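/- Let $n\ge 3$ be an integer, $\gamma>0$, $A>0$, $\theta^-<\frac{n-6}{4}<\theta^+$, $\eta_0>A$ and $b\in\mathbb R$. **Outer functions.** For $\eta>A$ let $\hat w_0(\eta)=(n-1)(n-2)\bigl[1-(\eta/A)^{-1/\gamma}\bigr]$, $f_1=-(n-1)\hat w_0''/\hat w_0$, $f_2=-(n-1)(\hat w_0')^2/\hat w_0^2$, and $$\hat w_1(\eta)=\frac{\eta_0^{2+1/\gamma}\,b}{\eta^{2+1/\gamma}}+\frac1{\eta^{2+1/\gamma}}\int_{\eta_0}^{\eta}\frac{f_1(x)}{\gamma}x^{1+1/\gamma}\,dx,\qquad \hat w_2(\eta)=-\frac1{\eta^{2+1/\gamma}}\int_\eta^\infty\frac{f_2(x)}{\gamma}x^{1+1/\gamma}\,dx .$$ Let $N=\lfloor 1/(2\gamma)\rfloor+1$ and $v_{k,l}(\eta)=\eta^{-2k-1/\gamma}(\ln\eta)^l$. Let $c_{1,1}=\frac{(n-1)(1+\gamma)}{\gamma^3}A^{1/\gamma}$, $c_{1,0}=\lim_{\eta\to\infty}\bigl(\eta^{2+1/\gamma}\hat w_1(\eta)-c_{1,1}\ln\eta\bigr)$,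 and for $2\le k\le N$ let $c_{k,0}=0$ and let $c_{k,1},\dots,c_{k,k}$ be determined recursively by $$\sum_{l=1}^k\gamma\, l\,c_{k,l}\,v_{k,l-1}+\frac1{n-2}\sum_{l=0}^{k-1}c_{k-1,l}\,v_{k-1,l}''=0 .$$ Put $$\hat w^\pm(\eta,\tau)=\hat w_0(\eta)+e^{-2\gamma\tau}\bigl(\hat w_1(\eta)+\theta^\pm\hat w_2(\eta)\bigr)+\sum_{k=2}^N e^{-2k\gamma\tau}\sum_{l=0}^k c_{k,l}v_{k,l}(\eta)$$ (the last sum is empty if $\gamma>1/2$). **Soliton.** Let $\bar w_0$ be the steady soliton profile, i.e. the positive smooth solution on all of $\mathbb R$ of $$(n-1)\Bigl(\frac{\bar w_{\xi\xi}}{\bar w}+\frac{n-6}{4}\frac{\bar w_\xi^2}{\bar w^2}\Bigr)-(n-1)(n-2)+\gamma A\,\bar w_\xi=0$$ with $\bar w_0(\xi)=\frac{(n-1)(n-2)}{\gamma A}\xi+\frac{(n-1)(n-6)}{4\gamma A}\frac1\xi+O(\xi^{-2})$ as $\xi\to\infty$. **Operator.** For a positive function $w(\xi,\tau)$ let $$I[w]=e^{-\gamma\tau}\bigl(w_\tau-(1+\gamma)w\bigr)-(n-1)\Bigl(\frac{w_{\xi\xi}}{w}+\frac{n-6}{4}\frac{w_\xi^2}{w^2}\Bigr)+(n-1)(n-2)-\gamma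 A\,w_\xi .$$ **Proposition.** Such a profile $\bar w_0$ exists. For every such profile there are $\tau_0\in\mathbb R$, $\xi_1>0$ and $\epsilon_1\in(0,1]$ such that for every $0<\epsilon<\epsilon_1$ the following holds. For each $\tau\ge\tau_0$ there are unique numbers $C_1(\tau),C_2(\tau)$ with $$e^{\gamma\tau}\hat w^+(A+\xi_1e^{-\gamma\tau},\tau)=\frac{\bar w_0(\xi_1+C_1(\tau))}{1+\epsilon},\qquad e^{\gamma\tau}\hat w^-(A+\xi_1e^{-\gamma\tau},\tau)=\frac{\bar w_0(\xi_1+C_2(\tau))}{1-\epsilon},$$ the functions $C_1,C_2$ are smooth on $[\tau_0,\infty)$, and there is $\tau_1=\tau_1(\epsilon)>\tau_0$ such that the functions $$w^+_\epsilon(\xi,\tau)=\begin{cases}\frac1{1+\epsilon}\bar w_0(\xi+C_1(\tau)),&\xi\le\xi_1,\\ e^{\gamma\tau}\hat w^+(A+\xi e^{-\gamma\tau},\tau),&\xi>\xi_1,\end{cases}\qquad w^-_\epsilon(\xi,\tau)=\begin{cases}\frac1{1-\epsilon}\bar w_0(\xi+C_2(\tau)),&\xi\le\xi_1,\\ e^{\gamma\tau}\hat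 w^-(A+\xi e^{-\gamma\tau},\tau),&\xi>\xi_1,\end{cases}$$ have the following properties: 1. $w^+_\epsilon>w^-_\epsilon>0$ on $\mathbb R\times[\tau_1,\infty)$; 2. $w^\pm_\epsilon$ are continuous on $\mathbb R\times[\tau_1,\infty)$ and smooth for $\xi\ne\xi_1$; 3. $I[w^+_\epsilon]>0$ and $I[w^-_\epsilon]<0$ at all $(\xi,\tau)$ with $\xi\ne\xi_1$, $\tau\ge\tau_1$; 4. for all $\tau\ge\tau_1$ the following one-sided limits exist and satisfy $$\lim_{\xi\to\xi_1^-}\partial_\xi w^+_\epsilon(\xi,\tau)>\lim_{\xi\to\xi_1^+}\partial_\xi w^+_\epsilon(\xi,\tau),\qquad \lim_{\xi\to\xi_1^-}\partial_\xi w^-_\epsilon(\xi,\tau)<\lim_{\xi\to\xi_1^+}\partial_\xi w^-_\epsilon(\xi,\tau).$$ -/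

import Mathlib

open Set Filter Topology MeasureTheory
open scoped ContDiff

noncomputable section

namespace YamabeBarrier

/-- The outer ansatz `ŵ₀(η) = (n-1)(n-2) (1 - (η/A)^(-1/γ))`, used for `η > A`. -/
def wHat0 (n : ℕ) (A γ η : ℝ) : ℝ :=
  ((n : ℝ) - 1) * ((n : ℝ) - 2) * (1 - (η / A) ^ (-(1 / γ)))

/-- `f₁ = -(n-1) ŵ₀'' / ŵ₀`. -/
def f1 (n : ℕ) (A γ η : ℝ) : ℝ :=
  -((n : ℝ) - 1) * (deriv (deriv (wHat0 n A γ)) η / wHat0 n A γ η)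

/-- `f₂ = -(n-1) (ŵ₀')² / ŵ₀²`. -/
def f2 (n : ℕ) (A γ η : ℝ) : ℝ :=
  -((n : ℝ) - 1) * ((deriv (wHat0 n A γ) η) ^ 2 / (wHat0 n A γ η) ^ 2)

/-- The solution `ŵ₁` on `η > A` of `γ η ŵ₁' + (1 + 2γ) ŵ₁ = f₁` with `ŵ₁(η₀) = b`. -/
def wHat1 (n : ℕ) (A γ η₀ b η : ℝ) : ℝ :=
  η₀ ^ (2 + 1 / γ) * b / η ^ (2 + 1 / γ) +
    1 / η ^ (2 + 1 / γ) * ∫ x in η₀..η, f1 n A γ x / γ * x ^ (1 + 1 / γ)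

/-- The positive solution `ŵ₂` on `η > A` of `γ η ŵ₂' + (1 + 2γ) ŵ₂ = f₂` given by integration
from infinity. -/
def wHat2 (n : ℕ) (A γ η : ℝ) : ℝ :=
  -(1 / η ^ (2 + 1 / γ)) * ∫ x in Ioi η, f2 n A γ x / γ * x ^ (1 + 1 / γ)

/-- `v_{k,l}(η) = η^(-2k-1/γ) (log η)^l`. -/
def v (γ : ℝ) (k l : ℕ) (η : ℝ) : ℝ :=
  η ^ (-(2 * (k : ℝ)) - 1 / γ) * Real.log η ^ l

/-- The coefficient of `v_{1,1}` in the expansion of `ŵ₁` at infinity. -/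
def leadCoeff (n : ℕ) (A γ : ℝ) : ℝ :=
  ((n : ℝ) - 1) * (1 + γ) / γ ^ 3 * A ^ (1 / γ)

/-- The coefficient of `v_{1,0}` in the expansion of `ŵ₁` at infinity, that is
`lim_{η → ∞} (η^(2+1/γ) ŵ₁(η) - leadCoeff * log η)`. -/
def constCoeff (n : ℕ) (A γ η₀ b : ℝ) : ℝ :=
  limUnder atTop fun η : ℝ =>
    η ^ (2 + 1 / γ) * wHat1 n A γ η₀ b η - leadCoeff n A γ * Real.log η

/-- The coefficients `c_{k,l}`. The row `k = 1` holds the expansion of `ŵ₁` at infinity. For `k ≥ 2`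
we have `c_{k,0} = 0`, and the other entries are determined by the cancellation
`∑_l γ l c_{k,l} v_{k,l-1} + (n-2)⁻¹ ∑_l c_{k-1,l} v_{k-1,l}'' = 0`, where, with
`r = 2(k-1) + 1/γ`,
`v_{k-1,l}'' = r (r+1) v_{k,l} - (2r+1) l v_{k,l-1} + l (l-1) v_{k,l-2}`. -/
def coeff (n : ℕ) (A γ η₀ b : ℝ) : ℕ → ℕ → ℝ
  | 0, _ => 0
  | 1, 0 => constCoeff n A γ η₀ b
  | 1, 1 => leadCoeff n A γ
  | 1, _ + 2 => 0
  | _ + 2, 0 => 0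
  | k + 2, l + 1 =>
      -((2 * ((k : ℝ) + 1) + 1 / γ) * (2 * ((k : ℝ) + 1) + 1 / γ + 1)
            * coeff n A γ η₀ b (k + 1) l
          - (2 * (2 * ((k : ℝ) + 1) + 1 / γ) + 1) * ((l : ℝ) + 1)
            * coeff n A γ η₀ b (k + 1) (l + 1)
          + ((l : ℝ) + 2) * ((l : ℝ) + 1) * coeff n A γ η₀ b (k + 1) (l + 2))
        / (((n : ℝ) - 2) * γ * ((l : ℝ) + 1))

/-- The number of correction terms: the smallest integer `N` with `γ > 1 / (2 N)`. It is `1` exactly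
when `γ > 1/2`, and then the sum in `wHat` is empty. -/
def corrOrder (γ : ℝ) : ℕ := ⌊1 / (2 * γ)⌋₊ + 1

/-- The outer barrier with parameter `θ`:
`ŵ₀ + e^(-2γτ) (ŵ₁ + θ ŵ₂)`, plus `∑_{k=2}^N e^(-2kγτ) ∑_{l=0}^k c_{k,l} v_{k,l}` if `γ ≤ 1/2`. -/
def wHat (n : ℕ) (A γ η₀ b θ η τ : ℝ) : ℝ :=
  wHat0 n A γ η + Real.exp (-2 * γ * τ) * (wHat1 n A γ η₀ b η + θ * wHat2 n A γ η) +
    ∑ k ∈ Finset.Icc 2 (corrOrder γ), Real.exp (-2 * (k : ℝ) * γ * τ) *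
      ∑ l ∈ Finset.range (k + 1), coeff n A γ η₀ b k l * v γ k l η

/-- The outer barrier in inner variables: `e^(γτ) ŵ(A + ξ e^(-γτ), τ)`. -/
def outerPart (n : ℕ) (A γ η₀ b θ ξ τ : ℝ) : ℝ :=
  Real.exp (γ * τ) * wHat n A γ η₀ b θ (A + ξ * Real.exp (-γ * τ)) τ

/-- The steady soliton profile: the positive entire solution of
`(n-1) (w''/w + (n-6)/4 (w'/w)²) - (n-1)(n-2) + γ A w' = 0`
whose translation is normalized by
`w(ξ) = (n-1)(n-2)/(γA) ξ + (n-1)(n-6)/(4γA) ξ⁻¹ + O(ξ⁻²)` as `ξ → ∞`. -/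
structure IsSteadySoliton (n : ℕ) (A γ : ℝ) (w : ℝ → ℝ) : Prop where
  smooth : ContDiff ℝ ∞ w
  pos : ∀ ξ, 0 < w ξ
  ode : ∀ ξ, ((n : ℝ) - 1) * (deriv (deriv w) ξ / w ξ
      + ((n : ℝ) - 6) / 4 * ((deriv w ξ) ^ 2 / (w ξ) ^ 2))
      - ((n : ℝ) - 1) * ((n : ℝ) - 2) + γ * A * deriv w ξ = 0
  asymp : (fun ξ : ℝ => w ξ - (((n : ℝ) - 1) * ((n : ℝ) - 2) / (γ * A) * ξ
      + ((n : ℝ) - 1) * ((n : ℝ) - 6) / (4 * γ * A) * (1 / ξ))) =O[atTop]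
      fun ξ : ℝ => 1 / ξ ^ 2

/-- The parabolic operator `I` in inner variables:
`e^(-γτ) (w_τ - (1+γ) w) - (n-1) (w_ξξ/w + (n-6)/4 w_ξ²/w²) + (n-1)(n-2) - γ A w_ξ`. -/
def innerOp (n : ℕ) (A γ : ℝ) (w : ℝ → ℝ → ℝ) (ξ τ : ℝ) : ℝ :=
  Real.exp (-γ * τ) * (deriv (fun t => w ξ t) τ - (1 + γ) * w ξ τ)
    - ((n : ℝ) - 1) * (deriv (deriv fun x => w x τ) ξ / w ξ τ
        + ((n : ℝ) - 6) / 4 * ((deriv (fun x => w x τ) ξ) ^ 2 / (w ξ τ) ^ 2))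
    + ((n : ℝ) - 1) * ((n : ℝ) - 2) - γ * A * deriv (fun x => w x τ) ξ

/-- `C` is the smooth shift on `[τ₀, ∞)` which makes `a⁻¹ w₀(ξ + C(τ))` agree with the outer
barrier at `ξ = ξ₁`; the equivalence says that `C(τ)` is the only value which does so. -/
def IsGluingShift (n : ℕ) (A γ η₀ b θ : ℝ) (w₀ : ℝ → ℝ) (a ξ₁ τ₀ : ℝ) (C : ℝ → ℝ) : Prop :=
  ContDiffOn ℝ ∞ C (Ici τ₀) ∧
    ∀ τ ∈ Ici τ₀, ∀ c : ℝ,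
      outerPart n A γ η₀ b θ ξ₁ τ = 1 / a * w₀ (ξ₁ + c) ↔ c = C τ

/-- The glued function: `a⁻¹ w₀(ξ + C(τ))` for `ξ ≤ ξ₁` and the outer barrier for `ξ > ξ₁`. -/
def glued (n : ℕ) (A γ η₀ b θ : ℝ) (w₀ : ℝ → ℝ) (a ξ₁ : ℝ) (C : ℝ → ℝ) (ξ τ : ℝ) : ℝ :=
  if ξ ≤ ξ₁ then 1 / a * w₀ (ξ + C τ) else outerPart n A γ η₀ b θ ξ τ

end YamabeBarrier

end

/-! Notation: `δ = e^(-γτ)`, `E = δ²`, `β = 1/γ`, `c = n - 2`, `κ = γA/(n-1)`, `P = (n-1)(n-2)`, `α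
= c/4 - 1 = (n-6)/4`. Each barrier joins a rescaled soliton near the tip to a formal expansion
outside. Both pieces carry a free parameter, the factor `1/a` with `a = 1 ± ε` inside and `θ`
outside. The signs of `a - 1` and of `θ - α` decide whether the piece is a supersolution or a
subsolution, and `θ - α` also decides the direction of the kink.

Inner piece. With `p = w'/w` the soliton equation becomes the planar system `w' = wp`, `p' = c(1 -
p²/4) - κwp` (`IsProfile`). A profile is found on the unstable curve of the equilibrium `(0, 2)`.
Every positive entire solution has `0 < p < 2` and `p` decreasing, since otherwise it would break
down in finite backward time. Hence `w` grows linearly and `w' = c/κ - α/(κt²) + o(t⁻²)`. Applied to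
`w(ξ + C(τ))/a` (`innerOp_inner`), the operator is `w/a` times `γAp(a - 1)` plus terms that vanish
as `τ → ∞`. On `ξ ≤ ξ₁` the function `p` is bounded below, so the sign is uniform.

Outer piece. All outer functions are expressed through `r = ratio A β η`, which solves a logistic
equation: `ŵ₀ = P/r`, with logarithmic derivative `G = β(r-1)/η`. By `innerOp_outerPart` and
`exists_nonlinear_error_le` the operator equals `(n-1)E((θ - α)G² - e)` with `|e| ≤ K(δ + δG)G²`.
Bernoulli's inequality gives `δG ≤ 1/ξ`, so `e` is negligible late and far out
(`exists_outerPart_sign`). If `γ ≤ 1/2`, the second derivative of the first correction is not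
controlled by `G²` at infinity. Each further correction cancels the second derivative of the
previous one, and the last leftover is `O(G²)`.

Matching. At fixed `ξ` the outer barrier tends to `(c/κ)ξ + θ/(κξ)`, with slope `c/κ - θ/(κξ²)`
(`tendsto_outerPart`, `tendsto_deriv_outerPart_space`). Where the soliton takes that value its slope
is `c/κ - α/(κξ²) + o(ξ⁻²)`. For large `ξ₁` the jump of the slope therefore has the sign of `θ - α`
(`IsProfile.eventually_slope_gap`). It persists for `a` near `1` and large `τ` (`exists_glued`). The
constants are chosen in the order `ξ₁`, `τ₀`, `ε₁`, `τ₁`.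

Ordering. The outer barrier increases with `θ` because `ŵ₂ > 0`. To the left of `ξ₁` the order
propagates because the quotient of two translates of the soliton is monotone. -/

namespace YamabeBarrier

/-! ### Tools for ordinary differential equations. -/

/-- A time-dependent vector field which is bounded and Lipschitz in space, locally uniformly in
time, has global integral curves. -/
theorem exists_global_integralCurve {E : Type*} [NormedAddCommGroup E] [NormedSpace ℝ E]
    [CompleteSpace E] {f : ℝ → E → E} (hc : ∀ x, Continuous fun t => f t x)
    (hb : ∀ T : ℝ, ∃ K L : NNReal, ∀ t ∈ Icc (-T) T, LipschitzWith K (f t) ∧ ∀ x, ‖f t x‖ ≤ L)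
    (t₀ : ℝ) (x₀ : E) : ∃ X : ℝ → E, X t₀ = x₀ ∧ ∀ t, HasDerivAt X (f t (X t)) t := by
  have key : ∀ k : ℕ, ∃ X : ℝ → E, X t₀ = x₀ ∧
      ∀ t ∈ Ioo (-(|t₀| + k + 1)) (|t₀| + k + 1), HasDerivAt X (f t (X t)) t := by
    intro k
    set T : ℝ := |t₀| + k + 1 with hT
    have hk : (0 : ℝ) ≤ k := k.cast_nonneg
    have ht₀ : t₀ ∈ Icc (-T) T := by
      rw [mem_Icc]; have := abs_le.1 (le_refl |t₀|); constructor <;> linarith [this.1, this.2]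
    obtain ⟨K, L, h⟩ := hb T
    have hT0 : 0 ≤ T := by positivity
    -- The radius `2TL` is at least the distance covered at speed `L` during the whole interval, so
    -- the solution cannot leave the ball.
    have hPL : IsPicardLindelof f (⟨t₀, ht₀⟩ : Icc (-T) T) x₀ (L * (2 * ⟨T, hT0⟩)) 0 L K :=
      { lipschitzOnWith := fun t ht => (h t ht).1.lipschitzOnWith
        continuousOn := fun x _ => (hc x).continuousOn
        norm_le := fun t ht x _ => (h t ht).2 x
        mul_max_le := by
          push_cast
          rw [sub_zero]
          refine mul_le_mul_of_nonneg_left ?_ L.2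
          refine max_le ?_ ?_ <;> change _ ≤ 2 * T <;> linarith [ht₀.1, ht₀.2] }
    obtain ⟨X, hX0, hX⟩ := hPL.exists_eq_forall_mem_Icc_hasDerivWithinAt₀
    exact ⟨X, hX0, fun t ht => (hX t (Ioo_subset_Icc_self ht)).hasDerivAt (Icc_mem_nhds ht.1 ht.2)⟩
  choose X hX0 hX using key
  have heq : ∀ j k : ℕ, j ≤ k → EqOn (X j) (X k) (Ioo (-(|t₀| + j + 1)) (|t₀| + j + 1)) := by
    intro j k hjk
    have hjk' : (j : ℝ) ≤ k := by exact_mod_cast hjk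
    have hj : (0 : ℝ) ≤ j := j.cast_nonneg
    obtain ⟨K, L, h⟩ := hb (|t₀| + j + 1)
    refine ODE_solution_unique_of_mem_Ioo (v := f) (s := fun _ => univ) (K := K) (t₀ := t₀)
      (fun t ht => (h t (Ioo_subset_Icc_self ht)).1.lipschitzOnWith) ?_ (fun t ht => ⟨hX j t ht, trivial⟩)
      (fun t ht => ⟨hX k t ⟨by linarith [ht.1], by linarith [ht.2]⟩, trivial⟩) ((hX0 j).trans (hX0 k).symm)
    have := abs_le.1 (le_refl |t₀|)
    constructor <;> linarith [this.1, this.2]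
  -- By uniqueness the local solutions agree on common intervals. Near `t` the single index `⌈|t|⌉₊
  -- + 1` represents all of them.
  refine ⟨fun t => X ⌈|t|⌉₊ t, hX0 _, fun t => ?_⟩
  set k := ⌈|t|⌉₊ + 1 with hk
  have hloc : ∀ s, |s| < |t| + 1 → X ⌈|s|⌉₊ s = X k s := by
    intro s hs
    refine heq _ _ ?_ ?_
    · rw [hk]
      have h1 : ⌈|s|⌉₊ ≤ ⌈|t| + 1⌉₊ := Nat.ceil_mono hs.le
      rwa [Nat.ceil_add_one (abs_nonneg t)] at h1
    · have h1 : |s| ≤ ⌈|s|⌉₊ := Nat.le_ceil _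
      have h2 := abs_nonneg t₀
      have h3 := abs_le.1 (le_refl |s|)
      constructor <;> linarith [h3.1, h3.2]
  have hev : (fun s => X ⌈|s|⌉₊ s) =ᶠ[𝓝 t] X k := by
    have : ∀ᶠ s in 𝓝 t, |s| < |t| + 1 :=
      continuous_abs.continuousAt.eventually_lt continuousAt_const (by linarith)
    filter_upwards [this] with s hs using hloc s hs
  have hd := hX k t ?_
  · change HasDerivAt _ (f t (X ⌈|t|⌉₊ t)) t
    rw [hloc t (by linarith)]
    exact hd.congr_of_eventuallyEq hev
  · have h1 : |t| ≤ ⌈|t|⌉₊ := Nat.le_ceil _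
    have h2 := abs_nonneg t₀
    have h3 := abs_le.1 (le_refl |t|)
    have h4 : (k : ℝ) = ⌈|t|⌉₊ + 1 := by rw [hk]; push_cast; ring
    constructor <;> linarith [h3.1, h3.2]

/-- If `f' ≤ 0` wherever `f > 0`, then `f` stays nonpositive. -/
theorem nonpos_of_deriv_nonpos_of_pos {f f' : ℝ → ℝ} {a b : ℝ} (hab : a ≤ b)
    (hf : ∀ t ∈ Icc a b, HasDerivAt f (f' t) t) (ha : f a ≤ 0)
    (h : ∀ t ∈ Icc a b, 0 < f t → f' t ≤ 0) : f b ≤ 0 := by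
  by_contra! hb
  set S := {t ∈ Icc a b | f t ≤ 0} with hS
  have hcont : ContinuousOn f (Icc a b) := fun t ht => (hf t ht).continuousAt.continuousWithinAt
  have hScl : IsClosed S := hcont.preimage_isClosed_of_isClosed isClosed_Icc isClosed_Iic
  have hSne : S.Nonempty := ⟨a, ⟨le_rfl, hab⟩, ha⟩
  have hSb : BddAbove S := ⟨b, fun t ht => ht.1.2⟩
  have hs := hScl.csSup_mem hSne hSb
  -- The last time at which `f ≤ 0`. Afterwards `f` is positive, hence nonincreasing, hence at most
  -- `f s`.
  set s := sSup S
  have hpos : ∀ t ∈ Ioc s b, 0 < f t := by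
    intro t ht
    by_contra! hle
    exact absurd (le_csSup hSb ⟨⟨hs.1.1.trans ht.1.le, ht.2⟩, hle⟩) (not_le.2 ht.1)
  have hanti : AntitoneOn f (Icc s b) := by
    refine antitoneOn_of_deriv_nonpos (convex_Icc s b)
      (hcont.mono (Icc_subset_Icc_left hs.1.1)) ?_ ?_
    · intro t ht
      rw [interior_Icc] at ht
      exact (hf t ⟨hs.1.1.trans ht.1.le, ht.2.le⟩).differentiableAt.differentiableWithinAt
    · intro t ht
      rw [interior_Icc] at ht
      have ht' : t ∈ Icc a b := ⟨hs.1.1.trans ht.1.le, ht.2.le⟩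
      rw [(hf t ht').deriv]
      exact h t ht' (hpos t ⟨ht.1, ht.2.le⟩)
  have := hanti ⟨le_rfl, hs.1.2⟩ ⟨hs.1.2, le_rfl⟩ hs.1.2
  linarith [hs.2]


/-! ### Existence of a profile on the unstable curve of the equilibrium `(0, 2)`. -/

/-- The first order system satisfied by a positive solution `w` of the soliton equation and its
logarithmic derivative `p`, with `c = n - 2` and `κ = γ A / (n - 1)`. -/
structure IsProfile (c κ : ℝ) (w p : ℝ → ℝ) : Prop where
  pos : ∀ t, 0 < w t
  deriv_w : ∀ t, HasDerivAt w (w t * p t) t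
  deriv_p : ∀ t, HasDerivAt p (c * (1 - p t ^ 2 / 4) - κ * w t * p t) t

/-- Truncation of a real number to `[0, b]`. -/
noncomputable def clamp (b x : ℝ) : ℝ := max 0 (min x b)

theorem clamp_nonneg (b x : ℝ) : 0 ≤ clamp b x := le_max_left _ _

theorem clamp_le {b : ℝ} (hb : 0 ≤ b) (x : ℝ) : clamp b x ≤ b := max_le hb (min_le_right _ _)

theorem clamp_of_mem {b x : ℝ} (h0 : 0 ≤ x) (h1 : x ≤ b) : clamp b x = x := by
  rw [clamp, min_eq_left h1, max_eq_right h0]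

theorem clamp_of_neg {b x : ℝ} (h0 : x ≤ 0) : clamp b x = 0 :=
  max_eq_left ((min_le_left _ _).trans h0)

theorem clamp_of_ge {b x : ℝ} (hb : 0 ≤ b) (h : b ≤ x) : clamp b x = b := by
  rw [clamp, min_eq_right h, max_eq_right hb]

theorem abs_clamp_sub_le (b x y : ℝ) : |clamp b x - clamp b y| ≤ |x - y| := by
  unfold clamp
  refine (abs_max_sub_max_le_max _ _ _ _).trans ?_
  rw [sub_self, abs_zero]
  refine max_le (abs_nonneg _) ((abs_min_sub_min_le_max _ _ _ _).trans ?_)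
  simp

/-- The profile system, with the first variable truncated to `[0, exp (2 t)]` and the second one
to `[0, 2]`. -/
noncomputable def truncField (c κ t : ℝ) (x : ℝ × ℝ) : ℝ × ℝ :=
  (clamp (Real.exp (2 * t)) x.1 * clamp 2 x.2,
    c * (1 - clamp 2 x.2 ^ 2 / 4) - κ * (clamp (Real.exp (2 * t)) x.1 * clamp 2 x.2))

theorem continuous_truncField (c κ : ℝ) (x : ℝ × ℝ) : Continuous fun t => truncField c κ t x := by
  unfold truncField clamp
  fun_prop

/-- These global bounds are the only purpose of the truncation, which is inactive inside
`trapRegion`. -/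
theorem truncField_bounds {c κ : ℝ} (hc : 0 < c) (hκ : 0 < κ) (T : ℝ) :
    ∃ K L : NNReal, ∀ t ∈ Icc (-T) T, LipschitzWith K (truncField c κ t) ∧
      ∀ x, ‖truncField c κ t x‖ ≤ L := by
  set B := Real.exp (2 * T) with hB
  have hB0 : 0 < B := Real.exp_pos _
  have hK : 0 ≤ (B + 2) * (1 + κ) + c := by positivity
  have hL : 0 ≤ 2 * B * (1 + κ) + c := by positivity
  refine ⟨⟨_, hK⟩, ⟨_, hL⟩, fun t ht => ?_⟩
  have hbB : Real.exp (2 * t) ≤ B := Real.exp_le_exp.2 (by linarith [ht.2])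
  constructor
  · refine LipschitzWith.of_dist_le_mul fun x y => ?_
    change _ ≤ ((B + 2) * (1 + κ) + c) * _
    have h1 : |x.1 - y.1| ≤ dist x y := le_max_left (dist x.1 y.1) _
    have h2 : |x.2 - y.2| ≤ dist x y := le_max_right (dist x.1 y.1) _
    have k1 := (abs_clamp_sub_le (Real.exp (2 * t)) x.1 y.1).trans h1
    have k2 := (abs_clamp_sub_le 2 x.2 y.2).trans h2
    unfold truncField
    have a1 := clamp_nonneg (Real.exp (2 * t)) x.1
    have a2 := (clamp_le (Real.exp_pos (2 * t)).le x.1).trans hbB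
    have a3 := clamp_nonneg 2 x.2
    have a4 := clamp_le zero_le_two x.2
    have a7 := clamp_nonneg 2 y.2
    have a8 := clamp_le zero_le_two y.2
    set x1 := clamp (Real.exp (2 * t)) x.1
    set y1 := clamp (Real.exp (2 * t)) y.1
    set x2 := clamp 2 x.2
    set y2 := clamp 2 y.2
    set d := dist x y
    have hd : 0 ≤ d := dist_nonneg
    have e1 : |x1 * x2 - y1 * y2| ≤ (B + 2) * d := by
      have : x1 * x2 - y1 * y2 = x1 * (x2 - y2) + y2 * (x1 - y1) := by ring
      rw [this]
      refine (abs_add_le _ _).trans ?_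
      rw [abs_mul, abs_mul, abs_of_nonneg a1, abs_of_nonneg a7]
      have := mul_le_mul a2 k2 (abs_nonneg _) hB0.le
      have := mul_le_mul a8 k1 (abs_nonneg _) zero_le_two
      linarith
    have e2 : |c * (1 - x2 ^ 2 / 4) - c * (1 - y2 ^ 2 / 4)| ≤ c * d := by
      have : c * (1 - x2 ^ 2 / 4) - c * (1 - y2 ^ 2 / 4) = c * ((x2 + y2) / 4 * (y2 - x2)) := by
        ring
      rw [this, abs_mul, abs_of_pos hc]
      refine mul_le_mul_of_nonneg_left ?_ hc.le
      rw [abs_mul, abs_of_nonneg (by positivity : 0 ≤ (x2 + y2) / 4), abs_sub_comm]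
      have := mul_le_mul (by linarith : (x2 + y2) / 4 ≤ 1) k2 (abs_nonneg _) zero_le_one
      linarith
    refine max_le ?_ ?_
    · change |x1 * x2 - y1 * y2| ≤ _
      have : 0 ≤ (B + 2) * κ * d := by positivity
      have : 0 ≤ c * d := by positivity
      nlinarith
    · change |c * (1 - x2 ^ 2 / 4) - κ * (x1 * x2) - (c * (1 - y2 ^ 2 / 4) - κ * (y1 * y2))| ≤ _
      have : c * (1 - x2 ^ 2 / 4) - κ * (x1 * x2) - (c * (1 - y2 ^ 2 / 4) - κ * (y1 * y2))
        = (c * (1 - x2 ^ 2 / 4) - c * (1 - y2 ^ 2 / 4)) + κ * (-(x1 * x2 - y1 * y2)) := by ring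
      rw [this]
      refine (abs_add_le _ _).trans ?_
      rw [abs_mul, abs_neg, abs_of_pos hκ]
      have := mul_le_mul_of_nonneg_left e1 hκ.le
      have : 0 ≤ (B + 2) * d := by positivity
      nlinarith
  · intro x
    change _ ≤ 2 * B * (1 + κ) + c
    unfold truncField
    have a1 := clamp_nonneg (Real.exp (2 * t)) x.1
    have a2 := (clamp_le (Real.exp_pos (2 * t)).le x.1).trans hbB
    have a3 := clamp_nonneg 2 x.2
    have a4 := clamp_le zero_le_two x.2
    set x1 := clamp (Real.exp (2 * t)) x.1
    set x2 := clamp 2 x.2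
    have e0 : 0 ≤ x1 * x2 := by positivity
    have e1 : x1 * x2 ≤ B * 2 := mul_le_mul a2 a4 a3 hB0.le
    have e2 : x2 ^ 2 ≤ 4 := by nlinarith
    have e3 : 0 ≤ B * κ := by positivity
    have e4 := mul_le_mul_of_nonneg_left e1 hκ.le
    have e5 : 0 ≤ κ * (x1 * x2) := by positivity
    refine max_le ?_ ?_
    · rw [Real.norm_eq_abs, abs_of_nonneg e0]
      nlinarith
    · rw [Real.norm_eq_abs, abs_le]
      have e6 : c * (1 - x2 ^ 2 / 4) ≤ c := by nlinarith [sq_nonneg x2]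
      have e7 : 0 ≤ c * (1 - x2 ^ 2 / 4) := mul_nonneg hc.le (by linarith)
      constructor <;> nlinarith

/-- A region which is forward invariant under the truncated system. -/
def trapRegion (κ t : ℝ) : Set (ℝ × ℝ) :=
  Icc (Real.exp (2 * t - κ * Real.exp (2 * t) / 2)) (Real.exp (2 * t)) ×ˢ
    (Icc 0 2 ∩ Ici (2 - κ * Real.exp (2 * t)))

theorem isClosed_trapRegion (κ t : ℝ) : IsClosed (trapRegion κ t) :=
  isClosed_Icc.prod (isClosed_Icc.inter isClosed_Ici)

/-- Along the unstable direction `w ≈ e^(2t)` and `p ≈ 2`. Each face is a one-sided differential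
inequality. In particular `p' ≥ -κwp ≥ -2κe^(2t)` gives `p ≥ 2 - κe^(2t)`, and integrating this in
`w'/w = p` bounds `w` from below, which keeps limits away from `w = 0`. -/
theorem trapRegion_forward_invariant {c κ : ℝ} (hc : 0 < c) (hκ : 0 < κ) {X : ℝ → ℝ × ℝ}
    (hX : ∀ t, HasDerivAt X (truncField c κ t (X t)) t) {s t : ℝ} (hst : s ≤ t)
    (hs : X s ∈ trapRegion κ s) : X t ∈ trapRegion κ t := by
  have h1 : ∀ t, HasDerivAt (fun t => (X t).1)
      (clamp (Real.exp (2 * t)) (X t).1 * clamp 2 (X t).2) t := fun t => (hX t).fst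
  have h2 : ∀ t, HasDerivAt (fun t => (X t).2) (c * (1 - clamp 2 (X t).2 ^ 2 / 4) -
      κ * (clamp (Real.exp (2 * t)) (X t).1 * clamp 2 (X t).2)) t := fun t => (hX t).snd
  have hE : ∀ t : ℝ, HasDerivAt (fun t => Real.exp (2 * t)) (2 * Real.exp (2 * t)) t := by
    intro t
    have := ((hasDerivAt_id t).const_mul 2).exp
    simpa [mul_comm] using this
  obtain ⟨⟨hs1, hs2⟩, ⟨hs3, hs4⟩, hs5⟩ := hs
  have hs5' : 2 - κ * Real.exp (2 * s) ≤ (X s).2 := hs5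
  have c0 : ∀ t, 0 ≤ clamp (Real.exp (2 * t)) (X t).1 := fun t => clamp_nonneg _ _
  have c1 : ∀ t, clamp (Real.exp (2 * t)) (X t).1 ≤ Real.exp (2 * t) :=
    fun t => clamp_le (Real.exp_pos _).le _
  have c2 : ∀ t, 0 ≤ clamp 2 (X t).2 := fun t => clamp_nonneg _ _
  have c3 : ∀ t, clamp 2 (X t).2 ≤ 2 := fun t => clamp_le zero_le_two _
  have c4 : ∀ t, clamp 2 (X t).2 ^ 2 ≤ 4 := fun t => by nlinarith [c2 t, c3 t]
  have c5 : ∀ t, clamp (Real.exp (2 * t)) (X t).1 * clamp 2 (X t).2 ≤ Real.exp (2 * t) * 2 :=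
    fun t => mul_le_mul (c1 t) (c3 t) (c2 t) (Real.exp_pos _).le
  have r1 : ∀ t, s ≤ t → (X t).2 - 2 ≤ 0 := by
    intro t ht
    refine nonpos_of_deriv_nonpos_of_pos (f := fun t => (X t).2 - 2)
      ht (fun x _ => (h2 x).sub_const 2) (by linarith) ?_
    intro x _ hx
    rw [clamp_of_ge zero_le_two (by linarith : 2 ≤ (X x).2)]
    nlinarith [c0 x]
  have r2 : ∀ t, s ≤ t → -(X t).2 ≤ 0 := by
    intro t ht
    refine nonpos_of_deriv_nonpos_of_pos (f := fun t => -(X t).2)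
      ht (fun x _ => (h2 x).neg) (by linarith) ?_
    intro x _ hx
    rw [clamp_of_neg (by linarith : (X x).2 ≤ 0)]
    nlinarith
  have r3 : ∀ t, s ≤ t → (X t).1 - Real.exp (2 * t) ≤ 0 := by
    intro t ht
    refine nonpos_of_deriv_nonpos_of_pos (f := fun t => (X t).1 - Real.exp (2 * t))
      ht (fun x _ => (h1 x).sub (hE x)) (by linarith) ?_
    intro x _ _
    nlinarith [c5 x]
  have r4 : ∀ t, s ≤ t → -(X t).1 ≤ 0 := by
    intro t ht
    refine nonpos_of_deriv_nonpos_of_pos (f := fun t => -(X t).1)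
      ht (fun x _ => (h1 x).neg) ?_ ?_
    · linarith [Real.exp_pos (2 * s - κ * Real.exp (2 * s) / 2)]
    intro x _ _
    nlinarith [mul_nonneg (c0 x) (c2 x)]
  have r5 : ∀ t, s ≤ t → 2 - κ * Real.exp (2 * t) - (X t).2 ≤ 0 := by
    intro t ht
    refine nonpos_of_deriv_nonpos_of_pos (f := fun t => 2 - κ * Real.exp (2 * t) - (X t).2)
      ht
      (fun x _ => (((hE x).const_mul κ).const_sub 2).sub (h2 x)) (by linarith) ?_
    intro x _ _
    have := mul_le_mul_of_nonneg_left (c5 x) hκ.le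
    have : 0 ≤ c * (1 - clamp 2 (X x).2 ^ 2 / 4) := mul_nonneg hc.le (by linarith [c4 x])
    linarith
  -- The logarithmic derivative of the product is `p - 2 + κe^(2t)`, nonnegative by `r5`. The
  -- earlier bounds make the clamps inactive.
  have r6 : ∀ t, s ≤ t →
      1 - (X t).1 * Real.exp (-(2 * t - κ * Real.exp (2 * t) / 2)) ≤ 0 := by
    intro t ht
    have hd : ∀ x : ℝ, HasDerivAt (fun t => Real.exp (-(2 * t - κ * Real.exp (2 * t) / 2)))
        (Real.exp (-(2 * x - κ * Real.exp (2 * x) / 2)) *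
          -(2 * 1 - κ * (2 * Real.exp (2 * x)) / 2)) x := fun x =>
      ((((hasDerivAt_id x).const_mul 2).sub (((hE x).const_mul κ).div_const 2)).neg).exp
    refine nonpos_of_deriv_nonpos_of_pos (f := fun t => 1 - (X t).1 * Real.exp (-(2 * t - κ * Real.exp (2 * t) / 2)))
      ht (fun x _ => ((h1 x).mul (hd x)).const_sub 1) ?_ ?_
    · rw [Real.exp_neg, ← div_eq_mul_inv, sub_nonpos, one_le_div (Real.exp_pos _)]
      exact hs1
    intro x hx _
    have hx1 := r1 x hx.1
    have hx2 := r2 x hx.1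
    have hx3 := r3 x hx.1
    have hx4 := r4 x hx.1
    have hx5 := r5 x hx.1
    rw [clamp_of_mem (by linarith) (by linarith), clamp_of_mem (by linarith) (by linarith)]
    have : 0 ≤ (X x).1 * Real.exp (-(2 * x - κ * Real.exp (2 * x) / 2)) *
        ((X x).2 - (2 - κ * Real.exp (2 * x))) :=
      mul_nonneg (mul_nonneg (by linarith) (Real.exp_pos _).le) (by linarith)
    nlinarith
  refine ⟨⟨?_, by linarith [r3 t hst]⟩, ⟨by linarith [r2 t hst], by linarith [r1 t hst]⟩, ?_⟩
  · have := r6 t hst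
    rwa [Real.exp_neg, ← div_eq_mul_inv, sub_nonpos, one_le_div (Real.exp_pos _)] at this
  · change 2 - κ * Real.exp (2 * t) ≤ (X t).2
    linarith [r5 t hst]

/-- Continuous dependence on the data at time `0`, backward in time. -/
theorem tendsto_backward_of_tendsto_zero {c κ : ℝ} (hc : 0 < c) (hκ : 0 < κ)
    {X : ℕ → ℝ → ℝ × ℝ} {Y : ℝ → ℝ × ℝ}
    (hX : ∀ j t, HasDerivAt (X j) (truncField c κ t (X j t)) t)
    (hY : ∀ t, HasDerivAt Y (truncField c κ t (Y t)) t)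
    (h0 : Tendsto (fun j => X j 0) atTop (𝓝 (Y 0))) {t : ℝ} (ht : t ≤ 0) :
    Tendsto (fun j => X j t) atTop (𝓝 (Y t)) := by
  obtain ⟨K, L, hKL⟩ := truncField_bounds hc hκ (-t)
  -- The Grönwall estimate runs forward, so time is reversed.
  have hrev : ∀ Z : ℝ → ℝ × ℝ, (∀ t, HasDerivAt Z (truncField c κ t (Z t)) t) →
      ∀ s, HasDerivAt (fun s => Z (-s)) (-truncField c κ (-s) (Z (-s))) s := by
    intro Z hZ s
    have := HasDerivAt.scomp s (hZ (-s)) (hasDerivAt_neg s)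
    rwa [neg_one_smul] at this
  have key : ∀ j, dist (X j t) (Y t) ≤ dist (X j 0) (Y 0) * Real.exp (K * (-t)) := by
    intro j
    have := dist_le_of_trajectories_ODE_of_mem (a := 0) (b := -t) (K := K)
      (v := fun s x => -truncField c κ (-s) x) (s := fun _ => univ)
      (f := fun s => X j (-s)) (g := fun s => Y (-s)) (δ := dist (X j 0) (Y 0))
      (fun s hs => ?_) (fun s _ => (hrev _ (hX j) s).continuousAt.continuousWithinAt)
      (fun s _ => (hrev _ (hX j) s).hasDerivWithinAt) (fun _ _ => trivial)
      (fun s _ => (hrev _ hY s).continuousAt.continuousWithinAt)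
      (fun s _ => (hrev _ hY s).hasDerivWithinAt) (fun _ _ => trivial) (by simp) (-t)
      ⟨by linarith, le_rfl⟩
    · simpa using this
    · exact ((hKL (-s) ⟨by linarith [hs.2], by linarith [hs.1, hs.2]⟩).1.neg).lipschitzOnWith
  rw [tendsto_iff_dist_tendsto_zero] at h0 ⊢
  refine squeeze_zero (fun _ => dist_nonneg) key ?_
  simpa using h0.mul_const (Real.exp (K * (-t)))

/-- The solution started at `(e^(-2j), 2)` at time `-j` stays in `trapRegion` from then on. By
compactness the values at time `0` subconverge, and the trajectory through the limit lies in
`trapRegion` for all times. -/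
theorem exists_isProfile {c κ : ℝ} (hc : 0 < c) (hκ : 0 < κ) : ∃ w p, IsProfile c κ w p := by
  have hglob := fun t₀ x₀ => exists_global_integralCurve (continuous_truncField c κ)
    (truncField_bounds hc hκ) t₀ x₀
  choose X hX0 hX using fun j : ℕ => hglob (-(j : ℝ)) (Real.exp (2 * -(j : ℝ)), 2)
  have hmem : ∀ j : ℕ, ∀ t, -(j : ℝ) ≤ t → X j t ∈ trapRegion κ t := by
    intro j t ht
    refine trapRegion_forward_invariant hc hκ (hX j) ht ?_
    rw [hX0]
    have : 0 < κ * Real.exp (2 * -(j : ℝ)) := mul_pos hκ (Real.exp_pos _)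
    refine ⟨⟨Real.exp_le_exp.2 ?_, le_rfl⟩, ⟨zero_le_two, le_rfl⟩, ?_⟩
    · linarith
    · change 2 - κ * Real.exp (2 * -(j : ℝ)) ≤ 2
      linarith
  have hcomp : IsCompact (trapRegion κ 0) :=
    isCompact_Icc.prod (isCompact_Icc.inter_right isClosed_Ici)
  obtain ⟨x, hx, φ, hφ, hlim⟩ := hcomp.tendsto_subseq
    (x := fun j => X j 0) (fun j => hmem j 0 (by simp))
  obtain ⟨Y, hY0, hY⟩ := hglob 0 x
  have hYmem : ∀ t, Y t ∈ trapRegion κ t := by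
    intro t
    rcases le_total 0 t with ht | ht
    · exact trapRegion_forward_invariant hc hκ hY ht (hY0 ▸ hx)
    · have hl := tendsto_backward_of_tendsto_zero hc hκ (X := fun j => X (φ j))
        (fun j => hX (φ j)) hY (by rw [hY0]; exact hlim) ht
      refine (isClosed_trapRegion κ t).mem_of_tendsto hl ?_
      filter_upwards [eventually_ge_atTop ⌈-t⌉₊] with j hj
      refine hmem _ _ ?_
      have h1 : -t ≤ j := Nat.ceil_le.1 hj
      have h2 : (j : ℝ) ≤ φ j := by exact_mod_cast hφ.id_le j
      linarith
  refine ⟨fun t => (Y t).1, fun t => (Y t).2, ?_, ?_, ?_⟩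
  · intro t
    exact (Real.exp_pos _).trans_le (hYmem t).1.1
  all_goals
    intro t
    obtain ⟨⟨h1, h2⟩, ⟨h3, h4⟩, -⟩ := hYmem t
    have h0 : 0 ≤ (Y t).1 := (Real.exp_pos _).le.trans h1
    have hd := hY t
    unfold truncField at hd
    rw [clamp_of_mem h0 h2, clamp_of_mem h3 h4] at hd
  · exact hd.fst
  · have := hd.snd
    rwa [← mul_assoc] at this


/-! ### Monotonicity and growth of an arbitrary profile. -/

namespace IsProfile

variable {c κ : ℝ} {w p : ℝ → ℝ}

/-- The set `p ≤ 2` is forward invariant, so `p > 2` would persist backward. There `(p - 2)' ≤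
-(c/4)(p - 2)²`, so `1/(p - 2)` would reach zero in finite backward time. -/
theorem p_le_two (h : IsProfile c κ w p) (hc : 0 < c) (hκ : 0 < κ) (t : ℝ) : p t ≤ 2 := by
  by_contra! ht
  have hback : ∀ s ≤ t, 2 < p s := by
    intro s hs
    by_contra! hle
    have := nonpos_of_deriv_nonpos_of_pos (f := fun x => p x - 2) hs
      (fun x _ => (h.deriv_p x).sub_const 2) (by linarith) ?_
    · linarith
    intro x _ hx
    have h1 : 0 < κ * w x * p x := mul_pos (mul_pos hκ (h.pos x)) (by linarith)
    have h2 : c * (1 - p x ^ 2 / 4) ≤ 0 := mul_nonpos_of_nonneg_of_nonpos hc.le (by nlinarith)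
    linarith
  set s := t - (4 / c) * (1 / (p t - 2)) with hs
  have hst : s ≤ t := by
    have : 0 ≤ (4 / c) * (1 / (p t - 2)) := by
      have : 0 < p t - 2 := by linarith
      positivity
    linarith
  have := nonpos_of_deriv_nonpos_of_pos
    (f := fun x => (p s - 2)⁻¹ - (p x - 2)⁻¹ + c / 4 * (x - s)) hst
    (fun x hx => ((((h.deriv_p x).sub_const 2).inv (by linarith [hback x hx.2])).const_sub _).add
      (((hasDerivAt_id x).sub_const s).const_mul (c / 4))) (by simp) ?_
  · have h1 : 0 < (p s - 2)⁻¹ := inv_pos.2 (by linarith [hback s hst])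
    have h2 : c / 4 * (t - s) = (p t - 2)⁻¹ := by
      rw [hs]; field_simp; ring
    rw [h2] at this
    linarith
  · intro x hx _
    have hx2 := hback x hx.2
    have h1 : 0 < κ * w x * p x := mul_pos (mul_pos hκ (h.pos x)) (by linarith)
    have h2 : 0 < (p x - 2) ^ 2 := by nlinarith
    have h3 : c / 4 ≤ -(c * (1 - p x ^ 2 / 4) - κ * w x * p x) / (p x - 2) ^ 2 := by
      rw [le_div_iff₀ h2]
      nlinarith
    have h4 : c / 4 * 1 = c / 4 := mul_one _
    linarith

/-- If `q = -p/w` were positive at `t`, it would stay above some `b > 0` at all earlier times. Since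
`(1/w)' = q`, the positive function `1/w` would then vanish in finite backward time. -/
theorem p_nonneg (h : IsProfile c κ w p) (hc : 0 < c) (hκ : 0 < κ) (t : ℝ) : 0 ≤ p t := by
  by_contra! ht
  have hwt := h.pos t
  have hd : ∀ x, HasDerivAt (fun x => -(p x / w x))
      (-(((c * (1 - p x ^ 2 / 4) - κ * w x * p x) * w x - p x * (w x * p x)) / w x ^ 2)) x :=
    fun x => ((h.deriv_p x).div (h.deriv_w x) (h.pos x).ne').neg
  -- The first entry puts `b` below `q(t)`. The second makes `q' < 0` wherever `q = b`, so `q ≤ b`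
  -- is forward invariant.
  set b := min (-(p t / w t) / 2) (κ / (c / 4 + 1)) with hb
  have hq : 0 < -(p t / w t) := by rw [← neg_div]; exact div_pos (by linarith) hwt
  have hb0 : 0 < b := lt_min (by linarith) (by positivity)
  have hb1 : b < -(p t / w t) := (min_le_left _ _).trans_lt (by linarith)
  have hb2 : b * (c / 4 + 1) ≤ κ := by
    rw [← le_div_iff₀ (by positivity)]; exact min_le_right _ _
  have hback : ∀ s ≤ t, b < -(p s / w s) := by
    intro s hs
    by_contra! hle
    have := image_le_of_deriv_right_lt_deriv_boundary' (f := fun x => -(p x / w x)) (a := s) (b := t)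
      (fun x _ => (hd x).continuousAt.continuousWithinAt)
      (fun x _ => (hd x).hasDerivWithinAt) (B := fun _ => b) (B' := fun _ => 0) hle
      continuousOn_const (fun x _ => hasDerivWithinAt_const _ _ _) ?_ (right_mem_Icc.2 hs)
    · exact absurd this (not_le.2 hb1)
    intro x _ hx
    have hw := h.pos x
    have hpx : p x = -(b * w x) := by
      have hx' : -(p x / w x) = b := hx
      rw [← hx']; field_simp
    rw [neg_lt_zero, hpx]
    have : (c * (1 - (-(b * w x)) ^ 2 / 4) - κ * w x * -(b * w x)) * w x
        - -(b * w x) * (w x * -(b * w x))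
        = w x * (c + b * w x ^ 2 * (κ - b * (c / 4 + 1))) := by ring
    rw [this]
    have : 0 ≤ b * w x ^ 2 * (κ - b * (c / 4 + 1)) :=
      mul_nonneg (by positivity) (by linarith)
    positivity
  set s := t - 1 / (b * w t) with hs
  have hst : s ≤ t := by
    have : 0 < 1 / (b * w t) := by positivity
    linarith
  have := nonpos_of_deriv_nonpos_of_pos
    (f := fun x => (w s)⁻¹ - (w x)⁻¹ + b * (x - s)) hst
    (fun x hx => (((h.deriv_w x).inv (h.pos x).ne').const_sub _).add
      (((hasDerivAt_id x).sub_const s).const_mul b)) (by simp) ?_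
  · have h1 : 0 < (w s)⁻¹ := inv_pos.2 (h.pos s)
    have h2 : b * (t - s) = (w t)⁻¹ := by
      rw [hs]; field_simp; ring
    rw [h2] at this
    linarith
  · intro x hx _
    have h1 := hback x hx.2
    have hw := h.pos x
    have h2 : -(-(w x * p x) / w x ^ 2) = p x / w x := by field_simp
    rw [h2]
    linarith

theorem p_pos (h : IsProfile c κ w p) (hc : 0 < c) (hκ : 0 < κ) (t : ℝ) : 0 < p t := by
  refine (h.p_nonneg hc hκ t).lt_of_ne fun h0 => ?_
  have hmin : IsLocalMin p t := Eventually.of_forall fun s => by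
    rw [← h0]; exact h.p_nonneg hc hκ s
  have := hmin.hasDerivAt_eq_zero (h.deriv_p t)
  rw [← h0] at this
  simp at this
  linarith

theorem p_lt_two (h : IsProfile c κ w p) (hc : 0 < c) (hκ : 0 < κ) (t : ℝ) : p t < 2 := by
  refine (h.p_le_two hc hκ t).lt_of_ne fun h0 => ?_
  have hmax : IsLocalMax p t := Eventually.of_forall fun s => by
    rw [h0]; exact h.p_le_two hc hκ s
  have := hmax.hasDerivAt_eq_zero (h.deriv_p t)
  rw [h0] at this
  have := mul_pos hκ (h.pos t)
  linarith

/-- `D = p'` satisfies `D' < 0` wherever `D > 0`. A positive value `D t` is therefore a lower bound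
for `p'` at all earlier times, and `p` would reach zero in finite backward time. -/
theorem deriv_p_nonpos (h : IsProfile c κ w p) (hc : 0 < c) (hκ : 0 < κ) (t : ℝ) :
    c * (1 - p t ^ 2 / 4) - κ * w t * p t ≤ 0 := by
  set D := fun t => c * (1 - p t ^ 2 / 4) - κ * w t * p t with hD
  have hd : ∀ x, HasDerivAt D (-(c / 2 * p x * D x) - κ * (w x * p x * p x + w x * D x)) x := by
    intro x
    have h1 := ((((h.deriv_p x).pow 2).div_const 4).const_sub 1).const_mul c
    have h2 := ((h.deriv_w x).const_mul κ).mul (h.deriv_p x)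
    refine (h1.sub h2).congr_deriv ?_
    simp only [hD]
    push_cast
    ring
  change D t ≤ 0
  by_contra! ht
  have hback : ∀ s ≤ t, D t ≤ D s := by
    intro s hs
    by_contra! hlt
    have := nonpos_of_deriv_nonpos_of_pos (f := fun x => D x - max (D s) 0) hs
      (fun x _ => (hd x).sub_const _) (by simp) ?_
    · have := max_lt hlt ht
      linarith
    intro x _ hx
    have hx0 : 0 < D x := (le_max_right (D s) 0).trans_lt (sub_pos.1 hx)
    have h1 := h.p_pos hc hκ x
    have h2 := h.pos x
    have : 0 < c / 2 * p x * D x := by positivity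
    have : 0 < κ * (w x * p x * p x + w x * D x) := by positivity
    linarith
  set s := t - p t / D t with hs
  have hst : s ≤ t := by
    have := div_pos (h.p_pos hc hκ t) ht
    linarith
  have := nonpos_of_deriv_nonpos_of_pos
    (f := fun x => p s - p x + D t * (x - s)) hst
    (fun x hx => ((h.deriv_p x).const_sub _).add
      (((hasDerivAt_id x).sub_const s).const_mul (D t))) (by simp) ?_
  · have h1 := h.p_pos hc hκ s
    have h2 : D t * (t - s) = p t := by
      rw [hs]; field_simp; ring
    rw [h2] at this
    linarith
  · intro x hx _
    have h1 := hback x hx.2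
    simp only [hD] at h1 ⊢
    linarith

theorem antitone_p (h : IsProfile c κ w p) (hc : 0 < c) (hκ : 0 < κ) : Antitone p :=
  antitone_of_deriv_nonpos (fun t => (h.deriv_p t).differentiableAt) fun t => by
    rw [(h.deriv_p t).deriv]; exact h.deriv_p_nonpos hc hκ t

theorem strictMono_w (h : IsProfile c κ w p) (hc : 0 < c) (hκ : 0 < κ) : StrictMono w :=
  strictMono_of_deriv_pos fun t => by
    rw [(h.deriv_w t).deriv]; exact mul_pos (h.pos t) (h.p_pos hc hκ t)

/-- Backward in time `p ≥ p 0`, so `w` decays at least exponentially. -/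
theorem tendsto_w_atBot (h : IsProfile c κ w p) (hc : 0 < c) (hκ : 0 < κ) :
    Tendsto w atBot (𝓝 0) := by
  have hp0 := h.p_pos hc hκ 0
  have hle : ∀ s ≤ 0, w s ≤ w 0 * Real.exp (p 0 * s) := by
    intro s hs
    have := nonpos_of_deriv_nonpos_of_pos
      (f := fun x => w s * Real.exp (-(p 0 * s)) - w x * Real.exp (-(p 0 * x))) hs
      (fun x hx => ((h.deriv_w x).mul
        (((hasDerivAt_id x).const_mul (p 0)).neg.exp)).const_sub _) (by simp) ?_
    · simp only [mul_zero, neg_zero, Real.exp_zero, mul_one] at this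
      rw [Real.exp_neg, ← div_eq_mul_inv, sub_nonpos, div_le_iff₀ (Real.exp_pos _)] at this
      exact this
    · intro x hx _
      have h1 := h.antitone_p hc hκ hx.2
      have : 0 ≤ w x * Real.exp (-(p 0 * x)) * (p x - p 0) :=
        mul_nonneg (mul_nonneg (h.pos x).le (Real.exp_pos _).le) (by linarith)
      change -(w x * p x * Real.exp (-(p 0 * x)) + w x * (Real.exp (-(p 0 * x)) * -(p 0 * 1))) ≤ 0
      linarith
  refine tendsto_of_tendsto_of_tendsto_of_le_of_le' tendsto_const_nhds
    (h := fun s => w 0 * Real.exp (p 0 * s)) ?_ (Eventually.of_forall fun s => (h.pos s).le) ?_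
  · have h1 : Tendsto (fun s => p 0 * s) atBot atBot := tendsto_id.const_mul_atBot hp0
    simpa using (Real.tendsto_exp_atBot.comp h1).const_mul (w 0)
  · filter_upwards [eventually_le_atBot 0] with s hs using hle s hs

/-- Linear growth of a profile at infinity. -/
theorem exists_growth (h : IsProfile c κ w p) (hc : 0 < c) (hκ : 0 < κ) :
    ∃ r R : ℝ, 0 < r ∧ 0 < R ∧ ∀ t, 0 ≤ t → r ≤ w t * p t ∧ w t * p t ≤ R ∧ r * t ≤ w t := by
  -- `p' ≤ 0` reads `κwp ≥ c(1 - p²/4)`, and `p ≤ p 0` on the half-line.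
  set r := c * (1 - p 0 ^ 2 / 4) / κ with hr
  have hp0 := h.p_pos hc hκ 0
  have hr0 : 0 < r := by
    have h1 := h.p_lt_two hc hκ 0
    have : 0 < 1 - p 0 ^ 2 / 4 := by nlinarith
    positivity
  have hlow : ∀ t, 0 ≤ t → r ≤ w t * p t := by
    intro t ht
    rw [hr, div_le_iff₀ hκ]
    have h1 := h.deriv_p_nonpos hc hκ t
    have h2 := h.antitone_p hc hκ ht
    have h3 := h.p_pos hc hκ t
    have h4 : p t ^ 2 ≤ p 0 ^ 2 := by nlinarith
    nlinarith
  -- `(wp)' = w(p² + c(1 - p²/4) - κwp)` is negative once `κwp > c + 4`, because `p ≤ 2`.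
  refine ⟨r, max (w 0 * p 0) ((c + 4) / κ), hr0, ?_, fun t ht => ⟨hlow t ht, ?_, ?_⟩⟩
  · exact lt_max_of_lt_left (mul_pos (h.pos 0) hp0)
  · have := nonpos_of_deriv_nonpos_of_pos
      (f := fun x => w x * p x - max (w 0 * p 0) ((c + 4) / κ)) ht
      (fun x hx => ((h.deriv_w x).mul (h.deriv_p x)).sub_const _) (by simp) ?_
    · linarith
    intro x _ hx
    have h1 : (c + 4) / κ < w x * p x := (le_max_right _ _).trans_lt (sub_pos.1 hx)
    rw [div_lt_iff₀ hκ] at h1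
    have h2 := h.p_pos hc hκ x
    have h3 := h.p_lt_two hc hκ x
    have h4 : p x ^ 2 ≤ 4 := by nlinarith
    have h5 := h.pos x
    have : w x * p x * p x + w x * (c * (1 - p x ^ 2 / 4) - κ * w x * p x)
      = w x * (p x ^ 2 + c - c * p x ^ 2 / 4 - w x * p x * κ) := by ring
    rw [this]
    refine mul_nonpos_of_nonneg_of_nonpos h5.le ?_
    have : 0 ≤ c * p x ^ 2 := by positivity
    linarith
  · have := nonpos_of_deriv_nonpos_of_pos
      (f := fun x => r * x - w x) ht
      (fun x hx => ((hasDerivAt_id x).const_mul r).sub (h.deriv_w x))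
      (by simpa using (h.pos 0).le) ?_
    · linarith
    intro x hx _
    have := hlow x hx.1
    linarith

theorem tendsto_w_atTop (h : IsProfile c κ w p) (hc : 0 < c) (hκ : 0 < κ) :
    Tendsto w atTop atTop := by
  obtain ⟨r, R, hr, -, hb⟩ := h.exists_growth hc hκ
  refine tendsto_atTop_mono' atTop ?_ (tendsto_id.const_mul_atTop hr)
  filter_upwards [eventually_ge_atTop 0] with t ht using (hb t ht).2.2

theorem exists_p_le (h : IsProfile c κ w p) (hc : 0 < c) (hκ : 0 < κ) :
    ∃ R : ℝ, 0 < R ∧ ∀ t, 0 < t → p t ≤ R / t := by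
  obtain ⟨r, R, hr, hR, hb⟩ := h.exists_growth hc hκ
  refine ⟨R / r, by positivity, fun t ht => ?_⟩
  obtain ⟨-, h2, h3⟩ := hb t ht.le
  have h4 := h.p_pos hc hκ t
  rw [div_div, le_div_iff₀ (by positivity)]
  nlinarith

/-- The deviation of `w'` from its second order expansion. -/
theorem hasDerivAt_defect (h : IsProfile c κ w p) (hκ : 0 < κ) (t : ℝ) :
    HasDerivAt (fun t => w t * p t - c / κ + (c / 4 - 1) / κ * p t ^ 2)
      (-(κ * w t + 2 * (c / 4 - 1) * p t) *
        (w t * p t - c / κ + (c / 4 - 1) / κ * p t ^ 2) - 2 * (c / 4 - 1) / κ * p t ^ 3) t := by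
  -- Calling the defect `g`, the profile equation is `w'' = -κwg`, equivalently `p' = -κg - p²`.
  -- Hence the equation for `g` is linear with damping about `κw` and a forcing cubic in `p`.
  have h1 := (((h.deriv_w t).mul (h.deriv_p t)).sub_const (c / κ)).add
    (((h.deriv_p t).pow 2).const_mul ((c / 4 - 1) / κ))
  refine h1.congr_deriv ?_
  field_simp
  push_cast
  ring

/-- The damping grows linearly in `t` and the forcing is `O(t⁻³)`, so `±K/t³` are barriers for the
defect. -/
theorem exists_defect_le (h : IsProfile c κ w p) (hc : 0 < c) (hκ : 0 < κ) :
    ∃ K T : ℝ, 0 ≤ K ∧ 1 ≤ T ∧ ∀ t, T ≤ t →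
      |w t * p t - c / κ + (c / 4 - 1) / κ * p t ^ 2| ≤ K / t ^ 3 := by
  obtain ⟨r, R₀, hr, -, hgr⟩ := h.exists_growth hc hκ
  obtain ⟨R, hR, hpR⟩ := h.exists_p_le hc hκ
  set α := c / 4 - 1 with hα
  set g := fun t => w t * p t - c / κ + α / κ * p t ^ 2 with hg
  set b := κ * r / 2 with hbdef
  have hb0 : 0 < b := by positivity
  -- The entry `4|α|/b` lets half of `κw` absorb `2αp`. The entry `6/b` lets the damping dominate
  -- the derivative of the barrier.
  set T := max 1 (max (4 * |α| / b) (6 / b)) with hT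
  have hT1 : 1 ≤ T := le_max_left _ _
  set F := 2 * |α| / κ * R ^ 3 with hF
  have hF0 : 0 ≤ F := by positivity
  set K := max (|g T| * T ^ 3) (2 * F / b) with hK
  have hK0 : 0 ≤ K := le_max_of_le_right (by positivity)
  have hKg : |g T| ≤ K / T ^ 3 := by
    rw [le_div_iff₀ (by positivity)]; exact le_max_left _ _
  have hKF : 2 * F ≤ K * b := by
    rw [← div_le_iff₀ hb0]; exact le_max_right _ _
  have hrate : ∀ t, T ≤ t → b * t ≤ κ * w t + 2 * α * p t := by
    intro t ht
    have ht0 : 0 < t := by linarith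
    have h1 := (hgr t ht0.le).2.2
    have h2 : 4 * |α| ≤ t * b := by
      rw [← div_le_iff₀ hb0]
      exact ((le_max_left _ _).trans (le_max_right _ _)).trans ht
    have h3 := h.p_pos hc hκ t
    have h4 := h.p_le_two hc hκ t
    have h5 : -(|α| * 2) ≤ α * p t := by
      have := neg_abs_le (α * p t)
      rw [abs_mul, abs_of_pos h3] at this
      have := mul_le_mul_of_nonneg_left h4 (abs_nonneg α)
      linarith
    have h6 := mul_le_mul_of_nonneg_left h1 hκ.le
    rw [hbdef] at *
    nlinarith
  have hforce : ∀ t, T ≤ t → |2 * α / κ * p t ^ 3| ≤ F / t ^ 3 := by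
    intro t ht
    have ht0 : 0 < t := by linarith
    have h3 := h.p_pos hc hκ t
    have h4 := hpR t ht0
    rw [abs_mul, abs_div, abs_mul, abs_two, abs_of_pos hκ, abs_of_pos (by positivity : 0 < p t ^ 3),
      hF, mul_div_assoc _ (R ^ 3), ← div_pow]
    gcongr
  have hcmp : ∀ t, T ≤ t → F / t ^ 3 + 3 * K / t ^ 4 ≤ b * t * (K / t ^ 3) := by
    intro t ht
    have ht0 : 1 ≤ t := by linarith
    have htpos : 0 < t := by linarith
    have h6 : 6 ≤ t * b := by
      rw [← div_le_iff₀ hb0]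
      exact ((le_max_right _ _).trans (le_max_right _ _)).trans ht
    have h7 : F / t ^ 3 + 3 * K / t ^ 4 = (F * t + 3 * K) / t ^ 4 := by field_simp
    have h8 : b * t * (K / t ^ 3) = (b * K * t ^ 2) / t ^ 4 := by field_simp
    rw [h7, h8]
    gcongr
    have h9 : F * t ≤ K * b / 2 * t ^ 2 := by nlinarith [mul_nonneg hK0 hb0.le, mul_nonneg hF0 htpos.le]
    have h10 : 6 * K ≤ t * b * K * t := by
      have := mul_le_mul h6 ht0 zero_le_one (by linarith : 0 ≤ t * b)
      nlinarith
    nlinarith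
  have hinv : ∀ t, T ≤ t → HasDerivAt (fun t => K / t ^ 3) (-(3 * K / t ^ 4)) t := by
    intro t ht
    have ht0 : t ≠ 0 := by linarith
    have := (hasDerivAt_const t K).div (hasDerivAt_pow 3 t) (pow_ne_zero 3 ht0)
    refine this.congr_deriv ?_
    field_simp
    push_cast
    ring
  have hgd : ∀ t, HasDerivAt g (-(κ * w t + 2 * α * p t) * g t - 2 * α / κ * p t ^ 3) t :=
    fun t => h.hasDerivAt_defect hκ t
  refine ⟨K, T, hK0, hT1, fun t ht => abs_le.2 ⟨?_, ?_⟩⟩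
  · have := nonpos_of_deriv_nonpos_of_pos (f := fun x => -g x - K / x ^ 3) ht
      (fun x hx => (hgd x).neg.sub (hinv x hx.1)) (by linarith [neg_abs_le (g T)]) ?_
    · change -(K / t ^ 3) ≤ g t
      linarith
    intro x hx hpos
    have h1 := hrate x hx.1
    have h2 := neg_abs_le (2 * α / κ * p x ^ 3)
    have h2' := le_abs_self (2 * α / κ * p x ^ 3)
    have h3 := hforce x hx.1
    have h4 := hcmp x hx.1
    have hx0 : 0 < x := by linarith [hx.1]
    have h5 : 0 ≤ K / x ^ 3 := by positivity
    have h6 : b * x * (K / x ^ 3) ≤ (κ * w x + 2 * α * p x) * (-g x) :=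
      mul_le_mul h1 (by linarith) h5 ((by positivity : 0 ≤ b * x).trans h1)
    linarith
  · have := nonpos_of_deriv_nonpos_of_pos (f := fun x => g x - K / x ^ 3) ht
      (fun x hx => (hgd x).sub (hinv x hx.1)) (by linarith [le_abs_self (g T)]) ?_
    · change g t ≤ K / t ^ 3
      linarith
    intro x hx hpos
    have h1 := hrate x hx.1
    have h2 := neg_abs_le (2 * α / κ * p x ^ 3)
    have h3 := hforce x hx.1
    have h4 := hcmp x hx.1
    have hx0 : 0 < x := by linarith [hx.1]
    have h5 : 0 ≤ K / x ^ 3 := by positivity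
    have h6 : b * x * (K / x ^ 3) ≤ (κ * w x + 2 * α * p x) * (g x) :=
      mul_le_mul h1 (by linarith) h5 ((by positivity : 0 ≤ b * x).trans h1)
    linarith

end IsProfile


/-- A function whose derivative is `O(t^(-k-1))` converges at infinity, with rate `O(t^(-k))`. -/
theorem exists_limit_of_deriv_le {F F' : ℝ → ℝ} {C T : ℝ} {k : ℕ} (hk : 1 ≤ k) (hC : 0 ≤ C)
    (hT : 0 < T) (hF : ∀ t, T ≤ t → HasDerivAt F (F' t) t)
    (hF' : ∀ t, T ≤ t → |F' t| ≤ C / t ^ (k + 1)) :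
    ∃ L, ∀ t, T ≤ t → |F t - L| ≤ C / t ^ k := by
  have hk' : (1 : ℝ) ≤ k := by exact_mod_cast hk
  have hinv : ∀ t, T ≤ t → HasDerivAt (fun t => C / t ^ k) (-(k * (C / t ^ (k + 1)))) t := by
    intro t ht
    have ht0 : t ≠ 0 := by linarith
    obtain ⟨j, rfl⟩ := Nat.exists_eq_succ_of_ne_zero (by lia : k ≠ 0)
    refine ((hasDerivAt_const t C).div (hasDerivAt_pow (j + 1) t) (pow_ne_zero _ ht0)).congr_deriv ?_
    field_simp
    simp
    ring
  have hle : ∀ t, T ≤ t → C / t ^ (k + 1) ≤ k * (C / t ^ (k + 1)) := by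
    intro t ht
    have ht0 : 0 < t := by linarith
    have : 0 ≤ C / t ^ (k + 1) := by positivity
    nlinarith
  have hlow : ∀ s t, T ≤ s → s ≤ t → F s - C / s ^ k ≤ F t - C / t ^ k := by
    intro s t hs hst
    have := nonpos_of_deriv_nonpos_of_pos
      (f := fun x => F s - C / s ^ k - (F x - C / x ^ k)) hst
      (fun x hx => ((hF x (hs.trans hx.1)).sub (hinv x (hs.trans hx.1))).const_sub _) (by simp) ?_
    · linarith
    intro x hx _
    have h1 := neg_abs_le (F' x)
    have h2 := hF' x (hs.trans hx.1)
    have h3 := hle x (hs.trans hx.1)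
    linarith
  have hupp : ∀ s t, T ≤ s → s ≤ t → F t + C / t ^ k ≤ F s + C / s ^ k := by
    intro s t hs hst
    have := nonpos_of_deriv_nonpos_of_pos
      (f := fun x => (F x + C / x ^ k) - (F s + C / s ^ k)) hst
      (fun x hx => ((hF x (hs.trans hx.1)).add (hinv x (hs.trans hx.1))).sub_const _) (by simp) ?_
    · linarith
    intro x hx _
    have h1 := le_abs_self (F' x)
    have h2 := hF' x (hs.trans hx.1)
    have h3 := hle x (hs.trans hx.1)
    linarith
  have hcross : ∀ s t, T ≤ s → T ≤ t → F s - C / s ^ k ≤ F t + C / t ^ k := by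
    intro s t hs ht
    have h1 := hlow s (max s t) hs (le_max_left _ _)
    have h2 := hupp t (max s t) ht (le_max_right _ _)
    have h3 : 0 < max s t := by have := le_max_left s t; linarith
    have h4 : 0 ≤ C / max s t ^ k := by positivity
    linarith
  have hne : ((fun s => F s - C / s ^ k) '' Ici T).Nonempty := ⟨_, T, le_refl T, rfl⟩
  have hbdd : BddAbove ((fun s => F s - C / s ^ k) '' Ici T) := by
    refine ⟨F T + C / T ^ k, ?_⟩
    rintro _ ⟨s, hs, rfl⟩
    exact hcross s T hs le_rfl
  refine ⟨sSup ((fun s => F s - C / s ^ k) '' Ici T), fun t ht => abs_le.2 ⟨?_, ?_⟩⟩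
  · have : sSup ((fun s => F s - C / s ^ k) '' Ici T) ≤ F t + C / t ^ k := by
      refine csSup_le hne ?_
      rintro _ ⟨s, hs, rfl⟩
      exact hcross s t hs ht
    linarith
  · have := le_csSup hbdd ⟨t, ht, rfl⟩
    dsimp only at this
    linarith

/-! ### Linear and second order asymptotics of profiles. -/

namespace IsProfile

variable {c κ : ℝ} {w p : ℝ → ℝ}

/-- Adding `p/κ` cancels `w' - c/κ` up to a multiple of `p² = O(t⁻²)`. The derivative is thus
integrable at infinity and no logarithm arises. -/
theorem hasDerivAt_linear_defect (h : IsProfile c κ w p) (hκ : 0 < κ) (t : ℝ) :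
    HasDerivAt (fun t => w t - c / κ * t + p t / κ) (-(c / (4 * κ) * p t ^ 2)) t := by
  refine (((h.deriv_w t).sub ((hasDerivAt_id t).const_mul (c / κ))).add
    ((h.deriv_p t).div_const κ)).congr_deriv ?_
  field_simp
  ring

theorem translate (h : IsProfile c κ w p) (s : ℝ) :
    IsProfile c κ (fun t => w (t + s)) fun t => p (t + s) where
  pos _ := h.pos _
  deriv_w t := (h.deriv_w (t + s)).comp_add_const t s
  deriv_p t := (h.deriv_p (t + s)).comp_add_const t s

theorem exists_linear_asymptotics (h : IsProfile c κ w p) (hc : 0 < c) (hκ : 0 < κ) :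
    ∃ b K : ℝ, 0 ≤ K ∧ ∀ t, 1 ≤ t → |w t - c / κ * t - b| ≤ K / t := by
  obtain ⟨R, hR, hpR⟩ := h.exists_p_le hc hκ
  obtain ⟨b, hb⟩ := exists_limit_of_deriv_le (k := 1) le_rfl
    (C := c / (4 * κ) * R ^ 2) (by positivity) one_pos
    (fun _ _ => h.hasDerivAt_linear_defect hκ _) (fun t ht => by
      have ht0 : 0 < t := by linarith
      have h1 := hpR t ht0
      have h2 := h.p_pos hc hκ t
      rw [abs_neg, abs_of_nonneg (by positivity), mul_div_assoc, ← div_pow]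
      gcongr)
  refine ⟨b, c / (4 * κ) * R ^ 2 + R / κ, by positivity, fun t ht => ?_⟩
  have ht0 : 0 < t := by linarith
  have h1 := hb t ht
  rw [pow_one] at h1
  have h2 : |p t / κ| ≤ R / κ / t := by
    rw [abs_of_nonneg (div_nonneg (h.p_nonneg hc hκ t) hκ.le), div_right_comm]
    gcongr
    exact hpR t ht0
  have : w t - c / κ * t - b = (w t - c / κ * t + p t / κ - b) + -(p t / κ) := by ring
  rw [this, add_div]
  refine (abs_add_le _ _).trans (add_le_add h1 ?_)
  rwa [abs_neg]

theorem tendsto_div_id (h : IsProfile c κ w p) (hc : 0 < c) (hκ : 0 < κ) :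
    Tendsto (fun t => w t / t) atTop (𝓝 (c / κ)) := by
  obtain ⟨b, K, hK, hb⟩ := h.exists_linear_asymptotics hc hκ
  rw [tendsto_iff_dist_tendsto_zero]
  refine squeeze_zero' (Eventually.of_forall fun _ => dist_nonneg) (g := fun t => (K + |b|) / t) ?_
    (tendsto_const_nhds.div_atTop tendsto_id)
  filter_upwards [eventually_ge_atTop 1] with t ht
  have ht0 : 0 < t := by linarith
  rw [Real.dist_eq, le_div_iff₀ ht0, ← abs_of_pos ht0, ← abs_mul, abs_of_pos ht0]
  have h1 : (w t / t - c / κ) * t = (w t - c / κ * t - b) + b := by field_simp; ring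
  rw [h1]
  refine (abs_add_le _ _).trans (add_le_add ((hb t ht).trans ?_) le_rfl)
  exact div_le_self hK ht

theorem tendsto_p (h : IsProfile c κ w p) (hc : 0 < c) (hκ : 0 < κ) :
    Tendsto p atTop (𝓝 0) := by
  obtain ⟨R, hR, hpR⟩ := h.exists_p_le hc hκ
  refine squeeze_zero' (Eventually.of_forall fun t => h.p_nonneg hc hκ t) (g := fun t => R / t) ?_
    (tendsto_const_nhds.div_atTop tendsto_id)
  filter_upwards [eventually_gt_atTop 0] with t ht using hpR t ht

theorem tendsto_sq_mul_defect (h : IsProfile c κ w p) (hc : 0 < c) (hκ : 0 < κ) :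
    Tendsto (fun t => t ^ 2 * (w t * p t - c / κ + (c / 4 - 1) / κ * p t ^ 2)) atTop (𝓝 0) := by
  obtain ⟨K, T, hK, hT, hb⟩ := h.exists_defect_le hc hκ
  refine squeeze_zero_norm' (a := fun t => K / t) ?_ (tendsto_const_nhds.div_atTop tendsto_id)
  filter_upwards [eventually_ge_atTop T] with t ht
  have ht0 : 0 < t := by linarith
  rw [norm_mul, Real.norm_eq_abs, Real.norm_eq_abs, abs_of_pos (by positivity)]
  have : K / t = t ^ 2 * (K / t ^ 3) := by field_simp
  rw [this]
  gcongr
  exact hb t ht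

theorem tendsto_mul_p (h : IsProfile c κ w p) (hc : 0 < c) (hκ : 0 < κ) :
    Tendsto (fun t => t * p t) atTop (𝓝 1) := by
  have h1 : Tendsto (fun t => w t * p t) atTop (𝓝 (c / κ)) := by
    have hsq : Tendsto (fun t : ℝ => (t ^ 2)⁻¹) atTop (𝓝 0) :=
      (tendsto_pow_atTop two_ne_zero).inv_tendsto_atTop
    have := (((h.tendsto_sq_mul_defect hc hκ).mul hsq).sub
      (((h.tendsto_p hc hκ).pow 2).const_mul ((c / 4 - 1) / κ))).add_const (c / κ)
    simp only [ne_eq, OfNat.ofNat_ne_zero, not_false_eq_true, zero_pow, mul_zero, sub_zero,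
      zero_add] at this
    refine this.congr' ?_
    filter_upwards [eventually_gt_atTop 0] with t ht
    field_simp
    ring
  have h2 := h1.div (h.tendsto_div_id hc hκ) (by positivity)
  rw [div_self (by positivity)] at h2
  refine h2.congr' ?_
  filter_upwards [eventually_gt_atTop 0] with t ht
  have := (h.pos t).ne'
  simp only [Pi.div_apply]
  field_simp

/-- This is the form of the asymptotics used in the gluing. The limit is the same for all translates
of a profile. -/
theorem tendsto_sq_mul_deriv_sub (h : IsProfile c κ w p) (hc : 0 < c) (hκ : 0 < κ) :
    Tendsto (fun t => t ^ 2 * (w t * p t - c / κ)) atTop (𝓝 (-((c / 4 - 1) / κ))) := by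
  have := (h.tendsto_sq_mul_defect hc hκ).sub
    (((h.tendsto_mul_p hc hκ).pow 2).const_mul ((c / 4 - 1) / κ))
  simp only [one_pow, mul_one, zero_sub] at this
  refine this.congr fun t => ?_
  ring

/-- Without a constant term, the defect bound gives `p = 1/t + O(t⁻³)`. After subtracting `c/(4κt)`,
the derivative of the linear defect is `O(t⁻⁴)`, and the two `1/t` terms combine to `(c/4 - 1)/κ`.
-/
theorem exists_asymptotics (h : IsProfile c κ w p) (hc : 0 < c) (hκ : 0 < κ) {K₀ : ℝ}
    (hK₀ : 0 ≤ K₀) (h0 : ∀ t, 1 ≤ t → |w t - c / κ * t| ≤ K₀ / t) :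
    ∃ K T : ℝ, ∀ t, T ≤ t →
      |w t - (c / κ * t + (c / 4 - 1) / κ * (1 / t))| ≤ K / t ^ 2 := by
  obtain ⟨K₁, T₁, hK₁, hT₁, hg⟩ := h.exists_defect_le hc hκ
  obtain ⟨R, hR, hpR⟩ := h.exists_p_le hc hκ
  obtain ⟨r, R₀, hr, -, hgr⟩ := h.exists_growth hc hκ
  set a := |(c / 4 - 1) / κ| with ha
  set K₂ := (K₁ + a * R ^ 2 + K₀) / r with hK₂
  have hK₂0 : 0 ≤ K₂ := by positivity
  have hp : ∀ t, T₁ ≤ t → |p t - 1 / t| ≤ K₂ / t ^ 3 := by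
    intro t ht
    have ht1 : 1 ≤ t := hT₁.trans ht
    have ht0 : 0 < t := by linarith
    have hw := (hgr t ht0.le).2.2
    have hw0 := h.pos t
    have h1 : |p t - 1 / t| * (w t * t) ≤ (K₁ + a * R ^ 2 + K₀) / t := by
      rw [← abs_of_pos (mul_pos hw0 ht0), ← abs_mul]
      have e : (p t - 1 / t) * (w t * t) =
          (w t * p t - c / κ + (c / 4 - 1) / κ * p t ^ 2) * t
          + (-((c / 4 - 1) / κ * p t ^ 2) * t) + -(w t - c / κ * t) := by field_simp; ring
      rw [e]
      refine (abs_add_three _ _ _).trans ?_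
      rw [abs_neg, abs_mul, abs_mul, abs_of_pos ht0, abs_neg, abs_mul, ← ha,
        abs_of_nonneg (sq_nonneg (p t)), add_div, add_div]
      have e1 : |w t * p t - c / κ + (c / 4 - 1) / κ * p t ^ 2| * t ≤ K₁ / t := by
        calc _ ≤ K₁ / t ^ 3 * t := by gcongr; exact hg t ht
          _ = K₁ / t ^ 2 := by field_simp
          _ ≤ K₁ / t := by gcongr; nlinarith
      have e2 : a * p t ^ 2 * t ≤ a * R ^ 2 / t := by
        have hpp := h.p_pos hc hκ t
        calc _ ≤ a * (R / t) ^ 2 * t := by gcongr; exact hpR t ht0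
          _ = a * R ^ 2 / t := by field_simp
      exact add_le_add (add_le_add e1 e2) (h0 t ht1)
    have h2 : |p t - 1 / t| * (r * t * t) ≤ |p t - 1 / t| * (w t * t) := by gcongr
    have h3 := h2.trans h1
    rw [hK₂, div_div, le_div_iff₀ (by positivity)]
    rw [le_div_iff₀ ht0] at h3
    linarith
  set M := fun t => w t - c / κ * t + p t / κ with hM
  set K₃ := c / (4 * κ) * (K₂ * (R + 1)) with hK₃
  have hK₃0 : 0 ≤ K₃ := by positivity
  have hd : ∀ t, T₁ ≤ t → HasDerivAt (fun t => M t - c / (4 * κ) * t⁻¹)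
      (-(c / (4 * κ) * p t ^ 2) - c / (4 * κ) * (-(t ^ 2)⁻¹)) t := fun t ht =>
    (h.hasDerivAt_linear_defect hκ t).sub ((hasDerivAt_inv (by linarith : t ≠ 0)).const_mul _)
  obtain ⟨L, hL⟩ := exists_limit_of_deriv_le (k := 2) one_le_two hK₃0
    (by linarith : 0 < T₁) hd (fun t ht => by
      have ht1 : 1 ≤ t := hT₁.trans ht
      have ht0 : 0 < t := by linarith
      have e : -(c / (4 * κ) * p t ^ 2) - c / (4 * κ) * (-(t ^ 2)⁻¹)
          = -(c / (4 * κ) * ((p t - 1 / t) * (p t + 1 / t))) := by field_simp; ring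
      have hpp := h.p_pos hc hκ t
      rw [e, abs_neg, abs_mul, abs_mul, abs_of_pos (by positivity : 0 < c / (4 * κ)),
        abs_of_pos (by positivity : 0 < p t + 1 / t)]
      calc _ ≤ c / (4 * κ) * (K₂ / t ^ 3 * (R / t + 1 / t)) := by
            gcongr
            · exact hp t ht
            · exact hpR t ht0
        _ = K₃ / t ^ 4 := by rw [hK₃]; field_simp
        _ ≤ K₃ / t ^ (2 + 1) := by gcongr; norm_num)
  have hL0 : L = 0 := by
    have hlim0 : Tendsto (fun t => M t - c / (4 * κ) * t⁻¹) atTop (𝓝 0) := by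
      have hz : Tendsto (fun t => w t - c / κ * t) atTop (𝓝 0) := by
        refine squeeze_zero_norm' (a := fun t => K₀ / t) ?_
          (tendsto_const_nhds.div_atTop tendsto_id)
        filter_upwards [eventually_ge_atTop 1] with t ht using h0 t ht
      have := (hz.add ((h.tendsto_p hc hκ).div_const κ)).sub
        (tendsto_inv_atTop_zero.const_mul (c / (4 * κ)))
      simpa using this
    have hlimL : Tendsto (fun t => M t - c / (4 * κ) * t⁻¹) atTop (𝓝 L) := by
      rw [tendsto_iff_dist_tendsto_zero]
      refine squeeze_zero' (Eventually.of_forall fun _ => dist_nonneg) (g := fun t => K₃ / t ^ 2) ?_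
        (tendsto_const_nhds.div_atTop (tendsto_pow_atTop two_ne_zero))
      filter_upwards [eventually_ge_atTop T₁] with t ht using hL t ht
    exact tendsto_nhds_unique hlimL hlim0
  refine ⟨K₃ + K₂ / κ, T₁, fun t ht => ?_⟩
  have ht1 : 1 ≤ t := hT₁.trans ht
  have ht0 : 0 < t := by linarith
  have e : w t - (c / κ * t + (c / 4 - 1) / κ * (1 / t))
      = (M t - c / (4 * κ) * t⁻¹ - L) + -((p t - 1 / t) / κ) := by
    rw [hL0]; simp only [hM]; field_simp; ring
  rw [e, add_div]
  refine (abs_add_le _ _).trans (add_le_add (hL t ht) ?_)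
  rw [abs_neg, abs_div, abs_of_pos hκ, div_right_comm]
  gcongr
  refine (hp t ht).trans ?_
  gcongr; norm_num

/-! ### Smoothness of profiles and existence of the normalized soliton. -/

theorem contDiff (h : IsProfile c κ w p) : ContDiff ℝ ∞ w := by
  have key : ∀ k : ℕ, ContDiff ℝ k w ∧ ContDiff ℝ k p := by
    intro k
    induction k with
    | zero =>
      exact ⟨contDiff_zero.2 (continuous_iff_continuousAt.2 fun t => (h.deriv_w t).continuousAt),
        contDiff_zero.2 (continuous_iff_continuousAt.2 fun t => (h.deriv_p t).continuousAt)⟩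
    | succ k ih =>
      obtain ⟨hw, hp⟩ := ih
      have e1 : deriv w = fun t => w t * p t := funext fun t => (h.deriv_w t).deriv
      have e2 : deriv p = fun t => c * (1 - p t ^ 2 / 4) - κ * w t * p t :=
        funext fun t => (h.deriv_p t).deriv
      constructor
      · push_cast
        refine contDiff_succ_iff_deriv.2 ⟨fun t => (h.deriv_w t).differentiableAt, by simp, ?_⟩
        rw [e1]; exact hw.mul hp
      · push_cast
        refine contDiff_succ_iff_deriv.2 ⟨fun t => (h.deriv_p t).differentiableAt, by simp, ?_⟩
        rw [e2]
        exact (contDiff_const.mul (contDiff_const.sub ((hp.pow 2).div_const 4))).sub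
          ((contDiff_const.mul hw).mul hp)
  exact contDiff_infty.2 fun k => (key k).1

theorem deriv_deriv (h : IsProfile c κ w p) (t : ℝ) :
    deriv (deriv w) t = w t * (c - (c / 4 - 1) * p t ^ 2 - κ * (w t * p t)) := by
  have e1 : deriv w = fun t => w t * p t := funext fun t => (h.deriv_w t).deriv
  rw [e1]
  refine (((h.deriv_w t).mul (h.deriv_p t)).congr_deriv ?_).deriv
  ring

end IsProfile

theorem IsSteadySoliton.isProfile {n : ℕ} (hn : 3 ≤ n) {A γ : ℝ} {w : ℝ → ℝ}
    (h : IsSteadySoliton n A γ w) :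
    IsProfile ((n : ℝ) - 2) (γ * A / ((n : ℝ) - 1)) w fun t => deriv w t / w t := by
  have hn' : (3 : ℝ) ≤ n := by exact_mod_cast hn
  have hm : (n : ℝ) - 1 ≠ 0 := by linarith
  have hd : Differentiable ℝ w := h.smooth.differentiable (by simp)
  have hd' : Differentiable ℝ (deriv w) :=
    (contDiff_infty_iff_deriv.1 h.smooth).2.differentiable (by simp)
  refine ⟨h.pos, fun t => ?_, fun t => ?_⟩
  · have := (h.pos t).ne'
    refine (hd t).hasDerivAt.congr_deriv ?_
    field_simp
  · have hw := (h.pos t).ne'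
    refine ((hd' t).hasDerivAt.div (hd t).hasDerivAt hw).congr_deriv ?_
    have ode := h.ode t
    have e : deriv (deriv w) t = w t * (((n : ℝ) - 2) - γ * A / ((n : ℝ) - 1) * deriv w t
        - ((n : ℝ) - 6) / 4 * ((deriv w t) ^ 2 / (w t) ^ 2)) := by
      field_simp at ode ⊢
      linarith
    rw [e]
    field_simp
    ring

theorem exists_isSteadySoliton {n : ℕ} (hn : 3 ≤ n) {A γ : ℝ} (hγ : 0 < γ) (hA : 0 < A) :
    ∃ w, IsSteadySoliton n A γ w := by
  have hn' : (3 : ℝ) ≤ n := by exact_mod_cast hn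
  have hm : 0 < (n : ℝ) - 1 := by linarith
  have hc : 0 < (n : ℝ) - 2 := by linarith
  have hκ : 0 < γ * A / ((n : ℝ) - 1) := by positivity
  obtain ⟨w₁, p₁, h₁⟩ := exists_isProfile hc hκ
  obtain ⟨b, K, hK, hb⟩ := h₁.exists_linear_asymptotics hc hκ
  set c := (n : ℝ) - 2 with hcdef
  set κ := γ * A / ((n : ℝ) - 1) with hκdef
  -- The translation that removes the constant term `b` of the linear asymptotics.
  set s := -(b / (c / κ)) with hs
  have h := h₁.translate s
  obtain ⟨b', K', hK', hb'⟩ := h.exists_linear_asymptotics hc hκ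
  have hb'0 : b' = 0 := by
    have l1 : Tendsto (fun t => w₁ (t + s) - c / κ * t - b') atTop (𝓝 0) := by
      refine squeeze_zero_norm' (a := fun t => K' / t) ?_ (tendsto_const_nhds.div_atTop tendsto_id)
      filter_upwards [eventually_ge_atTop 1] with t ht using hb' t ht
    have l2 : Tendsto (fun t => w₁ t - c / κ * t - b) atTop (𝓝 0) := by
      refine squeeze_zero_norm' (a := fun t => K / t) ?_ (tendsto_const_nhds.div_atTop tendsto_id)
      filter_upwards [eventually_ge_atTop 1] with t ht using hb t ht
    have l3 : Tendsto (fun t => w₁ (t + s) - c / κ * t) atTop (𝓝 0) := by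
      refine (l2.comp (tendsto_atTop_add_const_right atTop s tendsto_id)).congr fun t => ?_
      simp only [Function.comp, id, hs]
      field_simp
      ring
    have l4 := tendsto_nhds_unique l1 (l3.sub_const b')
    linarith
  rw [hb'0] at hb'
  simp only [sub_zero] at hb'
  obtain ⟨K₁, T₁, hasy⟩ := h.exists_asymptotics hc hκ hK' hb'
  refine ⟨fun t => w₁ (t + s), h.contDiff, h.pos, fun t => ?_, ?_⟩
  · have h0 := (h.pos t).ne'
    rw [h.deriv_deriv t, (h.deriv_w t).deriv]
    field_simp
    rw [hκdef, hcdef]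
    field_simp
    ring
  · refine Asymptotics.IsBigO.of_bound K₁ ?_
    filter_upwards [eventually_ge_atTop T₁] with t ht
    have e1 : ((n : ℝ) - 1) * ((n : ℝ) - 2) / (γ * A) = c / κ := by
      rw [hκdef, hcdef]; field_simp
    have e2 : ((n : ℝ) - 1) * ((n : ℝ) - 6) / (4 * γ * A) = (c / 4 - 1) / κ := by
      rw [hκdef, hcdef]; field_simp; ring
    rw [e1, e2, Real.norm_of_nonneg (by positivity : 0 ≤ 1 / t ^ 2), mul_one_div K₁]
    exact hasy t ht


/-! ### Closed forms of the outer functions. -/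

/-- The ratio `(1 - (η/A)^(-β))⁻¹`, in terms of which all outer functions are expressed. -/
noncomputable def ratio (A β η : ℝ) : ℝ := (1 - (η / A) ^ (-β))⁻¹

section ratio

variable {A β η : ℝ}

theorem hasDerivAt_rpow_div (hA : 0 < A) (hη : 0 < η) (β : ℝ) :
    HasDerivAt (fun x : ℝ => (x / A) ^ (-β)) (-β * (η / A) ^ (-β) / η) η := by
  have h := ((hasDerivAt_id η).div_const A).rpow_const (p := -β) (Or.inl (by positivity))
  refine h.congr_deriv ?_
  simp only [id]
  rw [Real.rpow_sub_one (by positivity)]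
  field_simp

theorem rpow_div_mem (hA : 0 < A) (hβ : 0 < β) (hη : A < η) :
    0 < (η / A) ^ (-β) ∧ (η / A) ^ (-β) < 1 := by
  have h1 : 1 < η / A := (one_lt_div hA).2 hη
  exact ⟨Real.rpow_pos_of_pos (by linarith) _, Real.rpow_lt_one_of_one_lt_of_neg h1 (by linarith)⟩

theorem one_lt_ratio (hA : 0 < A) (hβ : 0 < β) (hη : A < η) : 1 < ratio A β η := by
  obtain ⟨h0, h1⟩ := rpow_div_mem hA hβ hη
  exact (one_lt_inv₀ (by linarith)).2 (by linarith)

theorem rpow_mul_ratio (hA : 0 < A) (hβ : 0 < β) (hη : A < η) :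
    (η / A) ^ (-β) * ratio A β η = ratio A β η - 1 := by
  obtain ⟨h0, h1⟩ := rpow_div_mem hA hβ hη
  have : 1 - (η / A) ^ (-β) ≠ 0 := by linarith
  unfold ratio
  field_simp
  ring

theorem rpow_neg_eq_ratio (hA : 0 < A) (hβ : 0 < β) (hη : A < η) :
    η ^ (-β) = (ratio A β η - 1) / (ratio A β η * A ^ β) := by
  have h := rpow_mul_ratio hA hβ hη
  have hr := one_lt_ratio hA hβ hη
  have hAβ := Real.rpow_pos_of_pos hA β
  rw [Real.div_rpow (by linarith) hA.le, Real.rpow_neg hA.le, div_inv_eq_mul] at h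
  rw [← h]
  have : ratio A β η ≠ 0 := by linarith
  field_simp

/-- Because of this logistic equation, powers of `η` times functions of `ratio` are stable under
differentiation. -/
theorem hasDerivAt_ratio (hA : 0 < A) (hβ : 0 < β) (hη : A < η) :
    HasDerivAt (ratio A β) (-β * ratio A β η * (ratio A β η - 1) / η) η := by
  obtain ⟨h0, h1⟩ := rpow_div_mem hA hβ hη
  have h2 : 1 - (η / A) ^ (-β) ≠ 0 := by linarith
  refine (((hasDerivAt_rpow_div hA (by linarith) β).const_sub 1).inv h2).congr_deriv ?_
  rw [← rpow_mul_ratio hA hβ hη, ratio]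
  have : η ≠ 0 := by linarith
  field_simp

theorem tendsto_ratio_atTop (hA : 0 < A) (hβ : 0 < β) :
    Tendsto (ratio A β) atTop (𝓝 1) := by
  have h1 : Tendsto (fun η : ℝ => (η / A) ^ (-β)) atTop (𝓝 0) :=
    (tendsto_rpow_neg_atTop hβ).comp (tendsto_id.atTop_div_const hA)
  have h2 := (h1.const_sub 1).inv₀ (by norm_num)
  simp only [sub_zero, inv_one] at h2
  exact h2

/-- Logarithmic derivative of `η ↦ (ratio A β η)⁻¹`, bounded through Bernoulli's inequality. -/
theorem rate_le (hA : 0 < A) (hβ : 0 < β) (hη : A < η) :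
    β * (ratio A β η - 1) / η ≤ 1 / (η - A) := by
  obtain ⟨h0, h1⟩ := rpow_div_mem hA hβ hη
  have hη0 : 0 < η := by linarith
  set x := η / A with hx
  have hx1 : 1 < x := (one_lt_div hA).2 hη
  -- With `x = η/A` and denominators cleared, the claim is exactly `x^(1+β) ≥ 1 + (1+β)(x - 1)`.
  have hb := one_add_mul_self_le_rpow_one_add (s := x - 1) (by linarith)
    (p := 1 + β) (by linarith)
  rw [add_sub_cancel, Real.rpow_add (by linarith), Real.rpow_one] at hb
  have hu : x ^ (-β) * x ^ β = 1 := by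
    rw [← Real.rpow_add (by linarith), neg_add_cancel, Real.rpow_zero]
  have h1u : 0 < 1 - x ^ (-β) := by linarith
  rw [← rpow_mul_ratio hA hβ hη, ratio, div_le_div_iff₀ hη0 (by linarith), ← hx,
    ← div_eq_mul_inv, ← mul_div_assoc, div_mul_eq_mul_div, div_le_iff₀ h1u]
  have e : η = x * A := by rw [hx]; field_simp
  rw [e]
  have h3 := mul_le_mul_of_nonneg_left hb h0.le
  have h4 : x ^ (-β) * (x * x ^ β) = x := by rw [mul_left_comm, hu, mul_one]
  rw [h4] at h3
  have h5 := mul_le_mul_of_nonneg_left h3 hA.le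
  nlinarith

theorem hasDerivAt_rpow_mul_comp_ratio {Φ : ℝ → ℝ} {Φ' : ℝ} (hA : 0 < A) (hβ : 0 < β) (hη : A < η)
    (ρ : ℝ) (hΦ : HasDerivAt Φ Φ' (ratio A β η)) :
    HasDerivAt (fun x => x ^ (-ρ) * Φ (ratio A β x))
      (η ^ (-(ρ + 1)) * (-ρ * Φ (ratio A β η) - β * ratio A β η * (ratio A β η - 1) * Φ')) η := by
  have hη0 : 0 < η := by linarith
  have h1 := Real.hasDerivAt_rpow_const (x := η) (p := -ρ) (Or.inl hη0.ne')
  have h2 := h1.mul (hΦ.comp η (hasDerivAt_ratio hA hβ hη))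
  refine h2.congr_deriv ?_
  have e : η ^ (-ρ) = η ^ (-(ρ + 1)) * η := by
    rw [← Real.rpow_add_one hη0.ne']; congr 1; ring
  have e' : η ^ (-ρ - 1) = η ^ (-(ρ + 1)) := by congr 1; ring
  rw [e, e']
  simp only [Function.comp]
  field_simp
  ring

end ratio

/-- `η^(-ρ) p(log η)` for a polynomial `p`. -/
noncomputable def powLog (ρ : ℝ) (p : Polynomial ℝ) (η : ℝ) : ℝ :=
  η ^ (-ρ) * p.eval (Real.log η)

theorem hasDerivAt_powLog (ρ : ℝ) (p : Polynomial ℝ) {η : ℝ} (hη : 0 < η) :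
    HasDerivAt (powLog ρ p)
      (powLog (ρ + 1) (Polynomial.derivative p - Polynomial.C ρ * p) η) η := by
  have h1 := Real.hasDerivAt_rpow_const (x := η) (p := -ρ) (Or.inl hη.ne')
  have h2 := h1.mul ((p.hasDerivAt (Real.log η)).comp η (Real.hasDerivAt_log hη.ne'))
  refine h2.congr_deriv ?_
  have e : η ^ (-ρ) = η ^ (-(ρ + 1)) * η := by
    rw [← Real.rpow_add_one hη.ne']; congr 1; ring
  have e' : η ^ (-ρ - 1) = η ^ (-(ρ + 1)) := by congr 1; ring
  rw [e, e']
  simp only [powLog, Function.comp, Polynomial.eval_sub, Polynomial.eval_mul, Polynomial.eval_C]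
  field_simp
  ring

theorem exists_abs_log_pow_le {A : ℝ} (hA : 0 < A) {σ : ℝ} (hσ : 0 < σ) (l : ℕ) :
    ∃ C, 0 ≤ C ∧ ∀ η, A ≤ η → |Real.log η ^ l| ≤ C * η ^ σ := by
  have hlim : Tendsto (fun x : ℝ => Real.log x ^ l / x ^ σ) atTop (𝓝 0) := by
    have := (isLittleO_log_rpow_rpow_atTop l hσ).tendsto_div_nhds_zero
    simpa using this
  have hcont : ContinuousOn (fun x : ℝ => Real.log x ^ l / x ^ σ) (Ici A) := by
    intro x hx
    have hx0 : 0 < x := hA.trans_le hx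
    exact (((Real.continuousAt_log hx0.ne').pow l).div
      (Real.continuousAt_rpow_const _ _ (Or.inl hx0.ne'))
      (Real.rpow_pos_of_pos hx0 _).ne').continuousWithinAt
  obtain ⟨M, hM⟩ := (eventually_atTop.1
    ((hlim.norm.eventually (gt_mem_nhds (by simp : ‖(0 : ℝ)‖ < 1)))))
  obtain ⟨C, hC⟩ := (isCompact_Icc (a := A) (b := M)).exists_bound_of_continuousOn
    (hcont.mono Icc_subset_Ici_self)
  refine ⟨max C 1, le_max_of_le_right zero_le_one, fun η hη => ?_⟩
  have hη0 : 0 < η := hA.trans_le hη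
  have hp := Real.rpow_pos_of_pos hη0 σ
  have key : ‖Real.log η ^ l / η ^ σ‖ ≤ max C 1 := by
    rcases le_total M η with h | h
    · exact (hM η h).le.trans (le_max_right _ _)
    · exact (hC η ⟨hη, h⟩).trans (le_max_left _ _)
  rwa [norm_div, Real.norm_of_nonneg hp.le, div_le_iff₀ hp] at key

theorem exists_abs_eval_log_le {A : ℝ} (hA : 0 < A) {σ : ℝ} (hσ : 0 < σ) (p : Polynomial ℝ) :
    ∃ C, 0 ≤ C ∧ ∀ η, A ≤ η → |p.eval (Real.log η)| ≤ C * η ^ σ := by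
  choose C hC0 hC using fun l => exists_abs_log_pow_le hA hσ l
  refine ⟨∑ l ∈ Finset.range (p.natDegree + 1), |p.coeff l| * C l,
    Finset.sum_nonneg fun l _ => mul_nonneg (abs_nonneg _) (hC0 l), fun η hη => ?_⟩
  rw [Polynomial.eval_eq_sum_range, Finset.sum_mul]
  refine (Finset.abs_sum_le_sum_abs _ _).trans (Finset.sum_le_sum fun l _ => ?_)
  rw [abs_mul, mul_assoc]
  exact mul_le_mul_of_nonneg_left (hC l η hη) (abs_nonneg _)

theorem exists_abs_powLog_le {A : ℝ} (hA : 0 < A) {ρ σ : ℝ} (hσ : σ < ρ) (p : Polynomial ℝ) :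
    ∃ C, 0 ≤ C ∧ ∀ η, A ≤ η → |powLog ρ p η| ≤ C * η ^ (-σ) := by
  obtain ⟨C, hC0, hC⟩ := exists_abs_eval_log_le hA (sub_pos.2 hσ) p
  refine ⟨C, hC0, fun η hη => ?_⟩
  have hη0 : 0 < η := hA.trans_le hη
  have hp := Real.rpow_pos_of_pos hη0 (-ρ)
  rw [powLog, abs_mul, abs_of_pos hp]
  refine (mul_le_mul_of_nonneg_left (hC η hη) hp.le).trans (le_of_eq ?_)
  rw [mul_left_comm, ← Real.rpow_add hη0]
  congr 2; ring

section closedForms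

variable {n : ℕ} {A γ η : ℝ}

theorem wHat0_eq (n : ℕ) (A γ η : ℝ) :
    wHat0 n A γ η = ((n : ℝ) - 1) * ((n : ℝ) - 2) / ratio A (1 / γ) η := by
  rw [wHat0, ratio, div_inv_eq_mul]

theorem hasDerivAt_wHat0 (hA : 0 < A) (hη : 0 < η) :
    HasDerivAt (wHat0 n A γ)
      (((n : ℝ) - 1) * ((n : ℝ) - 2) * (1 / γ * (η / A) ^ (-(1 / γ)) / η)) η := by
  refine (((hasDerivAt_rpow_div hA hη (1 / γ)).const_sub 1).const_mul _).congr_deriv ?_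
  ring

theorem deriv_wHat0 (hA : 0 < A) (hγ : 0 < γ) (hη : A < η) :
    deriv (wHat0 n A γ) η = ((n : ℝ) - 1) * ((n : ℝ) - 2) *
      (1 / γ * (ratio A (1 / γ) η - 1) / η) / ratio A (1 / γ) η := by
  rw [(hasDerivAt_wHat0 hA (hA.trans hη)).deriv, ← rpow_mul_ratio hA (by positivity) hη]
  have := one_lt_ratio hA (by positivity : 0 < 1 / γ) hη
  field_simp

theorem hasDerivAt_deriv_wHat0 (hA : 0 < A) (hγ : 0 < γ) (hη : A < η) :
    HasDerivAt (deriv (wHat0 n A γ)) (-(((n : ℝ) - 1) * ((n : ℝ) - 2) *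
      ((1 / γ) * (1 / γ + 1) * (ratio A (1 / γ) η - 1) / η ^ 2) / ratio A (1 / γ) η)) η := by
  have hη0 : 0 < η := hA.trans hη
  have h1 := (((hasDerivAt_rpow_div hA hη0 (1 / γ)).const_mul (1 / γ)).div (hasDerivAt_id η)
    hη0.ne').const_mul (((n : ℝ) - 1) * ((n : ℝ) - 2))
  have h2 : deriv (wHat0 n A γ) =ᶠ[𝓝 η] fun x =>
      ((n : ℝ) - 1) * ((n : ℝ) - 2) * (1 / γ * (x / A) ^ (-(1 / γ)) / x) := by
    filter_upwards [lt_mem_nhds hη0] with x hx using (hasDerivAt_wHat0 hA hx).deriv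
  refine (h1.congr_of_eventuallyEq h2).congr_deriv ?_
  rw [← rpow_mul_ratio hA (by positivity) hη]
  have := one_lt_ratio hA (by positivity : 0 < 1 / γ) hη
  simp only [id]
  field_simp
  ring

theorem f1_eq (hn : 3 ≤ n) (hA : 0 < A) (hγ : 0 < γ) (hη : A < η) :
    f1 n A γ η =
    ((n : ℝ) - 1) * (1 / γ * (1 / γ + 1) * (ratio A (1 / γ) η - 1) / η ^ 2) := by
  have hn' : (3 : ℝ) ≤ n := by exact_mod_cast hn
  have h1 : (n : ℝ) - 1 ≠ 0 := by linarith
  have h2 : (n : ℝ) - 2 ≠ 0 := by linarith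
  have h3 := one_lt_ratio hA (by positivity : 0 < 1 / γ) hη
  have h4 : 0 < η := hA.trans hη
  rw [f1, (hasDerivAt_deriv_wHat0 hA hγ hη).deriv, wHat0_eq]
  field_simp

theorem f2_eq (hn : 3 ≤ n) (hA : 0 < A) (hγ : 0 < γ) (hη : A < η) :
    f2 n A γ η =
    -(((n : ℝ) - 1) * (1 / γ * (ratio A (1 / γ) η - 1) / η) ^ 2) := by
  have hn' : (3 : ℝ) ≤ n := by exact_mod_cast hn
  have h1 : (n : ℝ) - 1 ≠ 0 := by linarith
  have h2 : (n : ℝ) - 2 ≠ 0 := by linarith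
  have h3 := one_lt_ratio hA (by positivity : 0 < 1 / γ) hη
  have h4 : 0 < η := hA.trans hη
  rw [f2, deriv_wHat0 hA hγ hη, wHat0_eq]
  field_simp

end closedForms


section closedForms

variable {n : ℕ} {A γ η η₀ b : ℝ}

theorem rpow_mul_ratio_sub_one (hA : 0 < A) {β : ℝ} (hβ : 0 < β) (hη : A < η) :
    η ^ β * (ratio A β η - 1) = A ^ β * ratio A β η := by
  have hη0 : 0 < η := hA.trans hη
  have h1 := rpow_neg_eq_ratio hA hβ hη
  have h2 := one_lt_ratio hA hβ hη
  have h3 := Real.rpow_pos_of_pos hη0 β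
  have h4 := Real.rpow_pos_of_pos hA β
  rw [Real.rpow_neg hη0.le] at h1
  field_simp at h1
  linarith

/-- The identity `η^β (r - 1) = A^β r` removes the power of `η` and leaves an integrand with an
elementary primitive. -/
theorem f1_integrand_eq (hn : 3 ≤ n) (hA : 0 < A) (hγ : 0 < γ) (hη : A < η) :
    f1 n A γ η / γ * η ^ (1 + 1 / γ) = leadCoeff n A γ * (ratio A (1 / γ) η / η) := by
  have hη0 : 0 < η := hA.trans hη
  have h := rpow_mul_ratio_sub_one hA (by positivity : 0 < 1 / γ) hη
  rw [f1_eq hn hA hγ hη, leadCoeff, Real.rpow_add hη0, Real.rpow_one]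
  have e : ((n : ℝ) - 1) * (1 / γ * (1 / γ + 1) * (ratio A (1 / γ) η - 1) / η ^ 2) / γ *
      (η * η ^ (1 / γ)) = ((n : ℝ) - 1) * (1 / γ * (1 / γ + 1)) / γ / η *
        (η ^ (1 / γ) * (ratio A (1 / γ) η - 1)) := by field_simp
  rw [e, h]
  field_simp

/-- The primitive of the integrand of `wHat1`. -/
theorem hasDerivAt_log_ratio (hA : 0 < A) (hγ : 0 < γ) (hη : A < η) :
    HasDerivAt (fun x => Real.log x - γ * Real.log (ratio A (1 / γ) x))
      (ratio A (1 / γ) η / η) η := by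
  have hη0 : 0 < η := hA.trans hη
  have hr := one_lt_ratio hA (by positivity : 0 < 1 / γ) hη
  refine ((Real.hasDerivAt_log hη0.ne').sub (((hasDerivAt_ratio hA (by positivity) hη).log
    (by linarith)).const_mul γ)).congr_deriv ?_
  field_simp
  ring

theorem continuousOn_ratio (hA : 0 < A) {β : ℝ} (hβ : 0 < β) : ContinuousOn (ratio A β) (Ioi A) :=
  fun _ hx => (hasDerivAt_ratio hA hβ hx).continuousAt.continuousWithinAt

/-- The constant term in the expansion of `wHat1` at infinity. -/
noncomputable def wHat1Const (n : ℕ) (A γ η₀ b : ℝ) : ℝ :=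
  η₀ ^ (2 + 1 / γ) * b -
    leadCoeff n A γ * (Real.log η₀ - γ * Real.log (ratio A (1 / γ) η₀))

/-- This separates `wHat1` into a part regular at `A`, which will be the correction with `k = 1`,
and the merely logarithmic singularity `log r`. -/
theorem wHat1_eq (hn : 3 ≤ n) (hA : 0 < A) (hγ : 0 < γ) (hη₀ : A < η₀) (hη : A < η) :
    wHat1 n A γ η₀ b η = η ^ (-(2 + 1 / γ)) * (wHat1Const n A γ η₀ b +
      leadCoeff n A γ * (Real.log η - γ * Real.log (ratio A (1 / γ) η))) := by
  have hη0 : 0 < η := hA.trans hη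
  have hsub : uIcc η₀ η ⊆ Ioi A := fun x hx => lt_of_lt_of_le (lt_min hη₀ hη) hx.1
  have hint : ∫ x in η₀..η, f1 n A γ x / γ * x ^ (1 + 1 / γ) =
      leadCoeff n A γ * (Real.log η - γ * Real.log (ratio A (1 / γ) η)) -
      leadCoeff n A γ * (Real.log η₀ - γ * Real.log (ratio A (1 / γ) η₀)) := by
    rw [intervalIntegral.integral_congr (g := fun x => leadCoeff n A γ * (ratio A (1 / γ) x / x))
      (fun x hx => f1_integrand_eq hn hA hγ (hsub hx))]
    refine intervalIntegral.integral_eq_sub_of_hasDerivAt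
      (fun x hx => (hasDerivAt_log_ratio hA hγ (hsub hx)).const_mul _) ?_
    refine ContinuousOn.intervalIntegrable ?_
    refine continuousOn_const.mul (((continuousOn_ratio hA (by positivity)).mono hsub).div
      continuousOn_id fun x hx => ?_)
    exact (hA.trans (hsub hx)).ne'
  rw [wHat1, hint, wHat1Const, Real.rpow_neg hη0.le]
  have := Real.rpow_pos_of_pos hη0 (2 + 1 / γ)
  field_simp
  ring

theorem constCoeff_eq (hn : 3 ≤ n) (hA : 0 < A) (hγ : 0 < γ) (hη₀ : A < η₀) :
    constCoeff n A γ η₀ b = wHat1Const n A γ η₀ b := by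
  refine Tendsto.limUnder_eq ?_
  have h1 : Tendsto (fun η => wHat1Const n A γ η₀ b -
      leadCoeff n A γ * (γ * Real.log (ratio A (1 / γ) η))) atTop
      (𝓝 (wHat1Const n A γ η₀ b - leadCoeff n A γ * (γ * Real.log 1))) :=
    ((((tendsto_ratio_atTop hA (by positivity : 0 < 1 / γ)).log one_ne_zero).const_mul γ).const_mul
      _).const_sub _
  simp only [Real.log_one, mul_zero, sub_zero] at h1
  refine h1.congr' ?_
  filter_upwards [eventually_gt_atTop A] with η hη
  have hη0 : 0 < η := hA.trans hη
  rw [wHat1_eq hn hA hγ hη₀ hη, ← mul_assoc (η ^ (2 + 1 / γ)), ← Real.rpow_add hη0, add_neg_cancel, Real.rpow_zero]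
  ring

/-- By the logistic equation and `η^β (r - 1) = A^β r`, the integrand is the derivative of a
multiple of `ratio`, which tends to `1` at infinity. The result has a simple pole at `η = A`. -/
theorem wHat2_eq (hn : 3 ≤ n) (hA : 0 < A) (hγ : 0 < γ) (hη : A < η) :
    wHat2 n A γ η = η ^ (-(2 + 1 / γ)) *
      (((n : ℝ) - 1) * (1 / γ) ^ 2 * A ^ (1 / γ) * (ratio A (1 / γ) η - 1)) := by
  have hη0 : 0 < η := hA.trans hη
  have hβ : 0 < 1 / γ := by positivity
  have hn' : (3 : ℝ) ≤ n := by exact_mod_cast hn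
  have hAβ := Real.rpow_pos_of_pos hA (1 / γ)
  set B := ((n : ℝ) - 1) * (1 / γ) ^ 2 * A ^ (1 / γ) with hB
  have hB0 : 0 < B := by
    have : 0 < (n : ℝ) - 1 := by linarith
    positivity
  have hint : ∫ x in Ioi η, f2 n A γ x / γ * x ^ (1 + 1 / γ) = B * 1 - B * ratio A (1 / γ) η := by
    have hd : ∀ x ∈ Ioi η, HasDerivAt (fun x => B * ratio A (1 / γ) x)
        (f2 n A γ x / γ * x ^ (1 + 1 / γ)) x := by
      intro x hx
      have hxA : A < x := hη.trans hx
      have hx0 : 0 < x := hA.trans hxA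
      refine ((hasDerivAt_ratio hA hβ hxA).const_mul B).congr_deriv ?_
      have h := rpow_mul_ratio_sub_one hA hβ hxA
      rw [f2_eq hn hA hγ hxA, Real.rpow_add hx0, Real.rpow_one]
      have e : -(((n : ℝ) - 1) * (1 / γ * (ratio A (1 / γ) x - 1) / x) ^ 2) / γ *
          (x * x ^ (1 / γ)) = -(((n : ℝ) - 1) * (1 / γ) ^ 2 * (ratio A (1 / γ) x - 1) / x / γ) *
            (x ^ (1 / γ) * (ratio A (1 / γ) x - 1)) := by field_simp
      rw [e, h, hB]
      field_simp
    refine integral_Ioi_of_hasDerivAt_of_nonpos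
      (((hasDerivAt_ratio hA hβ hη).const_mul B).continuousAt.continuousWithinAt) hd ?_
      ((tendsto_ratio_atTop hA hβ).const_mul B)
    intro x hx
    have hxA : A < x := hη.trans hx
    have hx0 : 0 < x := hA.trans hxA
    rw [f2_eq hn hA hγ hxA]
    have h1 := Real.rpow_pos_of_pos hx0 (1 + 1 / γ)
    have h2 : 0 ≤ ((n : ℝ) - 1) * (1 / γ * (ratio A (1 / γ) x - 1) / x) ^ 2 :=
      mul_nonneg (by linarith) (sq_nonneg _)
    rw [neg_div, neg_mul, neg_nonpos]
    positivity
  rw [wHat2, hint, Real.rpow_neg hη0.le]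
  have := Real.rpow_pos_of_pos hη0 (2 + 1 / γ)
  field_simp
  ring

/-- The part of `wHat1 + θ wHat2` which is singular at `η = A`, with
`k₁ = θ (n - 1) β² A^β` and `k₂ = (n - 1) β (β + 1) A^β`. -/
noncomputable def singPart (A β k₁ k₂ η : ℝ) : ℝ :=
  η ^ (-(2 + β)) * (k₁ * (ratio A β η - 1) - k₂ * Real.log (ratio A β η))

/-- The polynomial with coefficients `coeff k`. -/
noncomputable def corrPoly (n : ℕ) (A γ η₀ b : ℝ) (k : ℕ) : Polynomial ℝ :=
  ∑ l ∈ Finset.range (k + 1), Polynomial.C (coeff n A γ η₀ b k l) * Polynomial.X ^ l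

theorem coeff_eq_zero_of_lt (k l : ℕ) (h : k < l) : coeff n A γ η₀ b k l = 0 := by
  induction k using Nat.strong_induction_on generalizing l with
  | _ k ih =>
    match k, l, h with
    | 0, _, _ => rw [coeff]
    | 1, 0, h => omega
    | 1, 1, h => omega
    | 1, l + 2, _ => rw [coeff]
    | k + 2, 0, h => omega
    | k + 2, l + 1, h =>
      rw [coeff, ih (k + 1) (by omega) l (by omega), ih (k + 1) (by omega) (l + 1) (by omega),
        ih (k + 1) (by omega) (l + 2) (by omega)]
      simp

theorem coeff_corrPoly (k l : ℕ) :
    (corrPoly n A γ η₀ b k).coeff l = coeff n A γ η₀ b k l := by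
  rw [corrPoly, Polynomial.finsetSum_coeff]
  simp only [Polynomial.coeff_C_mul, Polynomial.coeff_X_pow]
  by_cases h : l < k + 1
  · rw [Finset.sum_eq_single l]
    · simp
    · intro j _ hj
      simp [hj.symm]
    · simp [h]
  · rw [Finset.sum_eq_zero, coeff_eq_zero_of_lt k l (by omega)]
    intro j hj
    rw [Finset.mem_range] at hj
    rw [if_neg (by omega), mul_zero]

theorem corrPoly_one : corrPoly n A γ η₀ b 1 =
    Polynomial.C (constCoeff n A γ η₀ b) + Polynomial.C (leadCoeff n A γ) * Polynomial.X := by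
  rw [corrPoly, Finset.sum_range_succ, Finset.sum_range_one, coeff, coeff]
  simp

/-- The recursion for the coefficients, as an identity of polynomials. -/
theorem derivative_corrPoly (hn : 3 ≤ n) (hγ : 0 < γ) (k : ℕ) {ρ : ℝ}
    (hρ : ρ = 2 * ((k : ℝ) + 1) + 1 / γ) :
    Polynomial.C (((n : ℝ) - 2) * γ) * Polynomial.derivative (corrPoly n A γ η₀ b (k + 2)) =
      -(Polynomial.derivative (Polynomial.derivative (corrPoly n A γ η₀ b (k + 1))
          - Polynomial.C ρ * corrPoly n A γ η₀ b (k + 1))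
        - Polynomial.C (ρ + 1) * (Polynomial.derivative (corrPoly n A γ η₀ b (k + 1))
          - Polynomial.C ρ * corrPoly n A γ η₀ b (k + 1))) := by
  have hn' : (3 : ℝ) ≤ n := by exact_mod_cast hn
  have h2 : (n : ℝ) - 2 ≠ 0 := by linarith
  ext l
  simp only [Polynomial.coeff_C_mul, Polynomial.coeff_neg, Polynomial.coeff_sub,
    Polynomial.coeff_derivative, coeff_corrPoly]
  rw [coeff, ← hρ]
  have : (l : ℝ) + 1 ≠ 0 := by positivity
  push_cast
  field_simp
  ring

theorem sum_coeff_mul_v (k : ℕ) :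
    ∑ l ∈ Finset.range (k + 1), coeff n A γ η₀ b k l * v γ k l η =
      powLog (2 * k + 1 / γ) (corrPoly n A γ η₀ b k) η := by
  rw [powLog, corrPoly, Polynomial.eval_finsetSum, Finset.mul_sum]
  refine Finset.sum_congr rfl fun l _ => ?_
  have e : -(2 * (k : ℝ)) - 1 / γ = -(2 * (k : ℝ) + 1 / γ) := by ring
  rw [v, e]
  simp
  ring

/-- The coefficient `k₁` of `singPart` for the outer barrier with parameter `θ`. -/
noncomputable def singCoeff₁ (n : ℕ) (A γ θ : ℝ) : ℝ :=
  θ * (((n : ℝ) - 1) * (1 / γ) ^ 2 * A ^ (1 / γ))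

/-- The coefficient `k₂` of `singPart` for the outer barrier. -/
noncomputable def singCoeff₂ (n : ℕ) (A γ : ℝ) : ℝ :=
  ((n : ℝ) - 1) * (1 / γ * (1 / γ + 1)) * A ^ (1 / γ)

/-- The perturbation `wHat - wHat0`, in terms of `E = exp (-2 γ τ)`. -/
noncomputable def pert (n : ℕ) (A γ η₀ b θ E η : ℝ) : ℝ :=
  E * singPart A (1 / γ) (singCoeff₁ n A γ θ) (singCoeff₂ n A γ) η +
    ∑ k ∈ Finset.range (⌊1 / (2 * γ)⌋₊ + 1), E ^ (k + 1) *
      powLog (2 * ((k : ℝ) + 1) + 1 / γ) (corrPoly n A γ η₀ b (k + 1)) η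

/-- The regular part of `wHat1` joins the sum of corrections as its first term, so that one formula
covers all of them and only `singPart` needs separate treatment. -/
theorem wHat_eq (hn : 3 ≤ n) (hA : 0 < A) (hγ : 0 < γ) (hη₀ : A < η₀) (hη : A < η) (θ τ : ℝ) :
    wHat n A γ η₀ b θ η τ =
      wHat0 n A γ η + pert n A γ η₀ b θ (Real.exp (-2 * γ * τ)) η := by
  have hexp : ∀ k : ℕ, Real.exp (-2 * (k : ℝ) * γ * τ) = Real.exp (-2 * γ * τ) ^ k := by
    intro k
    rw [← Real.exp_nat_mul]
    congr 1; ring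
  have hIcc : Finset.Icc 2 (⌊1 / (2 * γ)⌋₊ + 1) = Finset.Ico (0 + 2) (⌊1 / (2 * γ)⌋₊ + 2) := by
    ext k; simp; omega
  rw [wHat, pert, corrOrder, wHat1_eq hn hA hγ hη₀ hη, wHat2_eq hn hA hγ hη,
    Finset.sum_range_succ', hIcc, ← Finset.sum_Ico_add', ← Finset.range_eq_Ico]
  simp only [hexp, sum_coeff_mul_v]
  have e : leadCoeff n A γ * γ = ((n : ℝ) - 1) * (1 / γ * (1 / γ + 1)) * A ^ (1 / γ) := by
    rw [leadCoeff]; field_simp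
  have hsum : ∑ k ∈ Finset.range ⌊1 / (2 * γ)⌋₊, Real.exp (-2 * γ * τ) ^ (k + 2) *
      powLog (2 * ((k + 2 : ℕ) : ℝ) + 1 / γ) (corrPoly n A γ η₀ b (k + 2)) η =
      ∑ k ∈ Finset.range ⌊1 / (2 * γ)⌋₊, Real.exp (-2 * γ * τ) ^ (k + 1 + 1) *
      powLog (2 * (((k + 1 : ℕ) : ℝ) + 1) + 1 / γ) (corrPoly n A γ η₀ b (k + 1 + 1)) η := by
    refine Finset.sum_congr rfl fun k _ => ?_
    push_cast
    congr 2
    ring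
  rw [hsum, Nat.cast_zero, zero_add, zero_add, pow_one, mul_one, corrPoly_one,
    constCoeff_eq hn hA hγ hη₀, singPart, powLog, singCoeff₁, singCoeff₂, ← e]
  simp
  ring

end closedForms


/-! ### The nonlinear error of the outer expansion. -/

/-- Relative form of the error estimate: `x₀`, `x₁`, `y₂` are the relative sizes of the perturbation
and its derivatives. -/
theorem abs_relative_error_le {η r G h x₀ x₁ y₂ Q β α C₀ C₁ C₂ C₃ A : ℝ} (hA : 0 < A) (hη : A ≤ η)
    (hβ : 0 < β) (hr : 1 ≤ r) (hG : 0 ≤ G) (hrG : r - 1 = η * G / β) (hh0 : 0 ≤ h) (hh1 : h ≤ 1)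
    (hC₀ : 0 ≤ C₀) (hC₂ : 0 ≤ C₂)
    (h0 : |x₀| ≤ 1 / 2) (h1 : |x₁| ≤ 1 / 2) (hx₀ : |x₀| ≤ C₀ * h) (hx₀' : |x₀| ≤ C₀ * (G * h))
    (hx₁ : |x₁| ≤ C₁ * h) (hy₂ : |y₂| ≤ C₂ * h * (G ^ 2 + G / η))
    (hQ : |y₂ / r - Q| ≤ C₃ * h * G ^ 2) :
    |(-(β + 1) * (G / η) + y₂) / (1 + x₀) - -(β + 1) * (G / η) - Q +
        α * ((G * ((1 + x₁) / (1 + x₀))) ^ 2 - G ^ 2)| ≤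
      ((β + 1) / A * (2 * C₀) + C₂ * (4 + 2 * (1 / β + C₀ / A)) + C₃ +
        |α| * (12 * (C₀ + C₁))) * h * G ^ 2 := by
  have hη0 : 0 < η := hA.trans_le hη
  have hx := abs_le.1 h0
  have hd : 0 < 1 + x₀ := by linarith [hx.1]
  have hinv : 1 / (1 + x₀) ≤ 2 := by rw [div_le_iff₀ hd]; linarith [hx.1]
  have hr0 : 0 < r := by linarith
  have hC₀' : 0 ≤ C₀ * (G * h) := by positivity
  -- Four sources of error: the denominator under `ŵ₀''`, the replacement of `w` by its limit `P`
  -- under the second derivative of the perturbation, the part of that derivative not cancelled by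
  -- `Q`, and the gradient term.
  have e : (-(β + 1) * (G / η) + y₂) / (1 + x₀) - -(β + 1) * (G / η) - Q +
        α * ((G * ((1 + x₁) / (1 + x₀))) ^ 2 - G ^ 2) =
      (β + 1) * (G / η) * (x₀ * (1 / (1 + x₀))) + y₂ * ((r - 1 - x₀) / r * (1 / (1 + x₀)))
      + (y₂ / r - Q) + α * (G ^ 2 * ((x₁ - x₀) * (2 + x₁ + x₀) * (1 / (1 + x₀)) ^ 2)) := by
    field_simp
    ring
  have t1 : |(β + 1) * (G / η) * (x₀ * (1 / (1 + x₀)))| ≤ (β + 1) / A * (2 * C₀) * h * G ^ 2 := by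
    rw [abs_mul, abs_of_nonneg (by positivity : 0 ≤ (β + 1) * (G / η)), abs_mul,
      abs_of_pos (by positivity : 0 < 1 / (1 + x₀))]
    calc _ ≤ (β + 1) * (G / A) * (C₀ * (G * h) * 2) := by gcongr
      _ = _ := by ring
  have t2 : |y₂ * ((r - 1 - x₀) / r * (1 / (1 + x₀)))| ≤
      C₂ * (4 + 2 * (1 / β + C₀ / A)) * h * G ^ 2 := by
    -- Boundedness suffices against the `G²` part of `y₂`. Against the `G/η` part a factor `ηG` must
    -- be gained, and `r - 1 = ηG/β` supplies it in `b2`.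
    have b1 : |(r - 1 - x₀) / r| ≤ 2 := by
      rw [abs_div, abs_of_pos hr0, div_le_iff₀ hr0, abs_le]
      constructor <;> linarith [hx.1, hx.2]
    have b2 : |(r - 1 - x₀) / r| ≤ η * G * (1 / β + C₀ / A) := by
      rw [abs_div, abs_of_pos hr0, div_le_iff₀ hr0]
      have c1 : C₀ * (G * h) ≤ η * G * (C₀ / A) := by
        have : C₀ * (G * h) ≤ C₀ * (G * 1) := by gcongr
        refine this.trans ?_
        rw [mul_one, mul_div_assoc', le_div_iff₀ hA]
        have : 0 ≤ C₀ * G := by positivity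
        nlinarith
      have c2 : |r - 1 - x₀| ≤ η * G * (1 / β + C₀ / A) := by
        refine (abs_sub _ _).trans ?_
        rw [abs_of_nonneg (by linarith : 0 ≤ r - 1), hrG]
        have : η * G * (1 / β + C₀ / A) = η * G / β + η * G * (C₀ / A) := by ring
        linarith
      have : 0 ≤ η * G * (1 / β + C₀ / A) := by positivity
      nlinarith
    rw [abs_mul, abs_mul, abs_of_pos (by positivity : 0 < 1 / (1 + x₀))]
    have s1 : |(r - 1 - x₀) / r| * (1 / (1 + x₀)) ≤ 2 * 2 := by gcongr
    have s2 : |(r - 1 - x₀) / r| * (1 / (1 + x₀)) ≤ η * G * (1 / β + C₀ / A) * 2 := by gcongr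
    set s := |(r - 1 - x₀) / r| * (1 / (1 + x₀))
    have s0 : 0 ≤ s := by positivity
    calc |y₂| * s ≤ C₂ * h * (G ^ 2 + G / η) * s := by gcongr
      _ = C₂ * h * (G ^ 2 * s + G / η * s) := by ring
      _ ≤ C₂ * h * (G ^ 2 * (2 * 2) + G / η * (η * G * (1 / β + C₀ / A) * 2)) := by gcongr
      _ = _ := by field_simp; ring
  have t4 : |α * (G ^ 2 * ((x₁ - x₀) * (2 + x₁ + x₀) * (1 / (1 + x₀)) ^ 2))| ≤
      |α| * (12 * (C₀ + C₁)) * h * G ^ 2 := by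
    have hx' := abs_le.1 h1
    have b1 : |x₁ - x₀| ≤ (C₀ + C₁) * h := by
      refine (abs_sub _ _).trans ?_
      linarith
    have b2 : |2 + x₁ + x₀| ≤ 3 := by
      rw [abs_le]; constructor <;> linarith [hx.1, hx.2, hx'.1, hx'.2]
    have b3 : (1 / (1 + x₀)) ^ 2 ≤ 2 ^ 2 := by gcongr
    have b0 : 0 ≤ (C₀ + C₁) * h := (abs_nonneg _).trans b1
    rw [abs_mul, abs_mul, abs_mul, abs_mul, abs_of_nonneg (sq_nonneg G),
      abs_of_nonneg (sq_nonneg (1 / (1 + x₀)))]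
    calc _ ≤ |α| * (G ^ 2 * ((C₀ + C₁) * h * 3 * 2 ^ 2)) := by gcongr
      _ = _ := by ring
  rw [e]
  refine (abs_add_le _ _).trans ((add_le_add ((abs_add_three _ _ _).trans
    (add_le_add (add_le_add t1 t2) hQ)) t4).trans (le_of_eq ?_))
  ring

/-- The nonlinear error made by replacing `w₀` by `w₀ + z`. Here `δ² = E`, `P / r` is the value of
`wHat0` and `G` its logarithmic derivative. -/
theorem exists_nonlinear_error_le {A β P C : ℝ} (α : ℝ) (hA : 0 < A) (hβ : 0 < β) (hP : 0 < P)
    (hC : 0 ≤ C) : ∃ K h₀ : ℝ, 0 < K ∧ 0 < h₀ ∧ ∀ η r G δ z₀ z₁ z₂ Q : ℝ, A ≤ η → 1 < r →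
      G = β * (r - 1) / η → 0 < δ → δ + δ * G ≤ h₀ →
      |z₀| ≤ C / r * (δ ^ 2 * G ^ 2 + δ ^ 2 * G) →
      |z₁| ≤ C / (r * η) * (δ ^ 2 * G ^ 2 * r + δ ^ 2 * G) →
      |z₂| ≤ C / (r * η ^ 2) * (δ ^ 2 * G ^ 2 * r ^ 2 + δ ^ 2 * G) →
      |z₂ / P - Q| ≤ C * G ^ 2 * (δ ^ 2 * r / η ^ 2 + δ ^ 2) →
      P / r / 2 ≤ P / r + z₀ ∧
      |(-(β + 1) * (G / η) * (P / r) + z₂) / (P / r + z₀) - -(β + 1) * (G / η) - Q +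
        α * (((P * G / r + z₁) / (P / r + z₀)) ^ 2 - G ^ 2)| ≤ K * (δ + δ * G) * G ^ 2 := by
  set L := 1 / A + 1 / β with hL
  have hL0 : 0 < L := by positivity
  set C₀ := C / P with hC₀
  have hC₀0 : 0 ≤ C₀ := by positivity
  set C₁ := C / P * (L + 1 / A) with hC₁
  have hC₁0 : 0 ≤ C₁ := by positivity
  set C₂ := C / P * (L ^ 2 + 1 / A) with hC₂
  have hC₂0 : 0 ≤ C₂ := by positivity
  set C₃ := C * (L / A + 1) with hC₃
  have hC₃0 : 0 ≤ C₃ := by positivity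
  -- The threshold forces `|x₀|, |x₁| ≤ 1/2` and `h ≤ 1`. The final `+ 1` in the first constant
  -- makes it positive.
  refine ⟨(β + 1) / A * (2 * C₀) + C₂ * (4 + 2 * (1 / β + C₀ / A)) + C₃ +
        |α| * (12 * (C₀ + C₁)) + 1, 1 / (2 * (C₀ + C₁ + 1)), by positivity, by positivity, ?_⟩
  intro η r G δ z₀ z₁ z₂ Q hη hr hGr hδ hh hz₀ hz₁ hz₂ hzQ
  have hη0 : 0 < η := hA.trans_le hη
  have hr0 : 0 < r := by linarith
  have hG : 0 < G := by rw [hGr]; exact div_pos (mul_pos hβ (by linarith)) hη0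
  set h := δ + δ * G with hhdef
  have hδG : 0 < δ * G := by positivity
  have hh0 : 0 < h := by positivity
  have hhC : h * (2 * (C₀ + C₁ + 1)) ≤ 1 := by
    rwa [← le_div_iff₀ (by positivity)]
  have hh1 : h ≤ 1 := by
    have : 0 ≤ h * (C₀ + C₁) := by positivity
    linarith
  have hδh : δ ≤ h := by linarith
  have hδGh : δ * G ≤ h := by linarith
  have hδ1 : δ ≤ 1 := by linarith
  have hrG : r - 1 = η * G / β := by rw [hGr]; field_simp
  -- Although `r` blows up at `A`, `r = 1 + ηG/β` shows that `δr/η` is controlled by `δ + δG`.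
  have hδr : δ * r / η ≤ L * h := by
    have e : δ * r / η = δ * (1 / η) + δ * G * (1 / β) := by
      have : r = 1 + η * G / β := by linarith
      rw [this]; field_simp
    rw [e, hL, add_mul]
    have i1 : 1 / η ≤ 1 / A := by gcongr
    have := mul_le_mul hδh i1 (by positivity) hh0.le
    have := mul_le_mul_of_nonneg_right hδGh (by positivity : 0 ≤ 1 / β)
    linarith
  set x₀ := z₀ * r / P with hx₀def
  set x₁ := z₁ * r / (P * G) with hx₁def
  set y₂ := z₂ * r / P with hy₂def
  have hx₀b : |x₀| ≤ C₀ * (δ * G * h) := by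
    rw [hx₀def, abs_div, abs_mul, abs_of_pos hP, abs_of_pos hr0, div_le_iff₀ hP]
    calc _ ≤ C / r * (δ ^ 2 * G ^ 2 + δ ^ 2 * G) * r := by gcongr
      _ = _ := by rw [hC₀, hhdef]; field_simp; ring
  have hx₀ : |x₀| ≤ C₀ * h := by
    refine hx₀b.trans ?_
    gcongr
    exact mul_le_of_le_one_left hh0.le (hδGh.trans hh1)
  have hx₀' : |x₀| ≤ C₀ * (G * h) := by
    refine hx₀b.trans ?_
    gcongr
    exact mul_le_of_le_one_left hG.le hδ1
  have hx₁ : |x₁| ≤ C₁ * h := by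
    rw [hx₁def, abs_div, abs_mul, abs_of_pos (by positivity : 0 < P * G), abs_of_pos hr0,
      div_le_iff₀ (by positivity)]
    calc _ ≤ C / (r * η) * (δ ^ 2 * G ^ 2 * r + δ ^ 2 * G) * r := by gcongr
      _ = C * G * (δ * G * (δ * r / η) + δ * δ * (1 / η)) := by field_simp
      _ ≤ C * G * (1 * (L * h) + 1 * h * (1 / A)) := by
          gcongr
          linarith
      _ = _ := by rw [hC₁]; field_simp
  have hy₂ : |y₂| ≤ C₂ * h * (G ^ 2 + G / η) := by
    rw [hy₂def, abs_div, abs_mul, abs_of_pos hP, abs_of_pos hr0, div_le_iff₀ hP]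
    have i1 : (δ * r / η) ^ 2 ≤ L ^ 2 * h := by
      calc (δ * r / η) ^ 2 ≤ (L * h) ^ 2 := by gcongr
        _ = L ^ 2 * (h * h) := by ring
        _ ≤ L ^ 2 * (h * 1) := by gcongr
        _ = L ^ 2 * h := by ring
    calc _ ≤ C / (r * η ^ 2) * (δ ^ 2 * G ^ 2 * r ^ 2 + δ ^ 2 * G) * r := by gcongr
      _ = C * (G ^ 2 * (δ * r / η) ^ 2 + G / η * (1 / η * (δ * δ))) := by field_simp
      _ ≤ C * (G ^ 2 * (L ^ 2 * h) + G / η * (1 / A * (1 * h))) := by gcongr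
      _ ≤ C * ((L ^ 2 + 1 / A) * h * (G ^ 2 + G / η)) := by
          refine mul_le_mul_of_nonneg_left ?_ hC
          have i2 : 0 ≤ G ^ 2 * (1 / A * h) := by positivity
          have i3 : 0 ≤ G / η * (L ^ 2 * h) := by positivity
          calc _ ≤ G ^ 2 * (L ^ 2 * h) + G / η * (1 / A * (1 * h)) + G ^ 2 * (1 / A * h) +
                G / η * (L ^ 2 * h) := by linarith
            _ = _ := by ring
      _ = _ := by rw [hC₂]; field_simp
  have hQ : |y₂ / r - Q| ≤ C₃ * h * G ^ 2 := by
    have e : y₂ / r = z₂ / P := by rw [hy₂def]; field_simp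
    rw [e]
    refine hzQ.trans ?_
    calc C * G ^ 2 * (δ ^ 2 * r / η ^ 2 + δ ^ 2)
        = C * G ^ 2 * (δ * (1 / η) * (δ * r / η) + δ * δ) := by field_simp
      _ ≤ C * G ^ 2 * (1 * (1 / A) * (L * h) + 1 * h) := by gcongr
      _ = _ := by rw [hC₃]; field_simp
  have i0 : 0 ≤ C₀ * h := by positivity
  have i1 : 0 ≤ C₁ * h := by positivity
  have h0 : |x₀| ≤ 1 / 2 := by linarith
  have h1 : |x₁| ≤ 1 / 2 := by linarith
  have hd : 0 < 1 + x₀ := by linarith [(abs_le.1 h0).1]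
  have ez : P / r + z₀ = P / r * (1 + x₀) := by rw [hx₀def]; field_simp
  have hPr : 0 < P / r := by positivity
  constructor
  · rw [ez, div_eq_mul_one_div (P / r) 2]
    exact mul_le_mul_of_nonneg_left (by linarith [(abs_le.1 h0).1]) hPr.le
  · have e1 : (-(β + 1) * (G / η) * (P / r) + z₂) / (P / r + z₀) =
        (-(β + 1) * (G / η) + y₂) / (1 + x₀) := by
      rw [ez, hy₂def]; field_simp
    have e2 : (P * G / r + z₁) / (P / r + z₀) = G * ((1 + x₁) / (1 + x₀)) := by
      rw [ez, hx₁def]; field_simp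
    rw [e1, e2]
    refine (abs_relative_error_le (α := α) hA hη hβ hr.le hG.le hrG hh0.le hh1 hC₀0 hC₂0 h0 h1
      hx₀ hx₀' hx₁ hy₂ hQ).trans ?_
    exact mul_le_mul_of_nonneg_right (mul_le_mul_of_nonneg_right (by linarith) hh0.le) (sq_nonneg G)


/-! ### Derivatives and pointwise bounds of the perturbation. -/

/-- The profile of the first derivative of `singPart`. -/
noncomputable def singPhi₁ (β k₁ k₂ r : ℝ) : ℝ :=
  -(2 + β) * (k₁ * (r - 1) - k₂ * Real.log r) - β * (r - 1) * (k₁ * r - k₂)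

/-- The profile of the second derivative of `singPart`. -/
noncomputable def singPhi₂ (β k₁ k₂ r : ℝ) : ℝ :=
  -(2 + β + 1) * singPhi₁ β k₁ k₂ r - β * r * (r - 1) *
    (-(2 + β) * (k₁ - k₂ / r) - β * ((k₁ * r - k₂) + (r - 1) * k₁))

section singPart

variable {A β η : ℝ}

theorem hasDerivAt_singPart (hA : 0 < A) (hβ : 0 < β) (hη : A < η) (k₁ k₂ : ℝ) :
    HasDerivAt (singPart A β k₁ k₂)
      (η ^ (-(2 + β + 1)) * singPhi₁ β k₁ k₂ (ratio A β η)) η := by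
  have hr := one_lt_ratio hA hβ hη
  have hr0 : ratio A β η ≠ 0 := by linarith
  have hΦ : HasDerivAt (fun r => k₁ * (r - 1) - k₂ * Real.log r)
      (k₁ * 1 - k₂ * (ratio A β η)⁻¹) (ratio A β η) :=
    (((hasDerivAt_id _).sub_const 1).const_mul k₁).sub ((Real.hasDerivAt_log hr0).const_mul k₂)
  refine (hasDerivAt_rpow_mul_comp_ratio hA hβ hη (2 + β) hΦ).congr_deriv ?_
  rw [singPhi₁]
  field_simp

theorem hasDerivAt_singPart₁ (hA : 0 < A) (hβ : 0 < β) (hη : A < η) (k₁ k₂ : ℝ) :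
    HasDerivAt (fun η => η ^ (-(2 + β + 1)) * singPhi₁ β k₁ k₂ (ratio A β η))
      (η ^ (-(2 + β + 1 + 1)) * singPhi₂ β k₁ k₂ (ratio A β η)) η := by
  have hr := one_lt_ratio hA hβ hη
  have hr0 : ratio A β η ≠ 0 := by linarith
  have hΦ : HasDerivAt (singPhi₁ β k₁ k₂)
      (-(2 + β) * (k₁ * 1 - k₂ * (ratio A β η)⁻¹) -
        (β * 1 * (k₁ * ratio A β η - k₂) + β * (ratio A β η - 1) * (k₁ * 1))) (ratio A β η) :=
    ((((hasDerivAt_id _).sub_const 1).const_mul k₁).sub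
      ((Real.hasDerivAt_log hr0).const_mul k₂)).const_mul (-(2 + β)) |>.sub
    ((((hasDerivAt_id _).sub_const 1).const_mul β).mul
      (((hasDerivAt_id _).const_mul k₁).sub_const k₂))
  refine (hasDerivAt_rpow_mul_comp_ratio hA hβ hη (2 + β + 1) hΦ).congr_deriv ?_
  rw [singPhi₂]
  field_simp

/-- Each derivative costs one factor `r`, while the factor `r - 1`, which gives the decay at
infinity, survives. The logarithm is handled by `0 ≤ log r ≤ r - 1`. -/
theorem abs_singPhi_le (hβ : 0 < β) (k₁ k₂ : ℝ) {r : ℝ} (hr : 1 < r) :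
    |k₁ * (r - 1) - k₂ * Real.log r| ≤ (|k₁| + |k₂|) * (r - 1) ∧
    |singPhi₁ β k₁ k₂ r| ≤ 2 * (1 + β) * (|k₁| + |k₂|) * ((r - 1) * r) ∧
    |singPhi₂ β k₁ k₂ r| ≤ 12 * (1 + β) ^ 2 * (|k₁| + |k₂|) * ((r - 1) * r ^ 2) := by
  have hr0 : 0 < r := by linarith
  have hr1 : 0 < r - 1 := by linarith
  have hlog0 : 0 ≤ Real.log r := Real.log_nonneg hr.le
  have hlog : Real.log r ≤ r - 1 := Real.log_le_sub_one_of_pos hr0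
  set M := |k₁| + |k₂| with hM
  have hM0 : 0 ≤ M := by positivity
  have a1 : |k₁ * (r - 1) - k₂ * Real.log r| ≤ M * (r - 1) := by
    refine (abs_sub _ _).trans ?_
    rw [abs_mul, abs_mul, abs_of_pos hr1, abs_of_nonneg hlog0, hM, add_mul]
    gcongr
  have a2 : |k₁ * r - k₂| ≤ M * r := by
    refine (abs_sub _ _).trans ?_
    rw [abs_mul, abs_of_pos hr0, hM, add_mul]
    have := abs_nonneg k₂
    nlinarith
  have a3 : |k₁ - k₂ / r| ≤ M * r := by
    refine (abs_sub _ _).trans ?_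
    rw [abs_div, abs_of_pos hr0, hM, add_mul]
    have h1 := abs_nonneg k₂
    have h2 := abs_nonneg k₁
    have h3 : |k₂| / r ≤ |k₂| * r := by
      rw [div_le_iff₀ hr0, mul_assoc]
      exact le_mul_of_one_le_right h1 (by nlinarith)
    nlinarith
  have a4 : |(k₁ * r - k₂) + (r - 1) * k₁| ≤ 2 * M * r := by
    refine (abs_add_le _ _).trans ?_
    rw [abs_mul, abs_of_pos hr1]
    have h1 := abs_nonneg k₂
    have h2 := abs_nonneg k₁
    nlinarith
  have b1 : |singPhi₁ β k₁ k₂ r| ≤ 2 * (1 + β) * M * ((r - 1) * r) := by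
    rw [singPhi₁]
    refine (abs_sub _ _).trans ?_
    rw [abs_mul, abs_mul, abs_mul, abs_neg, abs_of_pos hr1, abs_of_pos hβ,
      abs_of_pos (by linarith : 0 < 2 + β)]
    calc _ ≤ (2 + β) * (M * (r - 1)) + β * (r - 1) * (M * r) := by gcongr
      _ ≤ (2 + β) * (M * (r - 1) * r) + β * (r - 1) * (M * r) := by
          gcongr ?_ + _
          exact mul_le_mul_of_nonneg_left (le_mul_of_one_le_right (by positivity) hr.le)
            (by positivity)
      _ = _ := by ring
  refine ⟨a1, b1, ?_⟩
  rw [singPhi₂]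
  refine (abs_sub _ _).trans ?_
  have c1 : |-(2 + β) * (k₁ - k₂ / r) - β * ((k₁ * r - k₂) + (r - 1) * k₁)| ≤
      (2 + 3 * β) * (M * r) := by
    refine (abs_sub _ _).trans ?_
    rw [abs_mul, abs_mul, abs_neg, abs_of_pos hβ, abs_of_pos (by linarith : 0 < 2 + β)]
    calc _ ≤ (2 + β) * (M * r) + β * (2 * M * r) := by gcongr
      _ = _ := by ring
  rw [abs_mul, abs_mul (β * r * (r - 1)), abs_neg, abs_of_pos (by linarith : 0 < 2 + β + 1),
    abs_of_pos (by positivity : 0 < β * r * (r - 1))]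
  calc _ ≤ (2 + β + 1) * (2 * (1 + β) * M * ((r - 1) * r)) +
        β * r * (r - 1) * ((2 + 3 * β) * (M * r)) := by gcongr
    _ ≤ (2 + β + 1) * (2 * (1 + β) * M * ((r - 1) * r) * r) +
        β * r * (r - 1) * ((2 + 3 * β) * (M * r)) := by
          gcongr ?_ + _
          exact mul_le_mul_of_nonneg_left (le_mul_of_one_le_right (by positivity) hr.le)
            (by positivity)
    _ = (2 * (3 + β) * (1 + β) + β * (2 + 3 * β)) * (M * ((r - 1) * r ^ 2)) := by ring
    _ ≤ 12 * (1 + β) ^ 2 * (M * ((r - 1) * r ^ 2)) := by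
          gcongr
          nlinarith
    _ = _ := by ring

theorem rpow_neg_add_natCast (hA : 0 < A) (hβ : 0 < β) (hη : A < η) (j : ℕ) :
    η ^ (-(β + j)) = (ratio A β η - 1) / (ratio A β η * A ^ β) / η ^ j := by
  have hη0 : 0 < η := hA.trans hη
  rw [neg_add, Real.rpow_add hη0, rpow_neg_eq_ratio hA hβ hη, Real.rpow_neg hη0.le,
    Real.rpow_natCast, ← div_eq_mul_inv]

end singPart

/-- The operator on polynomials induced by `powLog ρ` on derivatives. -/
noncomputable def logDer (ρ : ℝ) (p : Polynomial ℝ) : Polynomial ℝ :=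
  Polynomial.derivative p - Polynomial.C ρ * p

/-- The first derivative of `pert`. -/
noncomputable def pert₁ (n : ℕ) (A γ η₀ b θ E η : ℝ) : ℝ :=
  E * (η ^ (-(2 + 1 / γ + 1)) *
      singPhi₁ (1 / γ) (singCoeff₁ n A γ θ) (singCoeff₂ n A γ) (ratio A (1 / γ) η)) +
    ∑ k ∈ Finset.range (⌊1 / (2 * γ)⌋₊ + 1), E ^ (k + 1) *
      powLog (2 * ((k : ℝ) + 1) + 1 / γ + 1)
        (logDer (2 * ((k : ℝ) + 1) + 1 / γ) (corrPoly n A γ η₀ b (k + 1))) η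

/-- The second derivative of the `k`-th correction term. -/
noncomputable def corr₂ (n : ℕ) (A γ η₀ b : ℝ) (k : ℕ) (η : ℝ) : ℝ :=
  powLog (2 * ((k : ℝ) + 1) + 1 / γ + 1 + 1) (logDer (2 * ((k : ℝ) + 1) + 1 / γ + 1)
    (logDer (2 * ((k : ℝ) + 1) + 1 / γ) (corrPoly n A γ η₀ b (k + 1)))) η

/-- The second derivative of `pert`. -/
noncomputable def pert₂ (n : ℕ) (A γ η₀ b θ E η : ℝ) : ℝ :=
  E * (η ^ (-(2 + 1 / γ + 1 + 1)) *
      singPhi₂ (1 / γ) (singCoeff₁ n A γ θ) (singCoeff₂ n A γ) (ratio A (1 / γ) η)) +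
    ∑ k ∈ Finset.range (⌊1 / (2 * γ)⌋₊ + 1), E ^ (k + 1) * corr₂ n A γ η₀ b k η

section pert

variable {n : ℕ} {A γ η η₀ b θ : ℝ}

theorem hasDerivAt_pert (hA : 0 < A) (hγ : 0 < γ) (hη : A < η) (E : ℝ) :
    HasDerivAt (pert n A γ η₀ b θ E) (pert₁ n A γ η₀ b θ E η) η :=
  ((hasDerivAt_singPart hA (by positivity) hη _ _).const_mul E).add
    (HasDerivAt.fun_sum fun _ _ => (hasDerivAt_powLog _ _ (hA.trans hη)).const_mul _)

theorem hasDerivAt_pert₁ (hA : 0 < A) (hγ : 0 < γ) (hη : A < η) (E : ℝ) :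
    HasDerivAt (pert₁ n A γ η₀ b θ E) (pert₂ n A γ η₀ b θ E η) η :=
  ((hasDerivAt_singPart₁ hA (by positivity) hη _ _).const_mul E).add
    (HasDerivAt.fun_sum fun _ _ => (hasDerivAt_powLog _ _ (hA.trans hη)).const_mul _)

/-- A sum of correction terms with a common bound `C k * B`. -/
theorem exists_abs_sum_le {B : ℝ → ℝ} {F : ℕ → ℝ → ℝ} {A : ℝ} (m : ℕ)
    (hB : ∀ η, A < η → 0 ≤ B η)
    (h : ∀ k, ∃ C, 0 ≤ C ∧ ∀ η, A < η → |F k η| ≤ C * B η) :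
    ∃ C, 0 ≤ C ∧ ∀ η E, A < η → 0 ≤ E → E ≤ 1 →
      |∑ k ∈ Finset.range m, E ^ (k + 1) * F k η| ≤ E * (C * B η) := by
  choose C hC0 hC using h
  refine ⟨∑ k ∈ Finset.range m, C k, Finset.sum_nonneg fun k _ => hC0 k, fun η E hη hE hE1 => ?_⟩
  rw [Finset.sum_mul, Finset.mul_sum]
  refine (Finset.abs_sum_le_sum_abs _ _).trans (Finset.sum_le_sum fun k _ => ?_)
  rw [abs_mul, abs_of_nonneg (by positivity), pow_succ']
  have h1 : E ^ k ≤ 1 := pow_le_one₀ hE hE1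
  have h2 := hC k η hη
  have h3 : 0 ≤ C k * B η := mul_nonneg (hC0 k) (hB η hη)
  calc E * E ^ k * |F k η| ≤ E * 1 * (C k * B η) := by gcongr
    _ = _ := by ring

/-- The exponent exceeds `β + 1 + j`, and the surplus absorbs the logarithms. The remaining power
`η^(-(β+1+j))` is a multiple of `G/(rη^j)`. -/
theorem exists_abs_powLog_le_rate (hA : 0 < A) (hγ : 0 < γ) (j k : ℕ) {ρ : ℝ}
    (hρ : ρ = 2 * ((k : ℝ) + 1) + 1 / γ + j) (p : Polynomial ℝ) :
    ∃ C, 0 ≤ C ∧ ∀ η, A < η → |powLog ρ p η| ≤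
      C * (1 / γ * (ratio A (1 / γ) η - 1) / η / (ratio A (1 / γ) η * η ^ j)) := by
  have hk : (0 : ℝ) ≤ k := k.cast_nonneg
  obtain ⟨C, hC0, hC⟩ := exists_abs_powLog_le hA
    (by rw [hρ]; push_cast; linarith : 1 / γ + ((1 + j : ℕ) : ℝ) < ρ) p
  have hAβ := Real.rpow_pos_of_pos hA (1 / γ)
  refine ⟨C * γ / A ^ (1 / γ), by positivity, fun η hη => ?_⟩
  have hη0 : 0 < η := hA.trans hη
  have hr := one_lt_ratio hA (by positivity : 0 < 1 / γ) hη
  have hr0 : 0 < ratio A (1 / γ) η := by linarith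
  refine (hC η hη.le).trans (le_of_eq ?_)
  rw [rpow_neg_add_natCast hA (by positivity) hη, pow_add, pow_one]
  field_simp

/-- One factor `r - 1` comes from the power `η^(-(β+2+j))` and one from the profile. Together they
make `(γηG)²`. -/
theorem exists_singPart_bounds (hA : 0 < A) (hγ : 0 < γ) (k₁ k₂ : ℝ) :
    ∃ D, 0 ≤ D ∧ ∀ η r G, A < η → r = ratio A (1 / γ) η → G = 1 / γ * (r - 1) / η →
      |singPart A (1 / γ) k₁ k₂ η| ≤ D * G ^ 2 / r ∧
      |η ^ (-(2 + 1 / γ + 1)) * singPhi₁ (1 / γ) k₁ k₂ (ratio A (1 / γ) η)| ≤ D * G ^ 2 / η ∧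
      |η ^ (-(2 + 1 / γ + 1 + 1)) * singPhi₂ (1 / γ) k₁ k₂ (ratio A (1 / γ) η)| ≤
        D * G ^ 2 * r / η ^ 2 := by
  have hβ : 0 < 1 / γ := by positivity
  have hAβ := Real.rpow_pos_of_pos hA (1 / γ)
  have hsq : 1 + 1 / γ ≤ (1 + 1 / γ) ^ 2 := by nlinarith
  refine ⟨12 * (1 + 1 / γ) ^ 2 * (|k₁| + |k₂|) * (γ ^ 2 / A ^ (1 / γ)), by positivity, ?_⟩
  intro η r G hη hr hG
  have hη0 : 0 < η := hA.trans hη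
  have hr1 : 1 < r := hr ▸ one_lt_ratio hA hβ hη
  have hr0 : 0 < r := by linarith
  have hr10 : 0 < r - 1 := by linarith
  have hG0 : 0 < G := by rw [hG]; positivity
  have hrG : r - 1 = γ * η * G := by rw [hG]; field_simp
  obtain ⟨s0, s1, s2⟩ := abs_singPhi_le hβ k₁ k₂ hr1
  set M := |k₁| + |k₂|
  have hM0 : 0 ≤ M := by positivity
  have pw : ∀ j : ℕ, η ^ (-(1 / γ + (2 + j : ℕ))) =
      γ ^ 2 / A ^ (1 / γ) * G ^ 2 / (r * η ^ j) / (r - 1) := by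
    intro j
    rw [rpow_neg_add_natCast hA hβ hη, ← hr, pow_add, hrG]
    field_simp
  refine ⟨?_, ?_, ?_⟩
  · have e : -(2 + 1 / γ) = -(1 / γ + (2 + 0 : ℕ)) := by push_cast; ring
    rw [singPart, e, pw, ← hr, abs_mul, abs_of_pos (by positivity)]
    calc _ ≤ γ ^ 2 / A ^ (1 / γ) * G ^ 2 / (r * η ^ 0) / (r - 1) * (M * (r - 1)) := by gcongr
      _ = 1 * M * (γ ^ 2 / A ^ (1 / γ)) * G ^ 2 / r := by field_simp
      _ ≤ _ := by
          gcongr ?_ * _ * _ * _ / _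
          linarith
  · have e : -(2 + 1 / γ + 1) = -(1 / γ + (2 + 1 : ℕ)) := by push_cast; ring
    rw [e, pw, ← hr, abs_mul, abs_of_pos (by positivity)]
    calc _ ≤ γ ^ 2 / A ^ (1 / γ) * G ^ 2 / (r * η ^ 1) / (r - 1) *
          (2 * (1 + 1 / γ) * M * ((r - 1) * r)) := by gcongr
      _ = 2 * (1 + 1 / γ) * M * (γ ^ 2 / A ^ (1 / γ)) * G ^ 2 / η := by field_simp
      _ ≤ _ := by
          gcongr ?_ * _ * _ * _ / _
          linarith
  · have e : -(2 + 1 / γ + 1 + 1) = -(1 / γ + (2 + 2 : ℕ)) := by push_cast; ring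
    rw [e, pw, ← hr, abs_mul, abs_of_pos (by positivity)]
    calc _ ≤ γ ^ 2 / A ^ (1 / γ) * G ^ 2 / (r * η ^ 2) / (r - 1) *
          (12 * (1 + 1 / γ) ^ 2 * M * ((r - 1) * r ^ 2)) := by gcongr
      _ = _ := by field_simp

/-- The last correction term decays fast enough to be absorbed. -/
theorem exists_abs_corr₂_last_le (hA : 0 < A) (hγ : 0 < γ) (n : ℕ) (η₀ b : ℝ) :
    ∃ D, 0 ≤ D ∧ ∀ η G, A < η → G = 1 / γ * (ratio A (1 / γ) η - 1) / η →
      |corr₂ n A γ η₀ b ⌊1 / (2 * γ)⌋₊ η| ≤ D * G ^ 2 := by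
  have hβ : 0 < 1 / γ := by positivity
  have hAβ := Real.rpow_pos_of_pos hA (1 / γ)
  set m := ⌊1 / (2 * γ)⌋₊ with hm
  -- This inequality dictates the number of corrections: it makes the last second derivative decay
  -- strictly faster than `η^(-2β-2)`, the rate of `G²`, with room for logarithms.
  have hlast : 1 / γ < 2 * ((m : ℝ) + 1) := by
    have h1 := Nat.lt_floor_add_one (1 / (2 * γ))
    rw [← hm] at h1
    have h2 : 1 / γ = 2 * (1 / (2 * γ)) := by field_simp
    linarith
  obtain ⟨C₃, hC₃, h₃⟩ := exists_abs_powLog_le hA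
    (ρ := 2 * ((m : ℝ) + 1) + 1 / γ + 1 + 1) (σ := 1 / γ + 1 + (1 / γ + 1)) (by linarith)
    (logDer (2 * ((m : ℝ) + 1) + 1 / γ + 1)
    (logDer (2 * ((m : ℝ) + 1) + 1 / γ) (corrPoly n A γ η₀ b (m + 1))))
  refine ⟨C₃ * (γ / A ^ (1 / γ)) ^ 2, by positivity, fun η G hη hG => ?_⟩
  have hη0 : 0 < η := hA.trans hη
  have hr1 := one_lt_ratio hA hβ hη
  set r := ratio A (1 / γ) η
  have hr0 : 0 < r := by linarith
  have hr10 : 0 < r - 1 := by linarith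
  have hG0 : 0 < G := by rw [hG]; positivity
  have hrG : r - 1 = γ * η * G := by rw [hG]; field_simp
  refine (h₃ η hη.le).trans ?_
  have e1 : η ^ (-(1 / γ + 1 + (1 / γ + 1))) = (γ * G / (r * A ^ (1 / γ))) ^ 2 := by
    have e2 : -(1 / γ + 1 + (1 / γ + 1)) = -(1 / γ + (1 : ℕ)) + -(1 / γ + (1 : ℕ)) := by
      push_cast; ring
    rw [e2, Real.rpow_add hη0, rpow_neg_add_natCast hA hβ hη]
    change (r - 1) / (r * _) / _ * ((r - 1) / (r * _) / _) = _
    rw [hrG]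
    field_simp
  rw [e1]
  calc C₃ * (γ * G / (r * A ^ (1 / γ))) ^ 2 ≤ C₃ * (γ * G / (1 * A ^ (1 / γ))) ^ 2 := by gcongr
    _ = _ := by ring

theorem add_le_mul_add {x y C X Y : ℝ} (hX : 0 ≤ X) (hY : 0 ≤ Y) (hx : x ≤ C) (hy : y ≤ C) :
    x * X + y * Y ≤ C * (X + Y) := by
  rw [mul_add]
  gcongr

/-- These are the hypotheses of `exists_nonlinear_error_le` with `E = δ²`. In the fourth bound the
sum omits the last correction, so only `singPart` and that correction remain to be estimated. -/
theorem exists_pert_bounds (hA : 0 < A) (hγ : 0 < γ) (n : ℕ) (η₀ b θ : ℝ) :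
    ∃ C, 0 ≤ C ∧ ∀ η r G E, A < η → r = ratio A (1 / γ) η → G = 1 / γ * (r - 1) / η →
      0 ≤ E → E ≤ 1 →
      |pert n A γ η₀ b θ E η| ≤ C / r * (E * G ^ 2 + E * G) ∧
      |pert₁ n A γ η₀ b θ E η| ≤ C / (r * η) * (E * G ^ 2 * r + E * G) ∧
      |pert₂ n A γ η₀ b θ E η| ≤ C / (r * η ^ 2) * (E * G ^ 2 * r ^ 2 + E * G) ∧
      ∀ P, 1 ≤ P → |pert₂ n A γ η₀ b θ E η / P - 1 / P * ∑ k ∈ Finset.range ⌊1 / (2 * γ)⌋₊,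
        E ^ (k + 1) * corr₂ n A γ η₀ b k η| ≤ C * G ^ 2 * (E * r / η ^ 2 + E) := by
  have hβ : 0 < 1 / γ := by positivity
  have hB : ∀ j : ℕ, ∀ η, A < η →
      0 ≤ 1 / γ * (ratio A (1 / γ) η - 1) / η / (ratio A (1 / γ) η * η ^ j) := by
    intro j η hη
    have hη0 : 0 < η := hA.trans hη
    have hr := one_lt_ratio hA hβ hη
    have : 0 < ratio A (1 / γ) η - 1 := by linarith
    have : 0 < ratio A (1 / γ) η := by linarith
    positivity
  obtain ⟨C₀, hC₀, h₀⟩ := exists_abs_sum_le (⌊1 / (2 * γ)⌋₊ + 1) (hB 0) fun k =>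
    exists_abs_powLog_le_rate hA hγ 0 k (ρ := 2 * ((k : ℝ) + 1) + 1 / γ) (by simp)
      (corrPoly n A γ η₀ b (k + 1))
  obtain ⟨C₁, hC₁, h₁⟩ := exists_abs_sum_le (⌊1 / (2 * γ)⌋₊ + 1) (hB 1) fun k =>
    exists_abs_powLog_le_rate hA hγ 1 k (ρ := 2 * ((k : ℝ) + 1) + 1 / γ + 1) (by simp)
      (logDer (2 * ((k : ℝ) + 1) + 1 / γ) (corrPoly n A γ η₀ b (k + 1)))
  obtain ⟨C₂, hC₂, h₂⟩ := exists_abs_sum_le (F := corr₂ n A γ η₀ b) (⌊1 / (2 * γ)⌋₊ + 1) (hB 2)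
    fun k => exists_abs_powLog_le_rate hA hγ 2 k (by push_cast; ring) _
  obtain ⟨D, hD, hsing⟩ := exists_singPart_bounds hA hγ (singCoeff₁ n A γ θ) (singCoeff₂ n A γ)
  obtain ⟨D₃, hD₃, h₃⟩ := exists_abs_corr₂_last_le hA hγ n η₀ b
  refine ⟨D + C₀ + C₁ + C₂ + D₃, by positivity, ?_⟩
  intro η r G E hη hr hG hE hE1
  have hη0 : 0 < η := hA.trans hη
  have hr1 : 1 < r := hr ▸ one_lt_ratio hA hβ hη
  have hr0 : 0 < r := by linarith
  have hr10 : 0 < r - 1 := by linarith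
  have hG0 : 0 < G := by rw [hG]; positivity
  obtain ⟨b0, b1, b2⟩ := hsing η r G hη hr hG
  have t0 := h₀ η E hη hE hE1
  have t1 := h₁ η E hη hE hE1
  have t2 := h₂ η E hη hE hE1
  have t3 := h₃ η G hη (hr ▸ hG)
  clear h₀ h₁ h₂ h₃ hsing hB
  rw [← hr, ← hG] at t0 t1 t2
  refine ⟨?_, ?_, ?_, ?_⟩
  · rw [pert]
    refine (abs_add_le _ _).trans ?_
    rw [abs_mul, abs_of_nonneg hE]
    calc _ ≤ E * (D * G ^ 2 / r) + E * (C₀ * (G / (r * η ^ 0))) := by gcongr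
      _ = D * (E * G ^ 2 / r) + C₀ * (E * G / r) := by rw [pow_zero]; ring
      _ ≤ (D + C₀ + C₁ + C₂ + D₃) * (E * G ^ 2 / r + E * G / r) :=
          add_le_mul_add (by positivity) (by positivity) (by linarith) (by linarith)
      _ = _ := by field_simp
  · rw [pert₁]
    refine (abs_add_le _ _).trans ?_
    rw [abs_mul, abs_of_nonneg hE]
    calc _ ≤ E * (D * G ^ 2 / η) + E * (C₁ * (G / (r * η ^ 1))) := by gcongr
      _ = D * (E * G ^ 2 / η) + C₁ * (E * G / (r * η)) := by ring
      _ ≤ (D + C₀ + C₁ + C₂ + D₃) * (E * G ^ 2 / η + E * G / (r * η)) :=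
          add_le_mul_add (by positivity) (by positivity) (by linarith) (by linarith)
      _ = _ := by field_simp
  · rw [pert₂]
    refine (abs_add_le _ _).trans ?_
    rw [abs_mul, abs_of_nonneg hE]
    calc _ ≤ E * (D * G ^ 2 * r / η ^ 2) + E * (C₂ * (G / (r * η ^ 2))) := by gcongr
      _ = D * (E * G ^ 2 * r / η ^ 2) + C₂ * (E * G / (r * η ^ 2)) := by ring
      _ ≤ (D + C₀ + C₁ + C₂ + D₃) * (E * G ^ 2 * r / η ^ 2 + E * G / (r * η ^ 2)) :=
          add_le_mul_add (by positivity) (by positivity) (by linarith) (by linarith)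
      _ = _ := by field_simp
  · intro P hP
    have hP0 : 0 < P := by linarith
    rw [pert₂, Finset.sum_range_succ]
    generalize ⌊1 / (2 * γ)⌋₊ = m at t3 ⊢
    generalize η ^ (-(2 + 1 / γ + 1 + 1)) * singPhi₂ (1 / γ) (singCoeff₁ n A γ θ)
      (singCoeff₂ n A γ) (ratio A (1 / γ) η) = F at b2 ⊢
    have e : (E * F + (∑ k ∈ Finset.range m, E ^ (k + 1) * corr₂ n A γ η₀ b k η +
        E ^ (m + 1) * corr₂ n A γ η₀ b m η)) / P -
        1 / P * ∑ k ∈ Finset.range m, E ^ (k + 1) * corr₂ n A γ η₀ b k η =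
        (E * F + E ^ (m + 1) * corr₂ n A γ η₀ b m η) / P := by ring
    rw [e, abs_div, abs_of_pos hP0]
    refine (div_le_self (abs_nonneg _) hP).trans ((abs_add_le _ _).trans ?_)
    have hEm : E ^ m ≤ 1 := pow_le_one₀ hE hE1
    rw [abs_mul, abs_mul, abs_of_nonneg hE, abs_of_nonneg (by positivity : 0 ≤ E ^ (m + 1)),
      pow_succ']
    calc _ ≤ E * (D * G ^ 2 * r / η ^ 2) + E * 1 * (D₃ * G ^ 2) := by gcongr
      _ = D * (E * G ^ 2 * r / η ^ 2) + D₃ * (E * G ^ 2) := by ring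
      _ ≤ (D + C₀ + C₁ + C₂ + D₃) * (E * G ^ 2 * r / η ^ 2 + E * G ^ 2) :=
          add_le_mul_add (by positivity) (by positivity) (by linarith) (by linarith)
      _ = _ := by ring

end pert


/-! ### The operator applied to the outer barrier. -/

/-- The derivative of `pert` in `τ` at fixed `η`. -/
noncomputable def pertT (n : ℕ) (A γ η₀ b θ E η : ℝ) : ℝ :=
  -(2 * γ) * E * singPart A (1 / γ) (singCoeff₁ n A γ θ) (singCoeff₂ n A γ) η +
    ∑ k ∈ Finset.range (⌊1 / (2 * γ)⌋₊ + 1), -(2 * γ * ((k : ℝ) + 1)) * E ^ (k + 1) *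
      powLog (2 * ((k : ℝ) + 1) + 1 / γ) (corrPoly n A γ η₀ b (k + 1)) η

section outer

variable {n : ℕ} {A γ η η₀ b θ ξ τ : ℝ}

theorem lt_outer_coord (hξ : 0 < ξ) : A < A + ξ * Real.exp (-γ * τ) := by
  have := mul_pos hξ (Real.exp_pos (-γ * τ))
  linarith

theorem outerPart_eq (hn : 3 ≤ n) (hA : 0 < A) (hγ : 0 < γ) (hη₀ : A < η₀) (hξ : 0 < ξ) :
    outerPart n A γ η₀ b θ ξ τ = Real.exp (γ * τ) *
      (wHat0 n A γ (A + ξ * Real.exp (-γ * τ)) +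
        pert n A γ η₀ b θ (Real.exp (-2 * γ * τ)) (A + ξ * Real.exp (-γ * τ))) := by
  rw [outerPart, wHat_eq hn hA hγ hη₀ (lt_outer_coord hξ)]

theorem hasDerivAt_outerPart_space (hn : 3 ≤ n) (hA : 0 < A) (hγ : 0 < γ) (hη₀ : A < η₀)
    (hξ : 0 < ξ) :
    HasDerivAt (fun x => outerPart n A γ η₀ b θ x τ)
      (deriv (wHat0 n A γ) (A + ξ * Real.exp (-γ * τ)) +
        pert₁ n A γ η₀ b θ (Real.exp (-2 * γ * τ)) (A + ξ * Real.exp (-γ * τ))) ξ := by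
  have hη := lt_outer_coord (A := A) (γ := γ) (τ := τ) hξ
  have h0 : HasDerivAt (fun x => A + x * Real.exp (-γ * τ)) (1 * Real.exp (-γ * τ)) ξ :=
    ((hasDerivAt_id ξ).mul_const _).const_add A
  have h1 := ((hasDerivAt_wHat0 (n := n) (γ := γ) hA (hA.trans hη)).differentiableAt.hasDerivAt.add
    (hasDerivAt_pert (n := n) (η₀ := η₀) (b := b) (θ := θ) hA hγ hη (Real.exp (-2 * γ * τ))))
  have h2 := (h1.comp ξ h0).const_mul (Real.exp (γ * τ))
  have hev : (fun x => outerPart n A γ η₀ b θ x τ) =ᶠ[𝓝 ξ] fun x => Real.exp (γ * τ) *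
      (wHat0 n A γ (A + x * Real.exp (-γ * τ)) +
        pert n A γ η₀ b θ (Real.exp (-2 * γ * τ)) (A + x * Real.exp (-γ * τ))) := by
    filter_upwards [lt_mem_nhds hξ] with x hx using outerPart_eq hn hA hγ hη₀ hx
  refine (HasDerivAt.congr_of_eventuallyEq h2 hev).congr_deriv ?_
  have e : Real.exp (γ * τ) * Real.exp (-γ * τ) = 1 := by
    rw [← Real.exp_add]; simp
  linear_combination (deriv (wHat0 n A γ) (A + ξ * Real.exp (-γ * τ)) +
        pert₁ n A γ η₀ b θ (Real.exp (-2 * γ * τ)) (A + ξ * Real.exp (-γ * τ))) * e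

theorem hasDerivAt_deriv_outerPart_space (hn : 3 ≤ n) (hA : 0 < A) (hγ : 0 < γ) (hη₀ : A < η₀)
    (hξ : 0 < ξ) :
    HasDerivAt (deriv fun x => outerPart n A γ η₀ b θ x τ) (Real.exp (-γ * τ) *
      (deriv (deriv (wHat0 n A γ)) (A + ξ * Real.exp (-γ * τ)) +
        pert₂ n A γ η₀ b θ (Real.exp (-2 * γ * τ)) (A + ξ * Real.exp (-γ * τ)))) ξ := by
  have hη := lt_outer_coord (A := A) (γ := γ) (τ := τ) hξ
  have h0 : HasDerivAt (fun x => A + x * Real.exp (-γ * τ)) (1 * Real.exp (-γ * τ)) ξ :=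
    ((hasDerivAt_id ξ).mul_const _).const_add A
  have h1 := ((hasDerivAt_deriv_wHat0 (n := n) hA hγ hη).differentiableAt.hasDerivAt.add
    (hasDerivAt_pert₁ (n := n) (η₀ := η₀) (b := b) (θ := θ) hA hγ hη (Real.exp (-2 * γ * τ))))
  have h2 := h1.comp ξ h0
  have hev : (deriv fun x => outerPart n A γ η₀ b θ x τ) =ᶠ[𝓝 ξ] fun x =>
      (deriv (wHat0 n A γ) (A + x * Real.exp (-γ * τ)) +
        pert₁ n A γ η₀ b θ (Real.exp (-2 * γ * τ)) (A + x * Real.exp (-γ * τ))) := by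
    filter_upwards [lt_mem_nhds hξ] with x hx using
      (hasDerivAt_outerPart_space hn hA hγ hη₀ hx).deriv
  refine (HasDerivAt.congr_of_eventuallyEq h2 hev).congr_deriv ?_
  ring

theorem hasDerivAt_pert_time (hA : 0 < A) (hγ : 0 < γ) (hξ : 0 < ξ) :
    HasDerivAt (fun t => pert n A γ η₀ b θ (Real.exp (-2 * γ * t)) (A + ξ * Real.exp (-γ * t)))
      (pertT n A γ η₀ b θ (Real.exp (-2 * γ * τ)) (A + ξ * Real.exp (-γ * τ)) +
        pert₁ n A γ η₀ b θ (Real.exp (-2 * γ * τ)) (A + ξ * Real.exp (-γ * τ)) *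
          (-γ * (ξ * Real.exp (-γ * τ)))) τ := by
  have hη := lt_outer_coord (A := A) (γ := γ) (τ := τ) hξ
  have hη' : HasDerivAt (fun t => A + ξ * Real.exp (-γ * t))
      (ξ * (Real.exp (-γ * τ) * (-γ * 1))) τ :=
    ((((hasDerivAt_id τ).const_mul (-γ)).exp).const_mul ξ).const_add A
  have hE : HasDerivAt (fun t => Real.exp (-2 * γ * t)) (Real.exp (-2 * γ * τ) * (-2 * γ * 1)) τ :=
    ((hasDerivAt_id τ).const_mul (-2 * γ)).exp
  have h1 := hE.mul ((hasDerivAt_singPart hA (by positivity : 0 < 1 / γ) hη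
    (singCoeff₁ n A γ θ) (singCoeff₂ n A γ)).comp τ hη')
  have h2 := HasDerivAt.fun_sum (u := Finset.range (⌊1 / (2 * γ)⌋₊ + 1)) fun k _ =>
    (hE.fun_pow (k + 1)).mul ((hasDerivAt_powLog (2 * ((k : ℝ) + 1) + 1 / γ)
      (corrPoly n A γ η₀ b (k + 1)) (hA.trans hη)).comp τ hη')
  refine (h1.add h2).congr_deriv ?_
  rw [pertT, pert₁, add_mul, Finset.sum_mul, add_add_add_comm, ← Finset.sum_add_distrib]
  congr 1
  · simp only [Function.comp]
    ring
  · refine Finset.sum_congr rfl fun k _ => ?_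
    simp only [Function.comp, logDer, Nat.add_sub_cancel]
    push_cast
    ring

theorem hasDerivAt_outerPart_time (hn : 3 ≤ n) (hA : 0 < A) (hγ : 0 < γ) (hη₀ : A < η₀)
    (hξ : 0 < ξ) :
    HasDerivAt (fun t => outerPart n A γ η₀ b θ ξ t) (Real.exp (γ * τ) *
      (γ * (wHat0 n A γ (A + ξ * Real.exp (-γ * τ)) +
          pert n A γ η₀ b θ (Real.exp (-2 * γ * τ)) (A + ξ * Real.exp (-γ * τ))) +
        pertT n A γ η₀ b θ (Real.exp (-2 * γ * τ)) (A + ξ * Real.exp (-γ * τ)) -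
        γ * (ξ * Real.exp (-γ * τ)) * (deriv (wHat0 n A γ) (A + ξ * Real.exp (-γ * τ)) +
          pert₁ n A γ η₀ b θ (Real.exp (-2 * γ * τ)) (A + ξ * Real.exp (-γ * τ))))) τ := by
  have hη := lt_outer_coord (A := A) (γ := γ) (τ := τ) hξ
  have hη' : HasDerivAt (fun t => A + ξ * Real.exp (-γ * t))
      (ξ * (Real.exp (-γ * τ) * (-γ * 1))) τ :=
    ((((hasDerivAt_id τ).const_mul (-γ)).exp).const_mul ξ).const_add A
  have hX : HasDerivAt (fun t => Real.exp (γ * t)) (Real.exp (γ * τ) * (γ * 1)) τ :=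
    ((hasDerivAt_id τ).const_mul γ).exp
  have h0 := (hasDerivAt_wHat0 (n := n) (γ := γ) hA (hA.trans hη)).differentiableAt.hasDerivAt.comp
    τ hη'
  have h1 := hX.mul (h0.add (hasDerivAt_pert_time (n := n) (η₀ := η₀) (b := b) (θ := θ) hA hγ hξ))
  have hev : (fun t => outerPart n A γ η₀ b θ ξ t) = fun t => Real.exp (γ * t) *
      (wHat0 n A γ (A + ξ * Real.exp (-γ * t)) +
        pert n A γ η₀ b θ (Real.exp (-2 * γ * t)) (A + ξ * Real.exp (-γ * t))) :=
    funext fun t => outerPart_eq hn hA hγ hη₀ hξ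
  rw [hev]
  refine h1.congr_deriv ?_
  simp only [Pi.add_apply, Function.comp]
  ring

/-- The recursion makes each correction term cancel the second derivative of the previous one. -/
theorem powLog_derivative_corrPoly (hn : 3 ≤ n) (hγ : 0 < γ) (k : ℕ) (η : ℝ) :
    -γ * powLog (2 * (((k + 1 : ℕ) : ℝ) + 1) + 1 / γ)
      (Polynomial.derivative (corrPoly n A γ η₀ b (k + 1 + 1))) η =
      1 / ((n : ℝ) - 2) * corr₂ n A γ η₀ b k η := by
  have hn' : (3 : ℝ) ≤ n := by exact_mod_cast hn
  have h2 : (n : ℝ) - 2 ≠ 0 := by linarith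
  have h := congrArg (Polynomial.eval (Real.log η))
    (derivative_corrPoly (A := A) (η₀ := η₀) (b := b) hn hγ k rfl)
  have e : 2 * (((k + 1 : ℕ) : ℝ) + 1) + 1 / γ = 2 * ((k : ℝ) + 1) + 1 / γ + 1 + 1 := by
    push_cast; ring
  rw [Polynomial.eval_mul, Polynomial.eval_C, Polynomial.eval_neg] at h
  rw [corr₂, powLog, powLog, e, logDer, logDer]
  generalize Polynomial.eval (Real.log η)
    (Polynomial.derivative (corrPoly n A γ η₀ b (k + 1 + 1))) = D at h ⊢
  generalize Polynomial.eval (Real.log η) _ = F at h ⊢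
  have h' : γ * D = -F / ((n : ℝ) - 2) := by
    rw [eq_div_iff h2]; linear_combination h
  linear_combination -η ^ (-(2 * ((k : ℝ) + 1) + 1 / γ + 1 + 1)) * h'

/-- The linear part of the outer equation. -/
theorem linear_part_pert (hn : 3 ≤ n) (hA : 0 < A) (hγ : 0 < γ) (hη : A < η) (E : ℝ) :
    pertT n A γ η₀ b θ E η - pert n A γ η₀ b θ E η - γ * η * pert₁ n A γ η₀ b θ E η =
      E * η ^ (-(2 + 1 / γ)) * (ratio A (1 / γ) η * (singCoeff₁ n A γ θ * (ratio A (1 / γ) η - 1)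
        - singCoeff₂ n A γ)) +
      E * (1 / ((n : ℝ) - 2) * ∑ k ∈ Finset.range ⌊1 / (2 * γ)⌋₊,
        E ^ (k + 1) * corr₂ n A γ η₀ b k η) := by
  have hη0 : 0 < η := hA.trans hη
  have hstep : ∀ ρ : ℝ, η * η ^ (-(ρ + 1)) = η ^ (-ρ) := by
    intro ρ
    rw [mul_comm, ← Real.rpow_add_one hη0.ne']
    congr 1; ring
  -- The exponent `ρ = 2(k+1) + β` satisfies `-2γ(k+1) - 1 + γρ = 0`, so the first order operator
  -- annihilates the pure power and only the derivative of the polynomial in `log η` survives.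
  have hterm : ∀ k : ℕ, -(2 * γ * ((k : ℝ) + 1)) * E ^ (k + 1) *
      powLog (2 * ((k : ℝ) + 1) + 1 / γ) (corrPoly n A γ η₀ b (k + 1)) η -
      E ^ (k + 1) * powLog (2 * ((k : ℝ) + 1) + 1 / γ) (corrPoly n A γ η₀ b (k + 1)) η -
      γ * η * (E ^ (k + 1) * powLog (2 * ((k : ℝ) + 1) + 1 / γ + 1)
        (logDer (2 * ((k : ℝ) + 1) + 1 / γ) (corrPoly n A γ η₀ b (k + 1))) η) =
      E ^ (k + 1) * (-γ * powLog (2 * ((k : ℝ) + 1) + 1 / γ)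
        (Polynomial.derivative (corrPoly n A γ η₀ b (k + 1))) η) := by
    intro k
    have h := hstep (2 * ((k : ℝ) + 1) + 1 / γ)
    have hγ1 : γ * (1 / γ) = 1 := by field_simp
    simp only [powLog, logDer, Polynomial.eval_sub, Polynomial.eval_mul, Polynomial.eval_C]
    linear_combination (-γ * E ^ (k + 1) *
      ((Polynomial.derivative (corrPoly n A γ η₀ b (k + 1))).eval (Real.log η) -
        (2 * ((k : ℝ) + 1) + 1 / γ) * (corrPoly n A γ η₀ b (k + 1)).eval (Real.log η))) * h +
      E ^ (k + 1) * η ^ (-(2 * ((k : ℝ) + 1) + 1 / γ)) *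
        (corrPoly n A γ η₀ b (k + 1)).eval (Real.log η) * hγ1
  -- The recursion turns the term of index `k + 1` into the second derivative of the term of index
  -- `k`. The lowest term has a polynomial of degree one and leaves the constant `singCoeff₂`.
  have hsum : ∑ k ∈ Finset.range (⌊1 / (2 * γ)⌋₊ + 1), -(2 * γ * ((k : ℝ) + 1)) * E ^ (k + 1) *
      powLog (2 * ((k : ℝ) + 1) + 1 / γ) (corrPoly n A γ η₀ b (k + 1)) η -
      ∑ k ∈ Finset.range (⌊1 / (2 * γ)⌋₊ + 1), E ^ (k + 1) *
        powLog (2 * ((k : ℝ) + 1) + 1 / γ) (corrPoly n A γ η₀ b (k + 1)) η -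
      γ * η * ∑ k ∈ Finset.range (⌊1 / (2 * γ)⌋₊ + 1), (E ^ (k + 1) *
        powLog (2 * ((k : ℝ) + 1) + 1 / γ + 1)
        (logDer (2 * ((k : ℝ) + 1) + 1 / γ) (corrPoly n A γ η₀ b (k + 1))) η) =
      E * (1 / ((n : ℝ) - 2) * ∑ k ∈ Finset.range ⌊1 / (2 * γ)⌋₊,
        E ^ (k + 1) * corr₂ n A γ η₀ b k η) - E * (η ^ (-(2 + 1 / γ)) * singCoeff₂ n A γ) := by
    rw [Finset.mul_sum, ← Finset.sum_sub_distrib, ← Finset.sum_sub_distrib,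
      Finset.sum_congr rfl fun k _ => hterm k, Finset.sum_range_succ', Finset.mul_sum,
      Finset.mul_sum, sub_eq_add_neg]
    congr 1
    · refine Finset.sum_congr rfl fun k _ => ?_
      rw [powLog_derivative_corrPoly hn hγ k η]
      ring
    · have e : leadCoeff n A γ * γ = singCoeff₂ n A γ := by
        rw [leadCoeff, singCoeff₂]; field_simp
      rw [Nat.cast_zero, zero_add, zero_add, mul_one, pow_one, corrPoly_one, powLog, ← e]
      simp only [Polynomial.derivative_add, Polynomial.derivative_C, Polynomial.derivative_C_mul,
        Polynomial.derivative_X, zero_add, mul_one, Polynomial.eval_C]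
      ring
  have h := hstep (2 + 1 / γ)
  have hγ1 : γ * (1 / γ) = 1 := by field_simp
  rw [pertT, pert, pert₁, singPart, singPhi₁]
  set r := ratio A (1 / γ) η
  set k₁ := singCoeff₁ n A γ θ
  set k₂ := singCoeff₂ n A γ
  linear_combination hsum - γ * E * (-(2 + 1 / γ) * (k₁ * (r - 1) - k₂ * Real.log r) -
    1 / γ * (r - 1) * (k₁ * r - k₂)) * h + E * η ^ (-(2 + 1 / γ)) *
      ((k₁ * (r - 1) - k₂ * Real.log r) + (r - 1) * (k₁ * r - k₂)) * hγ1

/-- The operator applied to the outer barrier. -/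
theorem innerOp_outerPart (hn : 3 ≤ n) (hA : 0 < A) (hγ : 0 < γ) (hη₀ : A < η₀) (hξ : 0 < ξ)
    {E r G P : ℝ} (hη : η = A + ξ * Real.exp (-γ * τ)) (hE : E = Real.exp (-2 * γ * τ))
    (hr : r = ratio A (1 / γ) η) (hG : G = 1 / γ * (r - 1) / η)
    (hP : P = ((n : ℝ) - 1) * ((n : ℝ) - 2)) :
    innerOp n A γ (outerPart n A γ η₀ b θ) ξ τ = ((n : ℝ) - 1) * E *
      ((θ - ((n : ℝ) - 6) / 4) * G ^ 2 -
        ((-(1 / γ + 1) * (G / η) * (P / r) + pert₂ n A γ η₀ b θ E η) /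
          (P / r + pert n A γ η₀ b θ E η) - -(1 / γ + 1) * (G / η) -
          1 / P * ∑ k ∈ Finset.range ⌊1 / (2 * γ)⌋₊, E ^ (k + 1) * corr₂ n A γ η₀ b k η +
          ((n : ℝ) - 6) / 4 * (((P * G / r + pert₁ n A γ η₀ b θ E η) /
            (P / r + pert n A γ η₀ b θ E η)) ^ 2 - G ^ 2))) := by
  have hn' : (3 : ℝ) ≤ n := by exact_mod_cast hn
  have hm0 : (n : ℝ) - 1 ≠ 0 := by linarith
  have hc0 : (n : ℝ) - 2 ≠ 0 := by linarith
  have hβ : 0 < 1 / γ := by positivity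
  have hηA : A < η := hη ▸ lt_outer_coord hξ
  have hη0 : 0 < η := hA.trans hηA
  have hr1 : 1 < r := hr ▸ one_lt_ratio hA hβ hηA
  have hr0 : r ≠ 0 := by linarith
  have hAβ := Real.rpow_pos_of_pos hA (1 / γ)
  have hlin := linear_part_pert (η₀ := η₀) (b := b) (θ := θ) hn hA hγ hηA E
  have d0 : wHat0 n A γ η = P / r := by rw [wHat0_eq, hP, hr]
  have d1 : deriv (wHat0 n A γ) η = P * G / r := by rw [deriv_wHat0 hA hγ hηA, hP, hG, hr]
  have d2 : deriv (deriv (wHat0 n A γ)) η = -(1 / γ + 1) * (G / η) * (P / r) := by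
    rw [(hasDerivAt_deriv_wHat0 hA hγ hηA).deriv, ← hr, hP, hG]
    field_simp
  have hE2 : Real.exp (-γ * τ) * Real.exp (-γ * τ) = E := by
    rw [hE, ← Real.exp_add]; congr 1; ring
  have hX : Real.exp (γ * τ) = (Real.exp (-γ * τ))⁻¹ := by
    rw [← Real.exp_neg]; congr 1; ring
  have hq : η ^ (-(2 + 1 / γ)) = (r - 1) / (r * A ^ (1 / γ)) / η ^ 2 := by
    have e : -(2 + 1 / γ) = -(1 / γ + (2 : ℕ)) := by push_cast; ring
    rw [e, rpow_neg_add_natCast hA hβ hηA, hr]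
  -- The term `(β + 1)G/η` will cancel `ŵ₀''/ŵ₀`, and `θG²` will meet `((n-6)/4)G²`. Their
  -- difference decides the sign.
  have hmain : E * η ^ (-(2 + 1 / γ)) * (r * (singCoeff₁ n A γ θ * (r - 1)
        - singCoeff₂ n A γ)) =
      ((n : ℝ) - 1) * E * (θ * G ^ 2 - (1 / γ + 1) * (G / η)) := by
    rw [hq, singCoeff₁, singCoeff₂, hG]
    field_simp
  rw [← hr, hmain] at hlin
  have hP' : 1 / ((n : ℝ) - 2) = ((n : ℝ) - 1) * (1 / P) := by rw [hP]; field_simp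
  rw [hP'] at hlin
  -- The order zero equation, solved by `ŵ₀`.
  have hzero : P - P / r - γ * η * (P * G / r) = 0 := by
    rw [hG]; field_simp; ring
  rw [innerOp, (hasDerivAt_outerPart_time hn hA hγ hη₀ hξ).deriv,
    (hasDerivAt_deriv_outerPart_space hn hA hγ hη₀ hξ).deriv,
    (hasDerivAt_outerPart_space hn hA hγ hη₀ hξ).deriv, outerPart_eq hn hA hγ hη₀ hξ, ← hη, ← hE,
    d0, d1, d2, ← hP, hX]
  have hξη : ξ * Real.exp (-γ * τ) = η - A := by rw [hη]; ring
  rw [hξη]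
  have hδ := (Real.exp_pos (-γ * τ)).ne'
  set δ := Real.exp (-γ * τ)
  set z₀ := pert n A γ η₀ b θ E η
  set z₁ := pert₁ n A γ η₀ b θ E η
  set z₂ := pert₂ n A γ η₀ b θ E η
  set S := ∑ k ∈ Finset.range ⌊1 / (2 * γ)⌋₊, E ^ (k + 1) * corr₂ n A γ η₀ b k η
  set T := pertT n A γ η₀ b θ E η
  have c1 : δ * (-(1 / γ + 1) * (G / η) * (P / r) + z₂) / (δ⁻¹ * (P / r + z₀)) =
      E * ((-(1 / γ + 1) * (G / η) * (P / r) + z₂) / (P / r + z₀)) := by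
    rw [← hE2, mul_div_mul_comm, div_inv_eq_mul]
  have c2 : (P * G / r + z₁) ^ 2 / (δ⁻¹ * (P / r + z₀)) ^ 2 =
      E * ((P * G / r + z₁) / (P / r + z₀)) ^ 2 := by
    rw [← hE2, mul_pow, inv_pow, div_pow, mul_comm (δ ^ 2)⁻¹, ← div_div, div_inv_eq_mul]
    ring
  have c3 : δ * (δ⁻¹ * (γ * (P / r + z₀) + T - γ * (η - A) * (P * G / r + z₁)) -
      (1 + γ) * (δ⁻¹ * (P / r + z₀))) =
      T - (P / r + z₀) - γ * (η - A) * (P * G / r + z₁) := by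
    field_simp
    ring
  rw [c1, c2, c3]
  linear_combination hlin + hzero

end outer


/-! ### Sign of the outer operator, and limits at a fixed inner coordinate. -/

section outer

variable {n : ℕ} {A γ η η₀ b θ ξ τ : ℝ}

/-- Far out and late, the outer barrier is positive and is a strict super- or subsolution. -/
theorem exists_outerPart_sign (hn : 3 ≤ n) (hA : 0 < A) (hγ : 0 < γ) (hη₀ : A < η₀)
    (hθ : θ - ((n : ℝ) - 6) / 4 ≠ 0) : ∃ h₀ : ℝ, 0 < h₀ ∧ ∀ ξ τ : ℝ, 0 < ξ →
      Real.exp (-γ * τ) + 1 / ξ ≤ h₀ → 0 < outerPart n A γ η₀ b θ ξ τ ∧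
        0 < (θ - ((n : ℝ) - 6) / 4) * innerOp n A γ (outerPart n A γ η₀ b θ) ξ τ := by
  have hn' : (3 : ℝ) ≤ n := by exact_mod_cast hn
  have hm : 0 < (n : ℝ) - 1 := by linarith
  have hβ : 0 < 1 / γ := by positivity
  obtain ⟨P, hP⟩ : ∃ P, P = ((n : ℝ) - 1) * ((n : ℝ) - 2) := ⟨_, rfl⟩
  have hP1 : 1 ≤ P := by rw [hP]; nlinarith
  obtain ⟨C, hC, hb⟩ := exists_pert_bounds hA hγ n η₀ b θ
  obtain ⟨K, h₁, hK, hh₁, herr⟩ := exists_nonlinear_error_le (((n : ℝ) - 6) / 4) hA hβ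
    (by linarith : 0 < P) hC
  set s := θ - ((n : ℝ) - 6) / 4 with hs
  have hs0 : 0 < |s| := abs_pos.2 hθ
  -- The last entry keeps the nonlinear error below `|s|G²/2`, half of the leading term.
  refine ⟨min (min 1 h₁) (|s| / (2 * K)), by positivity, fun ξ τ hξ hle => ?_⟩
  obtain ⟨η, hη⟩ : ∃ η, η = A + ξ * Real.exp (-γ * τ) := ⟨_, rfl⟩
  obtain ⟨r, hr⟩ : ∃ r, r = ratio A (1 / γ) η := ⟨_, rfl⟩
  obtain ⟨G, hG⟩ : ∃ G, G = 1 / γ * (r - 1) / η := ⟨_, rfl⟩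
  obtain ⟨E, hE⟩ : ∃ E, E = Real.exp (-2 * γ * τ) := ⟨_, rfl⟩
  obtain ⟨δ, hδ⟩ : ∃ δ, δ = Real.exp (-γ * τ) := ⟨_, rfl⟩
  have hηA : A < η := hη ▸ lt_outer_coord hξ
  have hη0 : 0 < η := hA.trans hηA
  have hr1 : 1 < r := hr ▸ one_lt_ratio hA hβ hηA
  have hr10 : 0 < r - 1 := by linarith
  have hG0 : 0 < G := by rw [hG]; positivity
  have hδ0 : 0 < δ := hδ ▸ Real.exp_pos _
  have hEδ : E = δ ^ 2 := by rw [hE, hδ, sq, ← Real.exp_add]; congr 1; ring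
  have hξ1 : 0 < 1 / ξ := by positivity
  -- Since `η - A = ξδ`, `rate_le` shows that being far out in the inner variable makes `δG` small.
  have hδG : δ * G ≤ 1 / ξ := by
    have h := rate_le hA hβ hηA
    rw [← hr, ← hG, show η - A = ξ * δ by rw [hη, hδ]; ring] at h
    calc δ * G ≤ δ * (1 / (ξ * δ)) := by gcongr
      _ = 1 / ξ := by field_simp
  rw [← hδ] at hle
  have hle1 := hle.trans ((min_le_left _ _).trans (min_le_left _ _))
  have hle2 := hle.trans ((min_le_left _ _).trans (min_le_right _ _))
  have hle3 := hle.trans (min_le_right _ _)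
  have hE0 : 0 ≤ E := by rw [hEδ]; positivity
  have hE1 : E ≤ 1 := by rw [hEδ]; nlinarith
  obtain ⟨b0, b1, b2, b3⟩ := hb η r G E hηA hr hG hE0 hE1
  obtain ⟨e0, e1⟩ := herr η r G δ _ _ _ _ hηA.le hr1 hG hδ0 (by linarith)
    (hEδ ▸ b0) (hEδ ▸ b1) (hEδ ▸ b2) (hEδ ▸ b3 P hP1)
  have hKh : K * (δ + δ * G) ≤ |s| / 2 := by
    have : δ + δ * G ≤ |s| / (2 * K) := by linarith
    calc K * (δ + δ * G) ≤ K * (|s| / (2 * K)) := by gcongr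
      _ = |s| / 2 := by field_simp
  constructor
  · rw [outerPart_eq hn hA hγ hη₀ hξ, ← hη, ← hE, wHat0_eq, ← hP, ← hr, hEδ]
    have : 0 < P / r / 2 := by positivity
    exact mul_pos (Real.exp_pos _) (by linarith)
  · rw [innerOp_outerPart hn hA hγ hη₀ hξ hη hE hr hG hP, ← hs, hEδ]
    set e := (-(1 / γ + 1) * (G / η) * (P / r) + _) / _ - -(1 / γ + 1) * (G / η) - _ + _
    have he : |s * e| ≤ s ^ 2 * G ^ 2 / 2 := by
      rw [abs_mul]
      calc |s| * |e| ≤ |s| * (|s| / 2 * G ^ 2) := by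
            gcongr
            exact e1.trans (by gcongr)
        _ = |s| ^ 2 * G ^ 2 / 2 := by ring
        _ = _ := by rw [sq_abs]
    have hsG : 0 < s ^ 2 * G ^ 2 := by positivity
    have := (abs_le.1 he).2
    have e4 : s * (((n : ℝ) - 1) * δ ^ 2 * (s * G ^ 2 - e)) =
      ((n : ℝ) - 1) * δ ^ 2 * (s ^ 2 * G ^ 2 - s * e) := by ring
    rw [e4]
    exact mul_pos (by positivity) (by linarith)

/-! ### Limits at a fixed inner coordinate -/

theorem tendsto_exp_neg_mul (hγ : 0 < γ) :
    Tendsto (fun τ => Real.exp (-γ * τ)) atTop (𝓝[>] 0) := by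
  refine tendsto_nhdsWithin_iff.2 ⟨?_, Eventually.of_forall fun τ => Real.exp_pos _⟩
  refine Real.tendsto_exp_atBot.comp ?_
  exact tendsto_id.const_mul_atTop_of_neg (by linarith)

theorem tendsto_outer_coord (ξ : ℝ) :
    Tendsto (fun δ => A + ξ * δ) (𝓝[>] 0) (𝓝 A) := by
  have : Continuous fun δ : ℝ => A + ξ * δ := by fun_prop
  simpa using this.continuousWithinAt.tendsto (x := (0 : ℝ)) (s := Ioi 0)

/-- The inverse of `δ · ratio` is the difference quotient at `δ = 0` of `1 - (η/A)^(-β)` along `η =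
A + ξδ`, whose derivative is `βξ/A`. -/
theorem tendsto_mul_ratio (hA : 0 < A) {β : ℝ} (hβ : 0 < β) (hξ : 0 < ξ) :
    Tendsto (fun δ => δ * ratio A β (A + ξ * δ)) (𝓝[>] 0) (𝓝 (A / (β * ξ))) := by
  have h1 : HasDerivAt (fun δ : ℝ => A + ξ * δ) (ξ * 1) 0 :=
    ((hasDerivAt_id _).const_mul ξ).const_add A
  have h2 := (hasDerivAt_rpow_div (η := A + ξ * 0) hA (by simpa) β).comp (0 : ℝ) h1
  have h3 := (hasDerivAt_iff_tendsto_slope.1 h2).mono_left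
    (nhdsWithin_mono (0 : ℝ) (fun x (hx : 0 < x) => hx.ne'))
  have h4 := (h3.neg).inv₀ (by
    simp only [mul_zero, add_zero, div_self hA.ne', Real.one_rpow]
    have : 0 < β * 1 / A * (ξ * 1) := by positivity
    intro h
    rw [neg_mul, neg_div, neg_mul, neg_neg] at h
    linarith)
  have e : (-(-β * ((A + ξ * 0) / A) ^ (-β) / (A + ξ * 0) * (ξ * 1)))⁻¹ = A / (β * ξ) := by
    simp only [mul_zero, add_zero, div_self hA.ne', Real.one_rpow]
    field_simp
  rw [e] at h4
  refine h4.congr' ?_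
  filter_upwards [self_mem_nhdsWithin] with δ hδ
  simp only [slope, Function.comp, mul_zero, add_zero, div_self hA.ne', Real.one_rpow, sub_zero,
    vsub_eq_sub, smul_eq_mul, ratio]
  rw [← mul_neg, mul_inv, inv_inv, neg_sub]

/-- `log r = log(δr) - log δ`, where `δr` converges and `δ log δ → 0`. -/
theorem tendsto_mul_log_ratio (hA : 0 < A) {β : ℝ} (hβ : 0 < β) (hξ : 0 < ξ) :
    Tendsto (fun δ => δ * Real.log (ratio A β (A + ξ * δ))) (𝓝[>] 0) (𝓝 0) := by
  have h1 := (tendsto_mul_ratio hA hβ hξ).log (by positivity)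
  have hid : Tendsto (fun δ : ℝ => δ) (𝓝[>] 0) (𝓝 0) := tendsto_id.mono_left nhdsWithin_le_nhds
  have htl : Tendsto (fun δ : ℝ => Real.log δ * δ) (𝓝[>] 0) (𝓝 0) := by
    simpa using tendsto_log_mul_rpow_nhdsGT_zero one_pos
  have h2 := (hid.mul h1).sub htl
  rw [zero_mul, sub_zero] at h2
  refine h2.congr' ?_
  filter_upwards [self_mem_nhdsWithin] with δ (hδ : 0 < δ)
  have hr := one_lt_ratio hA hβ (by nlinarith [mul_pos hξ hδ] : A < A + ξ * δ)
  rw [Real.log_mul hδ.ne' (by linarith)]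
  ring

theorem tendsto_outer_rpow (hA : 0 < A) (ξ ρ : ℝ) :
    Tendsto (fun δ => (A + ξ * δ) ^ ρ) (𝓝[>] 0) (𝓝 (A ^ ρ)) :=
  (tendsto_outer_coord ξ).rpow_const (Or.inl hA.ne')

theorem tendsto_outer_powLog (hA : 0 < A) (ξ ρ : ℝ) (p : Polynomial ℝ) :
    Tendsto (fun δ => powLog ρ p (A + ξ * δ)) (𝓝[>] 0) (𝓝 (powLog ρ p A)) :=
  (hasDerivAt_powLog ρ p hA).continuousAt.tendsto.comp (tendsto_outer_coord ξ)

theorem tendsto_mul_singPart (hA : 0 < A) {β : ℝ} (hβ : 0 < β) (hξ : 0 < ξ) (k₁ k₂ : ℝ) :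
    Tendsto (fun δ => δ * singPart A β k₁ k₂ (A + ξ * δ)) (𝓝[>] 0)
      (𝓝 (A ^ (-(2 + β)) * (k₁ * (A / (β * ξ))))) := by
  have hid : Tendsto (fun δ : ℝ => δ) (𝓝[>] 0) (𝓝 0) := tendsto_id.mono_left nhdsWithin_le_nhds
  have h := (tendsto_outer_rpow hA ξ (-(2 + β))).mul
    ((((tendsto_mul_ratio hA hβ hξ).sub hid).const_mul k₁).sub
      ((tendsto_mul_log_ratio hA hβ hξ).const_mul k₂))
  rw [sub_zero, mul_zero, sub_zero] at h
  refine h.congr fun δ => ?_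
  rw [singPart]
  ring

theorem tendsto_sq_mul_singPhi₁ (hA : 0 < A) {β : ℝ} (hβ : 0 < β) (hξ : 0 < ξ) (k₁ k₂ : ℝ) :
    Tendsto (fun δ => δ ^ 2 * ((A + ξ * δ) ^ (-(2 + β + 1)) *
      singPhi₁ β k₁ k₂ (ratio A β (A + ξ * δ)))) (𝓝[>] 0)
      (𝓝 (A ^ (-(2 + β + 1)) * -(β * (A / (β * ξ)) * (k₁ * (A / (β * ξ)))))) := by
  have hid : Tendsto (fun δ : ℝ => δ) (𝓝[>] 0) (𝓝 0) := tendsto_id.mono_left nhdsWithin_le_nhds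
  have hr := tendsto_mul_ratio hA hβ hξ
  have h1 := ((hr.sub hid).const_mul k₁).sub ((tendsto_mul_log_ratio hA hβ hξ).const_mul k₂)
  have h2 := (((hr.sub hid).const_mul β)).mul ((hr.const_mul k₁).sub (hid.const_mul k₂))
  have h := (tendsto_outer_rpow hA ξ (-(2 + β + 1))).mul
    (((hid.mul h1).const_mul (-(2 + β))).sub h2)
  simp only [sub_zero, mul_zero, zero_mul, zero_sub] at h
  refine h.congr fun δ => ?_
  rw [singPhi₁]
  ring

theorem tendsto_sum_powLog (hA : 0 < A) (ξ : ℝ) (N : ℕ) {e : ℝ → ℕ → ℝ}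
    (he : ∀ k, Tendsto (fun δ => e δ k) (𝓝[>] 0) (𝓝 0)) (ρ : ℕ → ℝ) (p : ℕ → Polynomial ℝ) :
    Tendsto (fun δ => ∑ k ∈ Finset.range N, e δ k * powLog (ρ k) (p k) (A + ξ * δ))
      (𝓝[>] 0) (𝓝 0) := by
  have := tendsto_finsetSum (Finset.range N) fun k _ =>
    (he k).mul (tendsto_outer_powLog hA ξ (ρ k) (p k))
  simpa using this

/-- Only `ŵ₀` and the simple pole of `θŵ₂` survive. The logarithm and the regular corrections carry
positive powers of `δ`. -/
theorem tendsto_outerPart (hn : 3 ≤ n) (hA : 0 < A) (hγ : 0 < γ) (hη₀ : A < η₀) (hξ : 0 < ξ)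
    {κ : ℝ} (hκ : κ = γ * A / ((n : ℝ) - 1)) :
    Tendsto (fun τ => outerPart n A γ η₀ b θ ξ τ) atTop
      (𝓝 (((n : ℝ) - 2) / κ * ξ + θ / κ / ξ)) := by
  have hn' : (3 : ℝ) ≤ n := by exact_mod_cast hn
  have hm : 0 < (n : ℝ) - 1 := by linarith
  have hβ : 0 < 1 / γ := by positivity
  have hr := tendsto_mul_ratio hA hβ hξ
  have hid : Tendsto (fun δ : ℝ => δ) (𝓝[>] 0) (𝓝 0) := tendsto_id.mono_left nhdsWithin_le_nhds
  have h1 := (hr.inv₀ (by positivity)).const_mul (((n : ℝ) - 1) * ((n : ℝ) - 2))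
  have h2 := tendsto_mul_singPart hA hβ hξ (singCoeff₁ n A γ θ) (singCoeff₂ n A γ)
  have h3 := tendsto_sum_powLog hA ξ (⌊1 / (2 * γ)⌋₊ + 1) (e := fun δ k => δ ^ (2 * k + 1))
    (fun k => by simpa using hid.pow (2 * k + 1)) (fun k => 2 * ((k : ℝ) + 1) + 1 / γ)
    (fun k => corrPoly n A γ η₀ b (k + 1))
  have h := ((h1.add (h2.add h3)).comp (tendsto_exp_neg_mul hγ))
  have hA2 : A ^ (-(2 + 1 / γ)) * A ^ (1 / γ) = (A ^ 2)⁻¹ := by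
    rw [← Real.rpow_add hA, show -(2 + 1 / γ) + 1 / γ = -(2 : ℕ) by push_cast; ring,
      Real.rpow_neg hA.le, Real.rpow_natCast]
  have e : ((n : ℝ) - 1) * ((n : ℝ) - 2) * (A / (1 / γ * ξ))⁻¹ +
      (A ^ (-(2 + 1 / γ)) * (singCoeff₁ n A γ θ * (A / (1 / γ * ξ))) + 0) =
      ((n : ℝ) - 2) / κ * ξ + θ / κ / ξ := by
    have : A ^ (-(2 + 1 / γ)) * (singCoeff₁ n A γ θ * (A / (1 / γ * ξ))) =
        θ * (((n : ℝ) - 1) * (1 / γ) ^ 2) * (A / (1 / γ * ξ)) *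
          (A ^ (-(2 + 1 / γ)) * A ^ (1 / γ)) := by
      rw [singCoeff₁]; ring
    rw [this, hA2, hκ]
    field_simp
    ring
  rw [e] at h
  refine h.congr fun τ => ?_
  rw [outerPart_eq hn hA hγ hη₀ hξ, wHat0_eq, pert]
  have hE : Real.exp (-2 * γ * τ) = Real.exp (-γ * τ) ^ 2 := by
    rw [sq, ← Real.exp_add]; congr 1; ring
  have hX : Real.exp (γ * τ) = (Real.exp (-γ * τ))⁻¹ := by
    rw [← Real.exp_neg]; congr 1; ring
  have hδ := (Real.exp_pos (-γ * τ)).ne'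
  simp only [Function.comp]
  rw [hE, hX, mul_add, mul_add, Finset.mul_sum]
  set δ := Real.exp (-γ * τ)
  congr 1
  · rw [mul_inv]; ring
  congr 1
  · field_simp
  · refine Finset.sum_congr rfl fun k _ => ?_
    field_simp
    ring

theorem tendsto_deriv_outerPart_space (hn : 3 ≤ n) (hA : 0 < A) (hγ : 0 < γ) (hη₀ : A < η₀)
    (hξ : 0 < ξ) {κ : ℝ} (hκ : κ = γ * A / ((n : ℝ) - 1)) :
    Tendsto (fun τ => deriv (fun x => outerPart n A γ η₀ b θ x τ) ξ) atTop
      (𝓝 (((n : ℝ) - 2) / κ - θ / κ / ξ ^ 2)) := by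
  have hn' : (3 : ℝ) ≤ n := by exact_mod_cast hn
  have hm : 0 < (n : ℝ) - 1 := by linarith
  have hβ : 0 < 1 / γ := by positivity
  have hid : Tendsto (fun δ : ℝ => δ) (𝓝[>] 0) (𝓝 0) := tendsto_id.mono_left nhdsWithin_le_nhds
  have h1 := (((tendsto_outer_coord (A := A) ξ).div_const A).rpow_const (p := -(1 / γ))
    (Or.inl (by rw [div_self hA.ne']; norm_num))).const_mul (1 / γ) |>.div
      (tendsto_outer_coord (A := A) ξ) hA.ne' |>.const_mul (((n : ℝ) - 1) * ((n : ℝ) - 2))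
  have h2 := tendsto_sq_mul_singPhi₁ hA hβ hξ (singCoeff₁ n A γ θ) (singCoeff₂ n A γ)
  have h3 := tendsto_sum_powLog hA ξ (⌊1 / (2 * γ)⌋₊ + 1) (e := fun δ k => δ ^ (2 * (k + 1)))
    (fun k => by simpa using hid.pow (2 * (k + 1))) (fun k => 2 * ((k : ℝ) + 1) + 1 / γ + 1)
    (fun k => logDer (2 * ((k : ℝ) + 1) + 1 / γ) (corrPoly n A γ η₀ b (k + 1)))
  have h := ((h1.add (h2.add h3)).comp (tendsto_exp_neg_mul hγ))
  have hA2 : A ^ (-(2 + 1 / γ + 1)) * A ^ (1 / γ) = (A ^ 3)⁻¹ := by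
    rw [← Real.rpow_add hA, show -(2 + 1 / γ + 1) + 1 / γ = -(3 : ℕ) by push_cast; ring,
      Real.rpow_neg hA.le, Real.rpow_natCast]
  have e : ((n : ℝ) - 1) * ((n : ℝ) - 2) * (1 / γ * (A / A) ^ (-(1 / γ)) / A) +
      (A ^ (-(2 + 1 / γ + 1)) * -(1 / γ * (A / (1 / γ * ξ)) * (singCoeff₁ n A γ θ *
        (A / (1 / γ * ξ)))) + 0) =
      ((n : ℝ) - 2) / κ - θ / κ / ξ ^ 2 := by
    have : A ^ (-(2 + 1 / γ + 1)) * -(1 / γ * (A / (1 / γ * ξ)) * (singCoeff₁ n A γ θ *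
        (A / (1 / γ * ξ)))) =
        -(1 / γ * (A / (1 / γ * ξ)) * (θ * (((n : ℝ) - 1) * (1 / γ) ^ 2) * (A / (1 / γ * ξ)))) *
          (A ^ (-(2 + 1 / γ + 1)) * A ^ (1 / γ)) := by
      rw [singCoeff₁]; ring
    rw [this, hA2, hκ, div_self hA.ne', Real.one_rpow]
    field_simp
    ring
  rw [e] at h
  refine h.congr fun τ => ?_
  have hE : Real.exp (-2 * γ * τ) = Real.exp (-γ * τ) ^ 2 := by
    rw [sq, ← Real.exp_add]; congr 1; ring
  rw [(hasDerivAt_outerPart_space hn hA hγ hη₀ hξ).deriv,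
    (hasDerivAt_wHat0 hA (hA.trans (lt_outer_coord hξ))).deriv, pert₁, hE]
  simp only [Function.comp, ← pow_mul, Pi.div_apply]

theorem tendsto_exp_mul_deriv_outerPart_time (hn : 3 ≤ n) (hA : 0 < A) (hγ : 0 < γ) (hη₀ : A < η₀)
    (hξ : 0 < ξ) :
    Tendsto (fun τ => Real.exp (-γ * τ) * deriv (fun t => outerPart n A γ η₀ b θ ξ t) τ) atTop
      (𝓝 0) := by
  have hβ : 0 < 1 / γ := by positivity
  have hid : Tendsto (fun δ : ℝ => δ) (𝓝[>] 0) (𝓝 0) := tendsto_id.mono_left nhdsWithin_le_nhds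
  have hδ := hid.comp (tendsto_exp_neg_mul hγ)
  have h1 := (hδ.mul (tendsto_outerPart (b := b) (θ := θ) hn hA hγ hη₀ hξ rfl)).const_mul γ
  have h2 := (hδ.mul (tendsto_deriv_outerPart_space (b := b) (θ := θ) hn hA hγ hη₀ hξ
    rfl)).const_mul (γ * ξ)
  have h3 := ((hid.mul (tendsto_mul_singPart hA hβ hξ (singCoeff₁ n A γ θ)
    (singCoeff₂ n A γ))).const_mul (-(2 * γ))).comp (tendsto_exp_neg_mul hγ)
  have h4 := (tendsto_sum_powLog hA ξ (⌊1 / (2 * γ)⌋₊ + 1)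
    (e := fun δ k => -(2 * γ * ((k : ℝ) + 1)) * δ ^ (2 * (k + 1)))
    (fun k => by simpa using (hid.pow (2 * (k + 1))).const_mul (-(2 * γ * ((k : ℝ) + 1))))
    (fun k => 2 * ((k : ℝ) + 1) + 1 / γ)
    (fun k => corrPoly n A γ η₀ b (k + 1))).comp (tendsto_exp_neg_mul hγ)
  have h := (h1.add (h3.add h4)).sub h2
  simp only [mul_zero, zero_mul, add_zero, sub_zero] at h
  refine h.congr fun τ => ?_
  have hE : Real.exp (-2 * γ * τ) = Real.exp (-γ * τ) ^ 2 := by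
    rw [sq, ← Real.exp_add]; congr 1; ring
  have hX : Real.exp (γ * τ) = (Real.exp (-γ * τ))⁻¹ := by
    rw [← Real.exp_neg]; congr 1; ring
  have hδ := (Real.exp_pos (-γ * τ)).ne'
  rw [(hasDerivAt_outerPart_time hn hA hγ hη₀ hξ).deriv,
    (hasDerivAt_outerPart_space hn hA hγ hη₀ hξ).deriv, outerPart_eq hn hA hγ hη₀ hξ, pertT, hX, hE]
  simp only [Function.comp, ← pow_mul]
  set δ := Real.exp (-γ * τ)
  field_simp

end outer


/-! ### Smoothness of the outer barrier and its monotonicity in `θ`. -/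

section outer

variable {n : ℕ} {A γ η₀ b θ : ℝ}

theorem contDiffOn_ratio (hA : 0 < A) {β : ℝ} (hβ : 0 < β) : ContDiffOn ℝ ∞ (ratio A β) (Ioi A) := by
  intro η hη
  have hη0 : 0 < η := hA.trans hη
  have h1 : 1 - (η / A) ^ (-β) ≠ 0 := by linarith [(rpow_div_mem hA hβ hη).2]
  have h2 : η / A ≠ 0 := by positivity
  exact ((contDiffAt_const.sub ((contDiffAt_id.div_const A).rpow_const_of_ne h2)).inv
    h1).contDiffWithinAt

theorem contDiffOn_powLog (ρ : ℝ) (p : Polynomial ℝ) : ContDiffOn ℝ ∞ (powLog ρ p) (Ioi 0) := by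
  intro η (hη : 0 < η)
  exact ((contDiffAt_id.rpow_const_of_ne hη.ne').mul ((Polynomial.contDiff_aeval p ∞).contDiffAt.comp η
    (Real.contDiffAt_log.2 hη.ne'))).contDiffWithinAt

theorem contDiffOn_singPart (hA : 0 < A) {β : ℝ} (hβ : 0 < β) (k₁ k₂ : ℝ) :
    ContDiffOn ℝ ∞ (singPart A β k₁ k₂) (Ioi A) := by
  have h1 : ContDiffOn ℝ ∞ (fun η : ℝ => η ^ (-(2 + β))) (Ioi A) := fun η hη =>
    (contDiffAt_id.rpow_const_of_ne (hA.trans hη).ne').contDiffWithinAt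
  have hr := contDiffOn_ratio hA hβ
  exact h1.mul ((contDiffOn_const.mul (hr.sub contDiffOn_const)).sub
    (contDiffOn_const.mul (hr.log fun η hη => by linarith [one_lt_ratio hA hβ hη])))

theorem contDiffOn_outerPart (hn : 3 ≤ n) (hA : 0 < A) (hγ : 0 < γ) (hη₀ : A < η₀) :
    ContDiffOn ℝ ∞ (fun q : ℝ × ℝ => outerPart n A γ η₀ b θ q.1 q.2) (Ioi 0 ×ˢ univ) := by
  have hβ : 0 < 1 / γ := by positivity
  have hη : ContDiffOn ℝ ∞ (fun q : ℝ × ℝ => A + q.1 * Real.exp (-γ * q.2)) (Ioi 0 ×ˢ univ) :=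
    (contDiff_const.add (contDiff_fst.mul (contDiff_const.mul contDiff_snd).exp)).contDiffOn
  have hmaps : MapsTo (fun q : ℝ × ℝ => A + q.1 * Real.exp (-γ * q.2)) (Ioi 0 ×ˢ univ) (Ioi A) :=
    fun q hq => lt_outer_coord hq.1
  have hmaps0 := hmaps.mono_right (Ioi_subset_Ioi hA.le)
  have hE : ContDiffOn ℝ ∞ (fun q : ℝ × ℝ => Real.exp (-2 * γ * q.2)) (Ioi 0 ×ˢ univ) :=
    (contDiff_const.mul contDiff_snd).exp.contDiffOn
  have hX : ContDiffOn ℝ ∞ (fun q : ℝ × ℝ => Real.exp (γ * q.2)) (Ioi 0 ×ˢ univ) :=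
    (contDiff_const.mul contDiff_snd).exp.contDiffOn
  have h0 := (contDiffOn_ratio hA hβ).comp hη hmaps
  have h1 := (contDiffOn_singPart hA hβ (singCoeff₁ n A γ θ) (singCoeff₂ n A γ)).comp hη hmaps
  have h2 : ∀ k ∈ Finset.range (⌊1 / (2 * γ)⌋₊ + 1), _ := fun k _ => (hE.pow (k + 1)).mul
    ((contDiffOn_powLog (2 * ((k : ℝ) + 1) + 1 / γ) (corrPoly n A γ η₀ b (k + 1))).comp hη hmaps0)
  have h := hX.mul (((contDiffOn_const (c := ((n : ℝ) - 1) * ((n : ℝ) - 2))).div h0 fun q hq => by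
    have := one_lt_ratio hA hβ (hmaps hq)
    simp only [Function.comp]
    linarith).add ((hE.mul h1).add (ContDiffOn.sum h2)))
  refine h.congr fun q hq => ?_
  rw [outerPart_eq hn hA hγ hη₀ hq.1, wHat0_eq, pert]
  rfl

theorem outerPart_strictMono_param (hn : 3 ≤ n) (hA : 0 < A) (hγ : 0 < γ) {θ' ξ τ : ℝ}
    (hξ : 0 < ξ) (hθ : θ < θ') :
    outerPart n A γ η₀ b θ ξ τ < outerPart n A γ η₀ b θ' ξ τ := by
  have hn' : (3 : ℝ) ≤ n := by exact_mod_cast hn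
  have hm : 0 < (n : ℝ) - 1 := by linarith
  have hη := lt_outer_coord (A := A) (γ := γ) (τ := τ) hξ
  have hw : 0 < wHat2 n A γ (A + ξ * Real.exp (-γ * τ)) := by
    rw [wHat2_eq hn hA hγ hη]
    have h1 := Real.rpow_pos_of_pos (hA.trans hη) (-(2 + 1 / γ))
    have h2 := Real.rpow_pos_of_pos hA (1 / γ)
    have h3 : 0 < ratio A (1 / γ) (A + ξ * Real.exp (-γ * τ)) - 1 := by
      linarith [one_lt_ratio hA (by positivity : 0 < 1 / γ) hη]
    positivity
  unfold outerPart wHat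
  gcongr

end outer

/-! ### Inversion of a profile and comparison of slopes. -/

namespace IsProfile

variable {c κ : ℝ} {w p : ℝ → ℝ}

/-- A profile has a smooth inverse on the positive half-line. -/
theorem exists_inverse (h : IsProfile c κ w p) (hc : 0 < c) (hκ : 0 < κ) :
    ∃ W : ℝ → ℝ, ContDiffOn ℝ ∞ W (Ioi 0) ∧ (∀ y, 0 < y → w (W y) = y) ∧ ∀ t, W (w t) = t := by
  -- Passing to `log w`, with derivative `p > 0` and range `ℝ`, gives a smooth inverse on the whole
  -- line.
  have hcd : ContDiff ℝ ∞ fun t => Real.log (w t) := h.contDiff.log fun t => (h.pos t).ne'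
  have hmono : StrictMono fun t => Real.log (w t) := fun s t hst =>
    Real.log_lt_log (h.pos s) (h.strictMono_w hc hκ hst)
  have hbot : Tendsto (fun t => Real.log (w t)) atBot atBot :=
    Real.tendsto_log_nhdsGT_zero.comp (tendsto_nhdsWithin_iff.2
      ⟨h.tendsto_w_atBot hc hκ, Eventually.of_forall h.pos⟩)
  have htop : Tendsto (fun t => Real.log (w t)) atTop atTop :=
    Real.tendsto_log_atTop.comp (h.tendsto_w_atTop hc hκ)
  have hsurj := hcd.continuous.surjective htop hbot
  set f := (hmono.orderIsoOfSurjective _ hsurj).toHomeomorph with hf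
  have hfe : ∀ t, f t = Real.log (w t) := fun t => rfl
  have hsymm : ContDiff ℝ ∞ f.symm := by
    refine f.contDiff_symm_deriv (f' := p) (fun t => (h.p_pos hc hκ t).ne') (fun t => ?_) hcd
    have := (h.deriv_w t).log (h.pos t).ne'
    rwa [mul_div_cancel_left₀ _ (h.pos t).ne'] at this
  refine ⟨fun y => f.symm (Real.log y), ?_, fun y hy => ?_, fun t => ?_⟩
  · exact hsymm.comp_contDiffOn (contDiffOn_id.log fun y (hy : 0 < y) => hy.ne')
  · have h1 := f.apply_symm_apply (Real.log y)
    rw [hfe] at h1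
    exact Real.log_injOn_pos (h.pos _) hy h1
  · exact f.symm_apply_apply t

/-- The slope of the profile where it takes the value `c / κ * ξ + θ / κ / ξ`. -/
theorem tendsto_sq_mul_deriv_inverse (h : IsProfile c κ w p) (hc : 0 < c) (hκ : 0 < κ) (θ : ℝ)
    {W : ℝ → ℝ} (hW : ∀ y, 0 < y → w (W y) = y) :
    Tendsto (fun ξ => ξ ^ 2 * (deriv w (W (c / κ * ξ + θ / κ / ξ)) - c / κ)) atTop
      (𝓝 (-((c / 4 - 1) / κ))) := by
  set ℓ : ℝ → ℝ := fun ξ => c / κ * ξ + θ / κ / ξ with hℓ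
  have ha : 0 < c / κ := by positivity
  have hdiv : Tendsto (fun ξ : ℝ => θ / κ / ξ) atTop (𝓝 0) := tendsto_const_nhds.div_atTop tendsto_id
  have hℓtop : Tendsto ℓ atTop atTop := (tendsto_id.const_mul_atTop ha).atTop_add hdiv
  have hmono := h.strictMono_w hc hκ
  have hYtop : Tendsto (fun ξ => W (ℓ ξ)) atTop atTop := by
    refine tendsto_atTop.2 fun T => ?_
    filter_upwards [hℓtop.eventually_ge_atTop (w T), hℓtop.eventually_gt_atTop 0] with ξ h1 h2
    rw [← hW _ h2] at h1
    exact hmono.le_iff_le.1 h1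
  have h1 : Tendsto (fun ξ => ℓ ξ / ξ) atTop (𝓝 (c / κ)) := by
    have h2 : Tendsto (fun ξ : ℝ => c / κ + θ / κ / ξ * ξ⁻¹) atTop (𝓝 (c / κ + 0 * 0)) :=
      (hdiv.mul tendsto_inv_atTop_zero).const_add _
    rw [zero_mul, add_zero] at h2
    refine h2.congr' ?_
    filter_upwards [eventually_gt_atTop 0] with ξ hξ
    simp only [hℓ]
    field_simp
  have h2 := (h.tendsto_div_id hc hκ).comp hYtop
  -- Both `w(Y)/Y` and `ℓ(ξ)/ξ` tend to `c/κ`, and `w(Y) = ℓ(ξ)` for `Y = W(ℓ(ξ))`. So `Y ~ ξ`,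
  -- which is all that the coefficient of `ξ⁻²` requires.
  have h3 : Tendsto (fun ξ => ξ / W (ℓ ξ)) atTop (𝓝 1) := by
    have := h2.div h1 ha.ne'
    rw [div_self ha.ne'] at this
    refine this.congr' ?_
    filter_upwards [hℓtop.eventually_gt_atTop 0, eventually_gt_atTop 0,
      hYtop.eventually_gt_atTop 0] with ξ hy hξ hY
    simp only [Function.comp, Pi.div_apply, hW _ hy]
    field_simp
  have h4 := (h3.pow 2).mul ((h.tendsto_sq_mul_deriv_sub hc hκ).comp hYtop)
  rw [one_pow, one_mul] at h4
  refine h4.congr' ?_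
  filter_upwards [hYtop.eventually_gt_atTop 0] with ξ hY
  rw [show c / κ * ξ + θ / κ / ξ = ℓ ξ from rfl]
  simp only [Function.comp, (h.deriv_w _).deriv]
  generalize W (ℓ ξ) = Y at hY ⊢
  field_simp

/-- Far out, the slope of the profile and that of `ξ ↦ c / κ * ξ + θ / κ / ξ` are ordered. -/
theorem eventually_slope_gap (h : IsProfile c κ w p) (hc : 0 < c) (hκ : 0 < κ) {θ : ℝ}
    (hθ : θ - (c / 4 - 1) ≠ 0) {W : ℝ → ℝ} (hW : ∀ y, 0 < y → w (W y) = y) :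
    ∀ᶠ ξ in atTop, 0 < (θ - (c / 4 - 1)) *
      (deriv w (W (c / κ * ξ + θ / κ / ξ)) - (c / κ - θ / κ / ξ ^ 2)) := by
  -- After multiplication by `ξ²` the slope difference tends to `(θ - (c/4 - 1))/κ`, so its product
  -- with `θ - (c/4 - 1)` has a positive limit.
  have h1 := ((h.tendsto_sq_mul_deriv_inverse hc hκ θ hW).add_const (θ / κ)).const_mul
    (θ - (c / 4 - 1))
  have h2 : 0 < (θ - (c / 4 - 1)) * (-((c / 4 - 1) / κ) + θ / κ) := by
    have : (θ - (c / 4 - 1)) * (-((c / 4 - 1) / κ) + θ / κ) = (θ - (c / 4 - 1)) ^ 2 / κ := by ring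
    rw [this]; positivity
  filter_upwards [h1.eventually_const_lt h2, eventually_gt_atTop 0] with ξ hξ hξ0
  refine pos_of_mul_pos_right (a := ξ ^ 2) ?_ (by positivity)
  refine hξ.trans_eq ?_
  field_simp
  ring

end IsProfile


/-! ### Gluing the soliton to the outer barrier. -/

theorem innerOp_congr {n : ℕ} {A γ : ℝ} {f g : ℝ → ℝ → ℝ} {ξ τ : ℝ} (ht : f ξ = g ξ)
    (hx : (fun x => f x τ) =ᶠ[𝓝 ξ] fun x => g x τ) : innerOp n A γ f ξ τ = innerOp n A γ g ξ τ := by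
  unfold innerOp
  rw [ht, hx.deriv.deriv_eq, hx.deriv_eq]

/-- The shift which glues `a⁻¹ w` to the outer barrier at `ξ₁`, for an inverse `W` of `w`. -/
noncomputable def shift (n : ℕ) (A γ η₀ b θ a ξ₁ : ℝ) (W : ℝ → ℝ) (τ : ℝ) : ℝ :=
  W (a * outerPart n A γ η₀ b θ ξ₁ τ) - ξ₁

section glue

variable {n : ℕ} {A γ η₀ b θ a ξ₁ τ₀ κ : ℝ} {w p W : ℝ → ℝ}

theorem contDiff_outerPart_time (hn : 3 ≤ n) (hA : 0 < A) (hγ : 0 < γ) (hη₀ : A < η₀)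
    (hξ₁ : 0 < ξ₁) : ContDiff ℝ ∞ fun τ => outerPart n A γ η₀ b θ ξ₁ τ := by
  rw [← contDiffOn_univ]
  exact (contDiffOn_outerPart (θ := θ) (b := b) hn hA hγ hη₀).comp
    (contDiff_const.prodMk contDiff_id).contDiffOn fun τ _ => ⟨hξ₁, mem_univ _⟩

theorem isGluingShift_shift (hn : 3 ≤ n) (hA : 0 < A) (hγ : 0 < γ) (hη₀ : A < η₀) (hξ₁ : 0 < ξ₁)
    (hW : ContDiffOn ℝ ∞ W (Ioi 0)) (hwW : ∀ y, 0 < y → w (W y) = y) (hWw : ∀ t, W (w t) = t)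
    (ha : 0 < a) (hpos : ∀ τ, τ₀ ≤ τ → 0 < outerPart n A γ η₀ b θ ξ₁ τ) :
    IsGluingShift n A γ η₀ b θ w a ξ₁ τ₀ (shift n A γ η₀ b θ a ξ₁ W) := by
  constructor
  · refine (hW.comp (contDiffOn_const.mul (contDiff_outerPart_time hn hA hγ hη₀ hξ₁).contDiffOn)
      fun τ hτ => mul_pos ha (hpos τ hτ)).sub contDiffOn_const
  · intro τ hτ c
    have h1 := hwW _ (mul_pos ha (hpos τ hτ))
    unfold shift
    constructor
    · intro h
      rw [h, ← mul_assoc, mul_one_div_cancel ha.ne', one_mul, hWw]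
      ring
    · rintro rfl
      rw [add_sub_cancel, h1]
      field_simp

/-- These three facts make the motion of the shift negligible: in the operator its velocity appears
only multiplied by `e^(-γτ)`. -/
theorem tendsto_shift (hn : 3 ≤ n) (hA : 0 < A) (hγ : 0 < γ) (hη₀ : A < η₀) (hξ₁ : 0 < ξ₁)
    (hW : ContDiffOn ℝ ∞ W (Ioi 0)) (ha : 0 < a) {ℓ : ℝ} (hℓ : 0 < ℓ)
    (hlim : Tendsto (fun τ => outerPart n A γ η₀ b θ ξ₁ τ) atTop (𝓝 ℓ)) :
    Tendsto (shift n A γ η₀ b θ a ξ₁ W) atTop (𝓝 (W (a * ℓ) - ξ₁)) ∧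
    (∀ᶠ τ in atTop, DifferentiableAt ℝ (shift n A γ η₀ b θ a ξ₁ W) τ) ∧
    Tendsto (fun τ => Real.exp (-γ * τ) * deriv (shift n A γ η₀ b θ a ξ₁ W) τ) atTop (𝓝 0) := by
  have haℓ : 0 < a * ℓ := mul_pos ha hℓ
  have hWc : ContinuousAt W (a * ℓ) := hW.continuousOn.continuousAt (Ioi_mem_nhds haℓ)
  have hWd : ContinuousAt (deriv W) (a * ℓ) :=
    (hW.continuousOn_deriv_of_isOpen isOpen_Ioi (by simp)).continuousAt (Ioi_mem_nhds haℓ)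
  have hal := hlim.const_mul a
  have hd : ∀ᶠ τ in atTop, HasDerivAt (shift n A γ η₀ b θ a ξ₁ W)
      (deriv W (a * outerPart n A γ η₀ b θ ξ₁ τ) *
        (a * deriv (fun t => outerPart n A γ η₀ b θ ξ₁ t) τ)) τ := by
    filter_upwards [hlim.eventually_const_lt hℓ] with τ hτ
    have h1 : DifferentiableAt ℝ W (a * outerPart n A γ η₀ b θ ξ₁ τ) :=
      (hW.differentiableOn (by simp)).differentiableAt (Ioi_mem_nhds (mul_pos ha hτ))
    have h2 := ((contDiff_outerPart_time (b := b) (θ := θ) hn hA hγ hη₀ hξ₁).differentiable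
      (by simp) τ).hasDerivAt.const_mul a
    exact (h1.hasDerivAt.comp τ h2).sub_const ξ₁
  refine ⟨(hWc.tendsto.comp hal).sub_const ξ₁, hd.mono fun τ h => h.differentiableAt, ?_⟩
  have h := ((hWd.tendsto.comp hal).mul ((tendsto_exp_mul_deriv_outerPart_time (b := b) (θ := θ)
    hn hA hγ hη₀ hξ₁).const_mul a))
  simp only [mul_zero] at h
  refine h.congr' ?_
  filter_upwards [hd] with τ hτ
  rw [hτ.deriv]
  simp only [Function.comp]
  ring

/-- The operator applied to a multiple of a moving profile. -/
theorem innerOp_inner (hn : 3 ≤ n) (h : IsProfile ((n : ℝ) - 2) (γ * A / ((n : ℝ) - 1)) w p)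
    (ha : a ≠ 0) {C : ℝ → ℝ} {ξ τ : ℝ} (hC : DifferentiableAt ℝ C τ) :
    innerOp n A γ (fun ξ τ => 1 / a * w (ξ + C τ)) ξ τ = w (ξ + C τ) / a *
      (p (ξ + C τ) * (Real.exp (-γ * τ) * deriv C τ) - Real.exp (-γ * τ) * (1 + γ) +
        γ * A * p (ξ + C τ) * (a - 1)) := by
  have hn' : (3 : ℝ) ≤ n := by exact_mod_cast hn
  have hm : (n : ℝ) - 1 ≠ 0 := by linarith
  have hw := (h.pos (ξ + C τ)).ne'
  have h1 : deriv (fun t => 1 / a * w (ξ + C t)) τ =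
      1 / a * (w (ξ + C τ) * p (ξ + C τ) * deriv C τ) :=
    (((h.deriv_w (ξ + C τ)).comp τ (hC.hasDerivAt.const_add ξ)).const_mul (1 / a)).deriv
  have h2 : (deriv fun x => 1 / a * w (x + C τ)) = fun x => 1 / a * deriv w (x + C τ) := by
    funext x
    rw [(((h.deriv_w (x + C τ)).comp_add_const x (C τ)).const_mul (1 / a)).deriv,
      (h.deriv_w _).deriv]
  have hdd : HasDerivAt (deriv w) (deriv (deriv w) (ξ + C τ)) (ξ + C τ) :=
    DifferentiableAt.hasDerivAt (by
      rw [funext fun t => (h.deriv_w t).deriv]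
      exact ((h.deriv_w _).mul (h.deriv_p _)).differentiableAt)
  have h3 : deriv (fun x => 1 / a * deriv w (x + C τ)) ξ =
      1 / a * deriv (deriv w) (ξ + C τ) := ((hdd.comp_add_const ξ (C τ)).const_mul (1 / a)).deriv
  -- `w''/w` and `(w'/w)²` ignore the factor `1/a`, but `γAw'` does not. After using the profile
  -- equation the mismatch is `γAw'(1 - 1/a)`.
  unfold innerOp
  rw [h1, h2, h3, h.deriv_deriv]
  beta_reduce
  rw [(h.deriv_w _).deriv]
  field_simp
  ring

/-- After factoring out `w/a > 0`, the main term `γAp(a - 1)` is bounded away from zero on `ξ ≤ ξ₁`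
because `p` is decreasing. The error terms are uniformly small since `p ≤ 2`. -/
theorem eventually_innerOp_inner_sign (hn : 3 ≤ n) (hA : 0 < A) (hγ : 0 < γ)
    (h : IsProfile ((n : ℝ) - 2) (γ * A / ((n : ℝ) - 1)) w p) (ha : 0 < a) (ha1 : a - 1 ≠ 0)
    {C : ℝ → ℝ} {C₀ : ℝ} (hC₀ : Tendsto C atTop (𝓝 C₀))
    (hC : ∀ᶠ τ in atTop, DifferentiableAt ℝ C τ)
    (hC' : Tendsto (fun τ => Real.exp (-γ * τ) * deriv C τ) atTop (𝓝 0)) (ξ₁ : ℝ) :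
    ∀ᶠ τ in atTop, ∀ ξ ≤ ξ₁,
      0 < (a - 1) * innerOp n A γ (fun ξ τ => 1 / a * w (ξ + C τ)) ξ τ := by
  have hn' : (3 : ℝ) ≤ n := by exact_mod_cast hn
  have hm : 0 < (n : ℝ) - 1 := by linarith
  have hc : 0 < (n : ℝ) - 2 := by linarith
  have hκ : 0 < γ * A / ((n : ℝ) - 1) := by positivity
  -- Eventually `C τ < C₀ + 1`, so by monotonicity this is a lower bound for `p` on the whole inner
  -- region.
  set q := p (ξ₁ + (C₀ + 1)) with hq
  have hq0 : 0 < q := h.p_pos hc hκ _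
  have hδ : Tendsto (fun τ => Real.exp (-γ * τ)) atTop (𝓝 0) :=
    (tendsto_exp_neg_mul hγ).mono_right nhdsWithin_le_nhds
  have hlim := ((hC'.abs.const_mul 2).add (hδ.mul_const (1 + γ)))
  simp only [abs_zero, mul_zero, zero_mul, add_zero] at hlim
  have hs : 0 < |a - 1| := abs_pos.2 ha1
  filter_upwards [hC, hC₀.eventually_lt_const (lt_add_one C₀),
    hlim.eventually_lt_const (by positivity : 0 < γ * A * q * |a - 1|)] with τ h1 h2 h3 ξ hξ
  rw [innerOp_inner hn h ha.ne' h1]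
  have hp0 := h.p_pos hc hκ (ξ + C τ)
  have hp2 := h.p_le_two hc hκ (ξ + C τ)
  have hpq : q ≤ p (ξ + C τ) := h.antitone_p hc hκ (by linarith)
  have hw := h.pos (ξ + C τ)
  set P := p (ξ + C τ)
  set D := Real.exp (-γ * τ) * deriv C τ
  have hδ0 := Real.exp_pos (-γ * τ)
  set δ := Real.exp (-γ * τ)
  have e : (a - 1) * (w (ξ + C τ) / a * (P * D - δ * (1 + γ) + γ * A * P * (a - 1))) =
      w (ξ + C τ) / a * (γ * A * P * |a - 1| ^ 2 + (a - 1) * (P * D - δ * (1 + γ))) := by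
    rw [sq_abs]; ring
  rw [e]
  refine mul_pos (by positivity) ?_
  have h4 : |(a - 1) * (P * D - δ * (1 + γ))| ≤ |a - 1| * (2 * |D| + δ * (1 + γ)) := by
    rw [abs_mul]
    gcongr
    refine (abs_sub _ _).trans ?_
    rw [abs_mul, abs_of_pos hp0, abs_of_pos (by positivity : 0 < δ * (1 + γ))]
    gcongr
  have h5 : |a - 1| * (2 * |D| + δ * (1 + γ)) < |a - 1| * (γ * A * q * |a - 1|) := by gcongr
  have h6 : |a - 1| * (γ * A * q * |a - 1|) ≤ γ * A * P * |a - 1| ^ 2 := by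
    calc _ = γ * A * q * |a - 1| ^ 2 := by ring
      _ ≤ _ := by gcongr
  have := (abs_le.1 h4).1
  linarith

theorem glued_of_le {C : ℝ → ℝ} {ξ τ : ℝ} (hξ : ξ ≤ ξ₁) :
    glued n A γ η₀ b θ w a ξ₁ C ξ τ = 1 / a * w (ξ + C τ) := if_pos hξ

theorem glued_of_lt {C : ℝ → ℝ} {ξ τ : ℝ} (hξ : ξ₁ < ξ) :
    glued n A γ η₀ b θ w a ξ₁ C ξ τ = outerPart n A γ η₀ b θ ξ τ := if_neg hξ.not_ge

theorem contDiffOn_inner (hw : ContDiff ℝ ∞ w) {C : ℝ → ℝ} (hC : ContDiffOn ℝ ∞ C (Ici τ₀)) :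
    ContDiffOn ℝ ∞ (fun q : ℝ × ℝ => 1 / a * w (q.1 + C q.2)) (univ ×ˢ Ici τ₀) :=
  contDiffOn_const.mul (hw.comp_contDiffOn (contDiff_fst.contDiffOn.add
    (hC.comp contDiff_snd.contDiffOn fun _ hq => hq.2)))

theorem continuousOn_glued (hn : 3 ≤ n) (hA : 0 < A) (hγ : 0 < γ) (hη₀ : A < η₀) (hξ₁ : 0 < ξ₁)
    (hw : ContDiff ℝ ∞ w) {C : ℝ → ℝ} (hC : IsGluingShift n A γ η₀ b θ w a ξ₁ τ₀ C) :
    ContinuousOn (fun q : ℝ × ℝ => glued n A γ η₀ b θ w a ξ₁ C q.1 q.2) (univ ×ˢ Ici τ₀) := by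
  unfold glued
  have hfr : frontier {q : ℝ × ℝ | q.1 ≤ ξ₁} ⊆ {q | q.1 = ξ₁} :=
    frontier_le_subset_eq continuous_fst continuous_const
  have hcl : closure {q : ℝ × ℝ | ¬ q.1 ≤ ξ₁} ⊆ {q | ξ₁ ≤ q.1} :=
    closure_minimal (fun q hq => (not_le.1 hq).le) (isClosed_le continuous_const continuous_fst)
  refine ContinuousOn.if (fun q hq => ?_) ((contDiffOn_inner hw hC.1).continuousOn.mono
    inter_subset_left) ?_
  · rw [show q.1 = ξ₁ from hfr hq.2]
    exact ((hC.2 q.2 hq.1.2 _).2 rfl).symm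
  · refine (contDiffOn_outerPart hn hA hγ hη₀).continuousOn.mono fun q hq => ⟨?_, mem_univ _⟩
    exact hξ₁.trans_le (hcl hq.2)

theorem contDiffOn_glued (hn : 3 ≤ n) (hA : 0 < A) (hγ : 0 < γ) (hη₀ : A < η₀) (hξ₁ : 0 < ξ₁)
    (hw : ContDiff ℝ ∞ w) {C : ℝ → ℝ} (hC : IsGluingShift n A γ η₀ b θ w a ξ₁ τ₀ C) :
    ContDiffOn ℝ ∞ (fun q : ℝ × ℝ => glued n A γ η₀ b θ w a ξ₁ C q.1 q.2)
      ({ξ₁}ᶜ ×ˢ Ici τ₀) := by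
  intro q hq
  rcases lt_or_gt_of_ne (show q.1 ≠ ξ₁ from hq.1) with h | h
  · refine (((contDiffOn_inner hw hC.1) q ⟨mem_univ _, hq.2⟩).mono
      (prod_mono (subset_univ _) Subset.rfl)).congr_of_eventuallyEq ?_ (glued_of_le h.le)
    refine Filter.Eventually.filter_mono nhdsWithin_le_nhds ?_
    filter_upwards [(isOpen_lt continuous_fst continuous_const).mem_nhds h] with x hx
      using glued_of_le (le_of_lt hx)
  · refine ContDiffWithinAt.congr_of_eventuallyEq (ContDiffAt.contDiffWithinAt
      ((contDiffOn_outerPart (b := b) (θ := θ) hn hA hγ hη₀).contDiffAt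
      ((isOpen_Ioi.prod isOpen_univ).mem_nhds ⟨hξ₁.trans h, mem_univ _⟩))) ?_ (glued_of_lt h)
    refine Filter.Eventually.filter_mono nhdsWithin_le_nhds ?_
    filter_upwards [(isOpen_lt continuous_const continuous_fst).mem_nhds h] with x hx
      using glued_of_lt hx

theorem tendsto_deriv_glued (hn : 3 ≤ n) (hA : 0 < A) (hγ : 0 < γ) (hη₀ : A < η₀) (hξ₁ : 0 < ξ₁)
    (hw : ContDiff ℝ ∞ w) (C : ℝ → ℝ) (τ : ℝ) :
    Tendsto (fun ξ => deriv (fun x => glued n A γ η₀ b θ w a ξ₁ C x τ) ξ) (𝓝[<] ξ₁)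
      (𝓝 (1 / a * deriv w (ξ₁ + C τ))) ∧
    Tendsto (fun ξ => deriv (fun x => glued n A γ η₀ b θ w a ξ₁ C x τ) ξ) (𝓝[>] ξ₁)
      (𝓝 (deriv (fun x => outerPart n A γ η₀ b θ x τ) ξ₁)) := by
  constructor
  · have hc : Continuous fun ξ => 1 / a * deriv w (ξ + C τ) :=
      continuous_const.mul ((hw.continuous_deriv (by simp)).comp (continuous_add_const _))
    refine (hc.continuousWithinAt (x := ξ₁) (s := Iio ξ₁)).tendsto.congr' ?_
    filter_upwards [self_mem_nhdsWithin] with ξ (hξ : ξ < ξ₁)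
    have hev : (fun x => glued n A γ η₀ b θ w a ξ₁ C x τ) =ᶠ[𝓝 ξ] fun x => 1 / a * w (x + C τ) := by
      filter_upwards [gt_mem_nhds hξ] with x hx using glued_of_le (le_of_lt hx)
    rw [hev.deriv_eq, (((hw.differentiable (by simp) (ξ + C τ)).hasDerivAt.comp_add_const ξ
      (C τ)).const_mul (1 / a)).deriv]
  · have hc := (hasDerivAt_deriv_outerPart_space (b := b) (θ := θ) (τ := τ) hn hA hγ hη₀
      hξ₁).continuousAt.continuousWithinAt (s := Ioi ξ₁)
    refine hc.tendsto.congr' ?_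
    filter_upwards [self_mem_nhdsWithin] with ξ (hξ : ξ₁ < ξ)
    have hev : (fun x => glued n A γ η₀ b θ w a ξ₁ C x τ) =ᶠ[𝓝 ξ]
        fun x => outerPart n A γ η₀ b θ x τ := by
      filter_upwards [lt_mem_nhds hξ] with x hx using glued_of_lt hx
    rw [hev.deriv_eq]

/-- One barrier: for `a` close to `1`, on the side of `1` prescribed by `θ`, the glued function is a
strict super- or subsolution away from `ξ₁` whose derivative jumps in the right direction. -/
theorem exists_glued (hn : 3 ≤ n) (hA : 0 < A) (hγ : 0 < γ) (hη₀ : A < η₀)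
    (h : IsProfile ((n : ℝ) - 2) κ w p) (hκ : κ = γ * A / ((n : ℝ) - 1))
    (hW : ContDiffOn ℝ ∞ W (Ioi 0)) (hwW : ∀ y, 0 < y → w (W y) = y) (hWw : ∀ t, W (w t) = t)
    (hξ₁ : 0 < ξ₁) {σ : ℝ} (hout : ∀ ξ τ, ξ₁ ≤ ξ → τ₀ ≤ τ → 0 < outerPart n A γ η₀ b θ ξ τ ∧
      0 < σ * innerOp n A γ (outerPart n A γ η₀ b θ) ξ τ)
    (hℓ : 0 < ((n : ℝ) - 2) / κ * ξ₁ + θ / κ / ξ₁)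
    (hgap : 0 < σ * (deriv w (W (((n : ℝ) - 2) / κ * ξ₁ + θ / κ / ξ₁)) -
      (((n : ℝ) - 2) / κ - θ / κ / ξ₁ ^ 2))) :
    ∃ ε₁ : ℝ, 0 < ε₁ ∧ ∀ a, 0 < a → |a - 1| < ε₁ → 0 < σ * (a - 1) →
      ∃ C : ℝ → ℝ, IsGluingShift n A γ η₀ b θ w a ξ₁ τ₀ C ∧ ∃ τ₁, ∀ τ, τ₁ ≤ τ →
        (∀ ξ, ξ ≠ ξ₁ → 0 < σ * innerOp n A γ (glued n A γ η₀ b θ w a ξ₁ C) ξ τ) ∧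
        0 < σ * (1 / a * deriv w (ξ₁ + C τ) -
          deriv (fun x => outerPart n A γ η₀ b θ x τ) ξ₁) := by
  set ℓ := ((n : ℝ) - 2) / κ * ξ₁ + θ / κ / ξ₁
  set d := ((n : ℝ) - 2) / κ - θ / κ / ξ₁ ^ 2
  have hlim := tendsto_outerPart (b := b) (θ := θ) hn hA hγ hη₀ hξ₁ hκ
  have hlim' := tendsto_deriv_outerPart_space (b := b) (θ := θ) hn hA hγ hη₀ hξ₁ hκ
  have hdw : Continuous (deriv w) := h.contDiff.continuous_deriv (by simp)
  have hWc : ∀ y, 0 < y → ContinuousAt W y := fun y hy =>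
    hW.continuousOn.continuousAt (Ioi_mem_nhds hy)
  -- The limiting jump of the slope, as a function of `a`, has a strict sign at `a = 1`. Continuity
  -- determines `ε₁`.
  have hcont : ContinuousAt (fun a => σ * (1 / a * deriv w (W (a * ℓ)) - d)) 1 := by
    have h1 : ContinuousAt (fun a => W (a * ℓ)) 1 :=
      ContinuousAt.comp (g := W) (hWc _ (by simpa)) (by fun_prop)
    have h2 := hdw.continuousAt.comp h1
    exact continuousAt_const.mul (((continuousAt_const.div continuousAt_id one_ne_zero).mul
      h2).sub continuousAt_const)
  have h1 : 0 < σ * (1 / 1 * deriv w (W (1 * ℓ)) - d) := by simpa using hgap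
  obtain ⟨ε₁, hε₁, hball⟩ := Metric.eventually_nhds_iff.1 (hcont.eventually_const_lt h1)
  refine ⟨ε₁, hε₁, fun a ha ha1 hσ => ?_⟩
  have hga := hball (by rwa [Real.dist_eq] : dist a 1 < ε₁)
  have hs1 : a - 1 ≠ 0 := by rintro h0; simp [h0] at hσ
  have hshift := isGluingShift_shift (θ := θ) (b := b) hn hA hγ hη₀ hξ₁ hW hwW hWw ha
    fun τ hτ => (hout ξ₁ τ le_rfl hτ).1
  obtain ⟨c1, c2, c3⟩ := tendsto_shift (W := W) (θ := θ) (b := b) hn hA hγ hη₀ hξ₁ hW ha hℓ hlim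
  set C := shift n A γ η₀ b θ a ξ₁ W with hC
  have hin := eventually_innerOp_inner_sign hn hA hγ (hκ ▸ h) ha hs1 c1 c2 c3 ξ₁
  have hjump : Tendsto (fun τ => σ * (1 / a * deriv w (ξ₁ + C τ) -
      deriv (fun x => outerPart n A γ η₀ b θ x τ) ξ₁)) atTop
      (𝓝 (σ * (1 / a * deriv w (W (a * ℓ)) - d))) := by
    have := (hdw.tendsto _).comp (c1.const_add ξ₁)
    rw [add_sub_cancel] at this
    exact ((this.const_mul (1 / a)).sub hlim').const_mul σ
  obtain ⟨τ₁, hτ₁⟩ := eventually_atTop.1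
    ((hin.and (hjump.eventually_const_lt hga)).and (eventually_ge_atTop τ₀))
  refine ⟨C, hshift, τ₁, fun τ hτ => ⟨fun ξ hξ => ?_, (hτ₁ τ hτ).1.2⟩⟩
  rcases lt_or_gt_of_ne hξ with hlt | hlt
  · rw [innerOp_congr (g := fun ξ τ => 1 / a * w (ξ + C τ)) (funext fun t => glued_of_le hlt.le)
      (by filter_upwards [gt_mem_nhds hlt] with x hx using glued_of_le (le_of_lt hx))]
    have h3 := (hτ₁ τ hτ).1.1 ξ hlt.le
    -- `σ` and `a - 1` have the same sign, so the inner sign transfers to `σ`.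
    have h4 : 0 < (σ * (a - 1)) * ((a - 1) * innerOp n A γ (fun ξ τ => 1 / a * w (ξ + C τ)) ξ τ) :=
      mul_pos hσ h3
    refine pos_of_mul_pos_right (a := (a - 1) ^ 2) ?_ (by positivity)
    linarith
  · rw [innerOp_congr (g := outerPart n A γ η₀ b θ) (funext fun t => glued_of_lt hlt)
      (by filter_upwards [lt_mem_nhds hlt] with x hx using glued_of_lt hx)]
    exact (hout ξ τ hlt.le (hτ₁ τ hτ).2).2

end glue


/-! ### Ordering of the two barriers and the main theorem. -/

/-- The quotient of two translates of a profile is monotone. -/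
theorem IsProfile.antitone_translate_div {c κ : ℝ} {w p : ℝ → ℝ} (h : IsProfile c κ w p)
    (hc : 0 < c) (hκ : 0 < κ) {C₁ C₂ : ℝ} (hC : C₂ ≤ C₁) :
    Antitone fun x => w (x + C₁) / w (x + C₂) := by
  have hd : ∀ x, HasDerivAt (fun x => w (x + C₁) / w (x + C₂))
      (w (x + C₁) / w (x + C₂) * (p (x + C₁) - p (x + C₂))) x := by
    intro x
    have h0 := (h.pos (x + C₂)).ne'
    refine (((h.deriv_w _).comp_add_const x C₁).div ((h.deriv_w _).comp_add_const x C₂)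
      h0).congr_deriv ?_
    field_simp
  refine antitone_of_deriv_nonpos (fun x => (hd x).differentiableAt) fun x => ?_
  rw [(hd x).deriv]
  have h1 := h.antitone_p hc hκ (by linarith : x + C₂ ≤ x + C₁)
  exact mul_nonpos_of_nonneg_of_nonpos (div_pos (h.pos _) (h.pos _)).le (by linarith)

end YamabeBarrier

open YamabeBarrier in
theorem mainTheorem7 (n : ℕ) (hn : 3 ≤ n) (γ A : ℝ) (hγ : 0 < γ) (hA : 0 < A)
    (θp θm : ℝ) (hθp : ((n : ℝ) - 6) / 4 < θp) (hθm : θm < ((n : ℝ) - 6) / 4)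
    (η₀ b : ℝ) (hη₀ : A < η₀) :
    (∃ w₀ : ℝ → ℝ, IsSteadySoliton n A γ w₀) ∧
    ∀ w₀ : ℝ → ℝ, IsSteadySoliton n A γ w₀ →
    ∃ τ₀ ξ₁ ε₁ : ℝ, 0 < ξ₁ ∧ 0 < ε₁ ∧ ε₁ ≤ 1 ∧
    ∀ ε : ℝ, 0 < ε → ε < ε₁ →
    ∃ C₁ C₂ : ℝ → ℝ,
      IsGluingShift n A γ η₀ b θp w₀ (1 + ε) ξ₁ τ₀ C₁ ∧
      IsGluingShift n A γ η₀ b θm w₀ (1 - ε) ξ₁ τ₀ C₂ ∧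
    ∃ τ₁ : ℝ, τ₀ < τ₁ ∧
    ∀ wp wm : ℝ → ℝ → ℝ,
      wp = glued n A γ η₀ b θp w₀ (1 + ε) ξ₁ C₁ →
      wm = glued n A γ η₀ b θm w₀ (1 - ε) ξ₁ C₂ →
      (∀ ξ τ : ℝ, τ₁ ≤ τ → wm ξ τ < wp ξ τ ∧ 0 < wm ξ τ) ∧
      (ContinuousOn (fun q : ℝ × ℝ => wp q.1 q.2) (univ ×ˢ Ici τ₁) ∧
        ContinuousOn (fun q : ℝ × ℝ => wm q.1 q.2) (univ ×ˢ Ici τ₁) ∧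
        ContDiffOn ℝ ∞ (fun q : ℝ × ℝ => wp q.1 q.2) ({ξ₁}ᶜ ×ˢ Ici τ₁) ∧
        ContDiffOn ℝ ∞ (fun q : ℝ × ℝ => wm q.1 q.2) ({ξ₁}ᶜ ×ˢ Ici τ₁)) ∧
      (∀ ξ τ : ℝ, ξ ≠ ξ₁ → τ₁ ≤ τ →
        0 < innerOp n A γ wp ξ τ ∧ innerOp n A γ wm ξ τ < 0) ∧
      (∀ τ : ℝ, τ₁ ≤ τ →
        (∃ dl dr : ℝ,
          Tendsto (fun ξ => deriv (fun x => wp x τ) ξ) (𝓝[<] ξ₁) (𝓝 dl) ∧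
          Tendsto (fun ξ => deriv (fun x => wp x τ) ξ) (𝓝[>] ξ₁) (𝓝 dr) ∧ dr < dl) ∧
        (∃ dl dr : ℝ,
          Tendsto (fun ξ => deriv (fun x => wm x τ) ξ) (𝓝[<] ξ₁) (𝓝 dl) ∧
          Tendsto (fun ξ => deriv (fun x => wm x τ) ξ) (𝓝[>] ξ₁) (𝓝 dr) ∧ dl < dr)) := by
  have hn' : (3 : ℝ) ≤ n := by exact_mod_cast hn
  have hm : 0 < (n : ℝ) - 1 := by linarith
  have hc : 0 < (n : ℝ) - 2 := by linarith
  refine ⟨exists_isSteadySoliton hn hγ hA, fun w₀ hw₀ => ?_⟩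
  obtain ⟨κ, hκe⟩ : ∃ κ, κ = γ * A / ((n : ℝ) - 1) := ⟨_, rfl⟩
  have hκ : 0 < κ := by rw [hκe]; positivity
  have h := hw₀.isProfile hn
  rw [← hκe] at h
  obtain ⟨W, hW, hwW, hWw⟩ := h.exists_inverse hc hκ
  have eα : ((n : ℝ) - 2) / 4 - 1 = ((n : ℝ) - 6) / 4 := by ring
  have hsp : θp - ((n : ℝ) - 6) / 4 ≠ 0 := by linarith
  have hsm : θm - ((n : ℝ) - 6) / 4 ≠ 0 := by linarith
  obtain ⟨hp, hp0, hpout⟩ := exists_outerPart_sign (b := b) hn hA hγ hη₀ hsp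
  obtain ⟨hm', hm0, hmout⟩ := exists_outerPart_sign (b := b) hn hA hγ hη₀ hsm
  -- Half of the threshold is spent on `e^(-γτ)`, which fixes `τ₀`, and half on `1/ξ`, which
  -- constrains `ξ₁`.
  obtain ⟨g, hg⟩ : ∃ g, g = min hp hm' / 2 := ⟨_, rfl⟩
  have hg0 : 0 < g := by rw [hg]; positivity
  have hgp : g + g ≤ hp := by rw [hg]; linarith [min_le_left hp hm']
  have hgm : g + g ≤ hm' := by rw [hg]; linarith [min_le_right hp hm']
  have hℓ : ∀ θ : ℝ, ∀ᶠ ξ : ℝ in atTop, 0 < ((n : ℝ) - 2) / κ * ξ + θ / κ / ξ := fun θ =>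
    ((tendsto_id.const_mul_atTop (by positivity : 0 < ((n : ℝ) - 2) / κ)).atTop_add
      (tendsto_const_nhds.div_atTop tendsto_id)).eventually_gt_atTop 0
  have hinv : ∀ᶠ ξ : ℝ in atTop, 1 / ξ < g :=
    (tendsto_const_nhds.div_atTop tendsto_id).eventually_lt_const hg0
  obtain ⟨ξ₁, ⟨⟨⟨⟨⟨hξ₁, hξg⟩, hℓp⟩, hℓm⟩, hgapp⟩, hgapm⟩⟩ := (((((eventually_gt_atTop 0).and
    hinv).and (hℓ θp)).and (hℓ θm)).and (h.eventually_slope_gap hc hκ (θ := θp) (by rwa [eα]) hwW)).and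
    (h.eventually_slope_gap hc hκ (θ := θm) (by rwa [eα]) hwW) |>.exists
  rw [eα] at hgapp hgapm
  obtain ⟨τ₀, hτ₀⟩ := eventually_atTop.1 (((tendsto_exp_neg_mul hγ).mono_right
    nhdsWithin_le_nhds).eventually_lt_const hg0)
  have hsmall : ∀ ξ τ, ξ₁ ≤ ξ → τ₀ ≤ τ → Real.exp (-γ * τ) + 1 / ξ ≤ g + g := fun ξ τ hξ hτ =>
    add_le_add (hτ₀ τ hτ).le ((one_div_le_one_div_of_le hξ₁ hξ).trans hξg.le)
  have houtp : ∀ ξ τ, ξ₁ ≤ ξ → τ₀ ≤ τ → _ := fun ξ τ hξ hτ =>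
    hpout ξ τ (hξ₁.trans_le hξ) ((hsmall ξ τ hξ hτ).trans hgp)
  have houtm : ∀ ξ τ, ξ₁ ≤ ξ → τ₀ ≤ τ → _ := fun ξ τ hξ hτ =>
    hmout ξ τ (hξ₁.trans_le hξ) ((hsmall ξ τ hξ hτ).trans hgm)
  obtain ⟨εp, hεp, hgluep⟩ := exists_glued hn hA hγ hη₀ h hκe hW hwW hWw hξ₁ houtp hℓp hgapp
  obtain ⟨εm, hεm, hgluem⟩ := exists_glued hn hA hγ hη₀ h hκe hW hwW hWw hξ₁ houtm hℓm hgapm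
  refine ⟨τ₀, ξ₁, min 1 (min εp εm), hξ₁, by positivity, min_le_left _ _, fun ε hε hε1 => ?_⟩
  have hε₁ := hε1.trans_le (min_le_left _ _)
  have hεp' := hε1.trans_le ((min_le_right _ _).trans (min_le_left _ _))
  have hεm' := hε1.trans_le ((min_le_right _ _).trans (min_le_right _ _))
  have hap : 0 < 1 + ε := by linarith
  have ham : 0 < 1 - ε := by linarith
  obtain ⟨C₁, hC₁, τp, hτp⟩ := hgluep (1 + ε) hap
    (by rwa [add_sub_cancel_left, abs_of_pos hε])
    (by rw [add_sub_cancel_left]; exact mul_pos (by linarith) hε)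
  obtain ⟨C₂, hC₂, τm, hτm⟩ := hgluem (1 - ε) ham
    (by rwa [sub_sub_cancel_left, abs_neg, abs_of_pos hε])
    (by rw [sub_sub_cancel_left]; exact mul_pos_of_neg_of_neg (by linarith) (by linarith))
  refine ⟨C₁, C₂, hC₁, hC₂, max (τ₀ + 1) (max τp τm), (lt_add_one τ₀).trans_le (le_max_left _ _), ?_⟩
  rintro wp wm rfl rfl
  have h0 : ∀ τ, max (τ₀ + 1) (max τp τm) ≤ τ → τ₀ ≤ τ ∧ τp ≤ τ ∧ τm ≤ τ := fun τ hτ =>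
    ⟨by linarith [(le_max_left _ _).trans hτ], (le_max_left _ _).trans ((le_max_right _ _).trans hτ),
      (le_max_right _ _).trans ((le_max_right _ _).trans hτ)⟩
  have hsub : Ici (max (τ₀ + 1) (max τp τm)) ⊆ Ici τ₀ := fun τ hτ => (h0 τ hτ).1
  have hw := h.contDiff
  refine ⟨fun ξ τ hτ => ?_, ⟨?_, ?_, ?_, ?_⟩, fun ξ τ hξ hτ => ⟨?_, ?_⟩, fun τ hτ => ⟨?_, ?_⟩⟩
  · obtain ⟨ht0, -, -⟩ := h0 τ hτ
    have hlt : ∀ x, 0 < x → outerPart n A γ η₀ b θm x τ < outerPart n A γ η₀ b θp x τ := fun x hx =>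
      outerPart_strictMono_param hn hA hγ hx (by linarith)
    rcases le_or_gt ξ ξ₁ with hle | hgt
    · rw [glued_of_le hle, glued_of_le hle]
      have e1 := (hC₁.2 τ ht0 _).2 rfl
      have e2 := (hC₂.2 τ ht0 _).2 rfl
      have hl := hlt ξ₁ hξ₁
      have hpos2 := h.pos (ξ + C₂ τ)
      refine ⟨?_, by positivity⟩
      rw [e1, e2] at hl
      have hb1 := h.pos (ξ₁ + C₁ τ)
      have hb2 := h.pos (ξ₁ + C₂ τ)
      rw [one_div_mul_eq_div, one_div_mul_eq_div, div_lt_div_iff₀ ham hap] at hl ⊢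
      -- The outer barriers are ordered at `ξ₁` and `1 - ε < 1 + ε`, so the soliton values, and
      -- hence their arguments, are ordered too.
      have hC : C₂ τ ≤ C₁ τ := by
        have : w₀ (ξ₁ + C₂ τ) < w₀ (ξ₁ + C₁ τ) := by nlinarith
        have := (h.strictMono_w hc hκ).lt_iff_lt.1 this
        linarith
      -- Moving left from `ξ₁` only increases the quotient of the two translates, so the strict
      -- order at `ξ₁` persists.
      have hanti := h.antitone_translate_div hc hκ hC hle
      beta_reduce at hanti
      rw [div_le_div_iff₀ hb2 hpos2] at hanti
      refine lt_of_mul_lt_mul_left ?_ hb2.le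
      calc w₀ (ξ₁ + C₂ τ) * (w₀ (ξ + C₂ τ) * (1 + ε))
          = w₀ (ξ + C₂ τ) * (w₀ (ξ₁ + C₂ τ) * (1 + ε)) := by ring
        _ < w₀ (ξ + C₂ τ) * (w₀ (ξ₁ + C₁ τ) * (1 - ε)) := by gcongr
        _ = w₀ (ξ₁ + C₁ τ) * w₀ (ξ + C₂ τ) * (1 - ε) := by ring
        _ ≤ w₀ (ξ + C₁ τ) * w₀ (ξ₁ + C₂ τ) * (1 - ε) := by gcongr
        _ = _ := by ring
    · rw [glued_of_lt hgt, glued_of_lt hgt]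
      exact ⟨hlt ξ (hξ₁.trans hgt), (houtm ξ τ hgt.le ht0).1⟩
  · exact (continuousOn_glued hn hA hγ hη₀ hξ₁ hw hC₁).mono (prod_mono Subset.rfl hsub)
  · exact (continuousOn_glued hn hA hγ hη₀ hξ₁ hw hC₂).mono (prod_mono Subset.rfl hsub)
  · exact (contDiffOn_glued hn hA hγ hη₀ hξ₁ hw hC₁).mono (prod_mono Subset.rfl hsub)
  · exact (contDiffOn_glued hn hA hγ hη₀ hξ₁ hw hC₂).mono (prod_mono Subset.rfl hsub)
  · exact pos_of_mul_pos_right ((hτp τ (h0 τ hτ).2.1).1 ξ hξ) (by linarith)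
  · exact neg_of_mul_pos_right ((hτm τ (h0 τ hτ).2.2).1 ξ hξ) (by linarith)
  · obtain ⟨hl, hr⟩ := tendsto_deriv_glued (a := 1 + ε) (b := b) (θ := θp) hn hA hγ hη₀ hξ₁ hw C₁ τ
    exact ⟨_, _, hl, hr, sub_pos.1
      (pos_of_mul_pos_right (hτp τ (h0 τ hτ).2.1).2 (by linarith))⟩
  · obtain ⟨hl, hr⟩ := tendsto_deriv_glued (a := 1 - ε) (b := b) (θ := θm) hn hA hγ hη₀ hξ₁ hw C₂ τ
    exact ⟨_, _, hl, hr, sub_neg.1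
      (neg_of_mul_pos_right (hτm τ (h0 τ hτ).2.2).2 (by linarith))⟩
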